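/- Let $\ell$ be a prime. A subgroup $G\le \mathrm{GL}_4(\mathbb F_\ell)$ is called *Hasse* if every $g\in G$ has an eigenvalue in $\mathbb F_\ell$ and $G$ acts irreducibly on $\mathbb F_\ell^4$. Fix a symplectic (alternating, nondegenerate) form on $\mathbb F_\ell^4$ with Gram matrix $J$; let $\mathrm{GSp}_4(\mathbb F_\ell)=\{M\in \mathrm{GL}_4(\mathbb F_\ell): M^TJM=kJ \text{ for some } k\in\mathbb F_\ell^\times\}$ and $\mathrm{Sp}_4(\mathbb F_\ell)=\{M: M^TJM=J\}$. Let $C_n$ be the cyclic group of order $n$. Let $C_s\le\mathrm{GL}_2(\mathbb F_\ell)$ be the group of invertible diagonal matrices, $N_{\mathrm{GL}_2(\mathbb F_\ell)}(C_s)$ its normaliser and $N(C_s)=N_{\mathrm{GL}_2(\mathbb F_\ell)}(C_s)\cap \mathrm{SL}_2(\mathbb F_\ell)$. For $G\le\mathrm{GL}_4(\mathbb F_\ell)$ let $\mathbb PG$ be its image in $\mathrm{PGL}_4(\mathbb F_\ell)$. **Theorem.** Let $G$ be a maximal (with respect to inclusion) Hasse subgroup of $\mathrm{GSp}_4(\mathbb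 F_\ell)$ such that $G^1:=G\cap \mathrm{Sp}_4(\mathbb F_\ell)$ acts reducibly on $\mathbb F_\ell^4$. Let $K=\mathbb F_\ell^\times\cdot G^1$ be the group generated by $G^1$ and the scalar matrices. Then at least one of the following holds. 1. $\ell\equiv 1\pmod 4$; $K$ is a subgroup of $G$ of index $2$, and $G^1$ is normal in $K$ with $K/G^1\cong C_{(\ell-1)/2}$ (this is the meaning of $G=(C_{(\ell-1)/2}.G^1).2$). There is a basis of $\mathbb F_\ell^4$ in which the form has Gram matrix $\begin{pmatrix}0&1&0&0\\-1&0&0&0\\0&0&0&1\\0&0&-1&0\end{pmatrix}$ and in which every element of $G^1$ is of the form $\begin{pmatrix}a&0\\0&d\end{pmatrix}$ with $a,d\in N(C_s)$. Here $N(C_s)$ is isomorphic to the generalised quaternion group $Q_{2(\ell-1)}$ of order $2(\ell-1)$. Moreover $\mathbb F_\ell^4$ is the direct sum of two $G^1$-stable subspaces of dimension $2$ which are non-singular (the form restricts to a nondegenerate form on each of them). 2. $\ell\equiv 3\pmod 4$, and there is a subgroup $H$ of index $2$ in $N_{\mathrm{GL}_2(\mathbb F_\ell)}(C_s)$ such that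 $G=(C_{(\ell-1)/2}.H).2$, in the following sense: $K$ is a subgroup of $G$ of index $2$; $K$ has a normal subgroup isomorphic to $C_{(\ell-1)/2}$ with quotient isomorphic to $H$; and in a suitable basis of $\mathbb F_\ell^4$, in which the form has Gram matrix $\begin{pmatrix}0&0&-1&0\\0&0&0&-1\\1&0&0&0\\0&1&0&0\end{pmatrix}$, one has $G^1=\left\{\begin{pmatrix}A&0\\0&A^{-T}\end{pmatrix}: A\in H\right\}$, where $A^{-T}$ is the inverse transpose of $A$. Moreover $\mathbb F_\ell^4$ is the direct sum of two $G^1$-stable totally isotropic subspaces of dimension $2$. 3. $|\mathbb PG|\le 2^7\cdot 3^2\cdot 5^2$. -/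

import Mathlib

open scoped MatrixGroups Matrix

noncomputable section

namespace HasseSubgroup

/-! ### Property (E), irreducibility, Hasse subgroups -/

section Hasse

/-- `W` is stable under the natural action of `G ≤ GL_n(F)` on column vectors. -/
def IsStable {n : ℕ} {F : Type*} [Field F] (G : Subgroup (GL (Fin n) F))
    (W : Submodule F (Fin n → F)) : Prop :=
  ∀ g ∈ G, ∀ v ∈ W, (g : Matrix (Fin n) (Fin n) F) *ᵥ v ∈ W

/-- `G ≤ GL_n(F)` acts irreducibly on `F^n`. -/
def ActsIrreducibly {n : ℕ} {F : Type*} [Field F] (G : Subgroup (GL (Fin n) F)) : Prop :=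
  0 < n ∧ ∀ W : Submodule F (Fin n → F), IsStable G W → W = ⊥ ∨ W = ⊤

/-- `G ≤ GL_n(F)` acts reducibly on `F^n`. -/
def ActsReducibly {n : ℕ} {F : Type*} [Field F] (G : Subgroup (GL (Fin n) F)) : Prop :=
  ¬ ActsIrreducibly G

/-- Property (E): every element of `G` has an eigenvalue in `F`. -/
def HasPropertyE {n : ℕ} {F : Type*} [Field F] (G : Subgroup (GL (Fin n) F)) : Prop :=
  ∀ g ∈ G, ∃ a : F,
    Module.End.HasEigenvalue (Matrix.toLin' (g : Matrix (Fin n) (Fin n) F)) a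

/-- `G` is Hasse: it has property (E) and acts irreducibly. -/
def IsHasse {n : ℕ} {F : Type*} [Field F] (G : Subgroup (GL (Fin n) F)) : Prop :=
  HasPropertyE G ∧ ActsIrreducibly G

/-- `G` is a maximal Hasse subgroup of `A`: it is maximal with respect to inclusion among
the Hasse subgroups of `GL_n(F)` that are contained in `A`. -/
def IsMaximalHasseIn {n : ℕ} {F : Type*} [Field F] (A G : Subgroup (GL (Fin n) F)) : Prop :=
  Maximal (fun H : Subgroup (GL (Fin n) F) => H ≤ A ∧ IsHasse H) G

/-- The group `F^× · Id` of scalar matrices. -/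
def scalars (n : ℕ) (F : Type*) [Field F] : Subgroup (GL (Fin n) F) :=
  (Matrix.GeneralLinearGroup.scalar (Fin n) : Fˣ →* GL (Fin n) F).range

/-- The saturation of `G`: the subgroup generated by `G` and the scalar matrices. -/
def saturation {n : ℕ} {F : Type*} [Field F] (G : Subgroup (GL (Fin n) F)) :
    Subgroup (GL (Fin n) F) :=
  G ⊔ scalars n F

/-- The image `ℙG` of `G` in `PGL_n(F)`. -/
def projImage {n : ℕ} {F : Type*} [Field F] (G : Subgroup (GL (Fin n) F)) :
    Subgroup (Matrix.ProjGenLinGroup (Fin n) F) :=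
  G.map Matrix.ProjGenLinGroup.mk

end Hasse

/-! ### Symplectic groups of an arbitrary symplectic form -/

section Symplectic

/-- `J` is the Gram matrix of a symplectic (alternating and nondegenerate) form. -/
def IsSymplecticForm {n : ℕ} {F : Type*} [Field F] (J : Matrix (Fin n) (Fin n) F) : Prop :=
  (Matrix.toBilin' J).IsAlt ∧ (Matrix.toBilin' J).Nondegenerate

/-- The general symplectic group of the form `J`. -/
def GSp {n : ℕ} {F : Type*} [Field F] (J : Matrix (Fin n) (Fin n) F) :
    Subgroup (GL (Fin n) F) where
  carrier := {M | ∃ k : Fˣ,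
    (M : Matrix (Fin n) (Fin n) F)ᵀ * J * (M : Matrix (Fin n) (Fin n) F) = (k : F) • J}
  one_mem' := ⟨1, by simp⟩
  mul_mem' := by
    rintro a b ⟨k, hk⟩ ⟨m, hm⟩
    refine ⟨k * m, ?_⟩
    rw [Units.val_mul, Matrix.transpose_mul,
      show (b : Matrix (Fin n) (Fin n) F)ᵀ * (a : Matrix (Fin n) (Fin n) F)ᵀ * J * (a * b)
        = (b : Matrix (Fin n) (Fin n) F)ᵀ * ((a : Matrix (Fin n) (Fin n) F)ᵀ * J * a) * b by
        simp only [Matrix.mul_assoc], hk, Matrix.mul_smul, Matrix.smul_mul, hm, smul_smul,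
      Units.val_mul]
  inv_mem' := by
    rintro a ⟨k, hk⟩
    refine ⟨k⁻¹, ?_⟩
    have h1 : (a : Matrix (Fin n) (Fin n) F) * (a⁻¹ : GL (Fin n) F) = 1 := by
      rw [← Units.val_mul, mul_inv_cancel, Units.val_one]
    have h2 : ((a⁻¹ : GL (Fin n) F) : Matrix (Fin n) (Fin n) F)ᵀ
        * (a : Matrix (Fin n) (Fin n) F)ᵀ = 1 := by
      rw [← Matrix.transpose_mul, h1, Matrix.transpose_one]
    have h3 : ((a⁻¹ : GL (Fin n) F) : Matrix (Fin n) (Fin n) F)ᵀ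
        * ((a : Matrix (Fin n) (Fin n) F)ᵀ * J * a) * (a⁻¹ : GL (Fin n) F) = J := by
      simp only [Matrix.mul_assoc]
      rw [h1, Matrix.mul_one, ← Matrix.mul_assoc, h2, Matrix.one_mul]
    rw [hk, Matrix.mul_smul, Matrix.smul_mul] at h3
    rw [← h3, smul_smul, h3, Units.inv_mul, one_smul]

/-- The symplectic group of the form `J`: the elements of `GSp J` with multiplier `1`. -/
def Sp {n : ℕ} {F : Type*} [Field F] (J : Matrix (Fin n) (Fin n) F) :
    Subgroup (GL (Fin n) F) where
  carrier := {M |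
    (M : Matrix (Fin n) (Fin n) F)ᵀ * J * (M : Matrix (Fin n) (Fin n) F) = J}
  one_mem' := by simp
  mul_mem' := by
    rintro a b (hk : _ = _) (hm : _ = _)
    change _ = _
    rw [Units.val_mul, Matrix.transpose_mul,
      show (b : Matrix (Fin n) (Fin n) F)ᵀ * (a : Matrix (Fin n) (Fin n) F)ᵀ * J * (a * b)
        = (b : Matrix (Fin n) (Fin n) F)ᵀ * ((a : Matrix (Fin n) (Fin n) F)ᵀ * J * a) * b by
        simp only [Matrix.mul_assoc], hk, hm]
  inv_mem' := by
    rintro a (hk : _ = _)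
    change _ = _
    have h1 : (a : Matrix (Fin n) (Fin n) F) * (a⁻¹ : GL (Fin n) F) = 1 := by
      rw [← Units.val_mul, mul_inv_cancel, Units.val_one]
    have h2 : ((a⁻¹ : GL (Fin n) F) : Matrix (Fin n) (Fin n) F)ᵀ
        * (a : Matrix (Fin n) (Fin n) F)ᵀ = 1 := by
      rw [← Matrix.transpose_mul, h1, Matrix.transpose_one]
    have h3 : ((a⁻¹ : GL (Fin n) F) : Matrix (Fin n) (Fin n) F)ᵀ
        * ((a : Matrix (Fin n) (Fin n) F)ᵀ * J * a) * (a⁻¹ : GL (Fin n) F) = J := by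
      simp only [Matrix.mul_assoc]
      rw [h1, Matrix.mul_one, ← Matrix.mul_assoc, h2, Matrix.one_mul]
    rwa [hk] at h3

/-- The subspace `V` is non-singular: the form `J` restricts to a nondegenerate form on it. -/
def IsNonsingular {n : ℕ} {F : Type*} [Field F] (J : Matrix (Fin n) (Fin n) F)
    (V : Submodule F (Fin n → F)) : Prop :=
  ((Matrix.toBilin' J).restrict V).Nondegenerate

/-- The subspace `V` is totally isotropic: the form `J` vanishes identically on it. -/
def IsTotallyIsotropic {n : ℕ} {F : Type*} [Field F] (J : Matrix (Fin n) (Fin n) F)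
    (V : Submodule F (Fin n → F)) : Prop :=
  ∀ v ∈ V, ∀ w ∈ V, Matrix.toBilin' J v w = 0

/-- The standard symplectic form for which `⟨e₁, e₂⟩` and `⟨e₃, e₄⟩` are non-singular
and orthogonal to each other. -/
def formNonsingular (F : Type*) [Field F] : Matrix (Fin 4) (Fin 4) F :=
  !![0, 1, 0, 0; -1, 0, 0, 0; 0, 0, 0, 1; 0, 0, -1, 0]

/-- The standard symplectic form for which `⟨e₁, e₂⟩` and `⟨e₃, e₄⟩` are totally isotropic. -/
def formIsotropic (F : Type*) [Field F] : Matrix (Fin 4) (Fin 4) F :=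
  !![0, 0, -1, 0; 0, 0, 0, -1; 1, 0, 0, 0; 0, 1, 0, 0]

end Symplectic

/-! ### Split Cartan subgroups and block-diagonal matrices -/

section Cartan

/-- The split Cartan subgroup of `GL_2(F)`: the invertible diagonal matrices. -/
def splitCartan (F : Type*) [Field F] : Subgroup (GL (Fin 2) F) :=
  (Units.map (Matrix.diagonalRingHom (Fin 2) F).toMonoidHom).range

/-- The normaliser in `GL_2(F)` of the split Cartan subgroup. -/
def splitNormalizerGL (F : Type*) [Field F] : Subgroup (GL (Fin 2) F) :=
  Subgroup.normalizer (splitCartan F : Set (GL (Fin 2) F))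

/-- `N(C_s)`: the intersection with `SL_2(F)` of the normaliser of the split Cartan subgroup
of `GL_2(F)`, regarded as a subgroup of `GL_2(F)`. -/
def splitNormalizerSL (F : Type*) [Field F] : Subgroup (GL (Fin 2) F) :=
  splitNormalizerGL F ⊓ (Matrix.GeneralLinearGroup.det : GL (Fin 2) F →* Fˣ).ker

/-- The embedding `(A, D) ↦ diag(A, D)` of `GL_2(F) × GL_2(F)` into `GL_4(F)`. -/
def blockDiag (F : Type*) [Field F] : GL (Fin 2) F × GL (Fin 2) F →* GL (Fin 4) F where
  toFun p :=
    { val := Matrix.reindex finSumFinEquiv finSumFinEquiv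
        (Matrix.fromBlocks (p.1 : Matrix (Fin 2) (Fin 2) F) 0 0 (p.2 : Matrix (Fin 2) (Fin 2) F))
      inv := Matrix.reindex finSumFinEquiv finSumFinEquiv
        (Matrix.fromBlocks ((p.1⁻¹ : GL (Fin 2) F) : Matrix (Fin 2) (Fin 2) F) 0 0
          ((p.2⁻¹ : GL (Fin 2) F) : Matrix (Fin 2) (Fin 2) F))
      val_inv := by
        simp only [Matrix.reindex_apply, Matrix.submatrix_mul_equiv, Matrix.fromBlocks_multiply,
          Matrix.mul_zero, Matrix.zero_mul, add_zero, zero_add, Units.mul_inv,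
          Matrix.fromBlocks_one, Matrix.submatrix_one_equiv]
      inv_val := by
        simp only [Matrix.reindex_apply, Matrix.submatrix_mul_equiv, Matrix.fromBlocks_multiply,
          Matrix.mul_zero, Matrix.zero_mul, add_zero, zero_add, Units.inv_mul,
          Matrix.fromBlocks_one, Matrix.submatrix_one_equiv] }
  map_one' := by
    apply Units.ext
    simp only [Prod.fst_one, Prod.snd_one, Units.val_one, Matrix.reindex_apply,
      Matrix.fromBlocks_one, Matrix.submatrix_one_equiv]
  map_mul' p q := by
    apply Units.ext
    simp only [Prod.fst_mul, Prod.snd_mul, Units.val_mul, Matrix.reindex_apply,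
      Matrix.submatrix_mul_equiv, Matrix.fromBlocks_multiply,
      Matrix.mul_zero, Matrix.zero_mul, add_zero, zero_add]

/-- The inverse transpose `A ↦ A^{-T}` on `GL_2(F)`. -/
def invTranspose (F : Type*) [Field F] : GL (Fin 2) F →* GL (Fin 2) F where
  toFun A :=
    { val := ((A⁻¹ : GL (Fin 2) F) : Matrix (Fin 2) (Fin 2) F)ᵀ
      inv := (A : Matrix (Fin 2) (Fin 2) F)ᵀ
      val_inv := by
        rw [← Matrix.transpose_mul, Units.mul_inv, Matrix.transpose_one]
      inv_val := by
        rw [← Matrix.transpose_mul, Units.inv_mul, Matrix.transpose_one] }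
  map_one' := by
    apply Units.ext
    simp
  map_mul' A B := by
    apply Units.ext
    simp only [mul_inv_rev, Units.val_mul, Matrix.transpose_mul]

/-- The embedding `A ↦ diag(A, A^{-T})` of `GL_2(F)` into `GL_4(F)`. -/
def blockDiagInvTranspose (F : Type*) [Field F] : GL (Fin 2) F →* GL (Fin 4) F :=
  (blockDiag F).comp ((MonoidHom.id (GL (Fin 2) F)).prod (invTranspose F))

/-- The conjugate `P⁻¹ G P`: the group `G` written in the basis given by the columns of `P`. -/
def inBasis {n : ℕ} {F : Type*} [Field F] (P : GL (Fin n) F) (G : Subgroup (GL (Fin n) F)) :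
    Subgroup (GL (Fin n) F) :=
  G.map (MulAut.conj P⁻¹).toMonoidHom

/-- The columns of `P` form a basis in which the form with Gram matrix `J` has
Gram matrix `J'`. -/
def CarriesForm {n : ℕ} {F : Type*} [Field F] (P : GL (Fin n) F)
    (J J' : Matrix (Fin n) (Fin n) F) : Prop :=
  (P : Matrix (Fin n) (Fin n) F)ᵀ * J * (P : Matrix (Fin n) (Fin n) F) = J'

end Cartan

end HasseSubgroup

end

/-! By maximality `G` contains the scalars. A scalar `c` has multiplier `c ^ 2`, so `K` consists of
the elements of `G` whose multiplier is a square. If `K` were all of `G`, then `G¹` would be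
irreducible because `G` is. Hence `ℓ` is odd and `K` has index two (`relIndex_saturation`). Fix `g`
in `G` with nonsquare multiplier. Clifford's argument shows that a nonzero proper `G¹`-stable
subspace `W` is complementary to `gW` (`IsStable.isCompl_map`), so `W` is a plane. The radical of
the form on `W` is stable too, so `W` is totally isotropic or non-singular (`exists_stable_plane`).
These two alternatives lead to cases 2 and 1, the latter with case 3 as its exceptions.

Both alternatives reduce to `2 × 2` matrices. Call such a matrix split when its discriminant is a
square, that is, when it has an eigenvector over `F_ℓ`. A group with no stable line that contains a
nonscalar matrix of discriminant zero contains `SL₂` (`mem_of_disc_eq_zero`). Without such matrices,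
every nonscalar element fixes exactly two points of the projective line over `F_{ℓ²}`, and Klein's
orbit count (`stable_pair_or_exceptional`) leaves two possibilities: a stable pair of lines, or
projective order 12, 24 or 60.

Isotropic planes. In adapted bases `G¹` is `{diag(A, A^{-T}) : A ∈ H}`, every `A` is split, and `g`
is block antidiagonal with an upper block `B`. Having an eigenvalue on the coset of `g` amounts to a
condition on `B` (`trace_or_det_of_eigenvalue`): `B` is symmetric and `-1` is a nonsquare, or `B` is
not symmetric and has nonsquare determinant. Since `A^{-T}` is conjugate to `A` by the Weyl element
up to a scalar, this becomes a condition on traces and determinants in a coset normalising `H` in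
`PGL₂`. If `-1` were a square, that coset would have no element of trace zero, that is, no
projective involution, and both of Klein's possibilities would supply one. So `-1` is a nonsquare.
Split groups then have no projective subgroup of order four, which rules out the exceptional orders,
and `H` permutes two rational lines (`exists_pair_of_coset`). The determinants put `H` inside
`squareMonomial`, and maximality gives equality (`inf_Sp_eq_squareMonomial`).

Non-singular planes. Here `G¹` lies in `SL₂ × SL₂`, each element has a split component, and after a
twist `g` provides a symmetry interchanging the components (`exists_twist`). If the first projection
is `SL₂`, then for `ℓ ≥ 5` Goursat's lemma and the simplicity of `PSL₂` produce a pair that is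
non-split in both components, a contradiction. An exceptional projection has order at most 120, so
`G¹` has order at most 120². A stable pair is either rational, which gives case 1, or leaves at most
16 elements (`exists_pair_or_card_le`). The bound in case 3 is `2 * 120 ^ 2`. -/

noncomputable section

namespace HasseSubgroup

/-! ### Klein's orbit count for groups whose nontrivial elements fix two points -/

section Counting

variable {Γ S : Type*} [Group Γ] [MulAction Γ S]

open MulAction

/-- Double counting of the pairs `(γ, s)` with `γ ≠ 1` and `γ • s = s`. -/
theorem sum_card_stabilizer_sub_one [Finite Γ] [Fintype S]
    (h2 : ∀ γ : Γ, γ ≠ 1 → (fixedBy S γ).ncard = 2) :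
    ∑ s : S, (Nat.card (stabilizer Γ s) - 1) = 2 * (Nat.card Γ - 1) := by
  classical
  have := Fintype.ofFinite Γ
  have hA : ∀ s : S, Nat.card (stabilizer Γ s) - 1
      = ((Finset.univ.filter fun γ : Γ => γ ≠ 1).filter fun γ => γ • s = s).card := by
    intro s
    have h0 : Nat.card (stabilizer Γ s) = (Finset.univ.filter fun γ : Γ => γ • s = s).card := by
      rw [Nat.card_eq_fintype_card, Fintype.card_subtype]
      simp only [mem_stabilizer_iff]
    have h3 : ((Finset.univ.filter fun γ : Γ => γ ≠ 1).filter fun γ => γ • s = s)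
        = (Finset.univ.filter fun γ : Γ => γ • s = s).erase 1 := by
      ext γ; simp
    rw [h0, h3, Finset.card_erase_of_mem (by simp)]
  have hB : ∀ γ ∈ (Finset.univ.filter fun γ : Γ => γ ≠ 1),
      (Finset.univ.filter fun s : S => γ • s = s).card = 2 := by
    intro γ hγ
    rw [← h2 γ (by simpa using hγ), ← Set.ncard_coe_finset]
    congr 1
    ext s
    simp
  simp only [hA, Finset.card_filter]
  rw [Finset.sum_comm]
  simp only [← Finset.card_filter]
  rw [Finset.sum_congr rfl hB]
  simp only [Finset.sum_const, smul_eq_mul]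
  rw [mul_comm, Finset.filter_ne' Finset.univ (1 : Γ), Finset.card_erase_of_mem (by simp),
    Finset.card_univ, Nat.card_eq_fintype_card]

theorem ncard_orbit_mul_card_stabilizer (s : S) :
    (orbit Γ s).ncard * Nat.card (stabilizer Γ s) = Nat.card Γ := by
  rw [← Nat.card_coe_set_eq, ← Nat.card_prod]
  exact Nat.card_congr (orbitProdStabilizerEquivGroup Γ s)

theorem card_stabilizer_of_mem_orbit [Finite S] {s t : S} (h : t ∈ orbit Γ s) :
    Nat.card (stabilizer Γ t) = Nat.card (stabilizer Γ s) := by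
  have h1 := ncard_orbit_mul_card_stabilizer (Γ := Γ) s
  have h2 := ncard_orbit_mul_card_stabilizer (Γ := Γ) t
  rw [orbit_eq_iff.mpr h, ← h1] at h2
  have : 0 < (orbit Γ s).ncard := by
    rw [Set.ncard_pos (Set.toFinite _)]; exact ⟨s, mem_orbit_self s⟩
  exact Nat.eq_of_mul_eq_mul_left this h2

/-- Stabilizers along an orbit share one order `e`, and the orbit has `N / e` points. It therefore
contributes `N` minus its size to the double count. -/
theorem sum_orbit_card_stabilizer [Finite Γ] [Fintype S] [DecidableEq S] (s : S) (T : Finset S)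
    (hT : ∀ t, t ∈ T ↔ t ∈ orbit Γ s) :
    ∑ t ∈ T, (Nat.card (stabilizer Γ t) - 1) + (orbit Γ s).ncard = Nat.card Γ := by
  have h1 : ∀ t ∈ T, Nat.card (stabilizer Γ t) - 1 = Nat.card (stabilizer Γ s) - 1 := fun t ht => by
    rw [card_stabilizer_of_mem_orbit ((hT t).1 ht)]
  have h2 : T.card = (orbit Γ s).ncard := by
    rw [← Set.ncard_coe_finset]; congr 1; ext t; simp [hT]
  have h3 := ncard_orbit_mul_card_stabilizer (Γ := Γ) s
  have h4 : 0 < Nat.card (stabilizer Γ s) := Nat.card_pos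
  rw [Finset.sum_congr rfl h1, Finset.sum_const, smul_eq_mul, h2, ← h3]
  obtain ⟨e, he⟩ : ∃ e, Nat.card (stabilizer Γ s) = e + 1 := ⟨_, (Nat.succ_pred_eq_of_pos h4).symm⟩
  rw [he]; simp; ring

/-- The solutions of `1/e₁ + 1/e₂ + 1/e₃ = 1 + 2/N` in which `e₃` is the largest. -/
theorem platonic_arith_aux {N n₁ n₂ n₃ e₁ e₂ e₃ : ℕ} (h₁ : n₁ * e₁ = N)
    (h₂ : n₂ * e₂ = N) (h₃ : n₃ * e₃ = N) (he₁ : 2 ≤ e₁) (h12 : e₁ ≤ e₂) (h23 : e₂ ≤ e₃)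
    (hs : n₁ + n₂ + n₃ = N + 2) :
    n₃ = 2 ∨ (N = 12 ∧ e₁ = 2 ∧ e₂ = 3 ∧ e₃ = 3) ∨ (N = 24 ∧ e₁ = 2 ∧ e₂ = 3 ∧ e₃ = 4) ∨
      (N = 60 ∧ e₁ = 2 ∧ e₂ = 3 ∧ e₃ = 5) := by
  -- If all `eᵢ ≥ 3`, then the three quotients add up to at most `N`, short of `N + 2`. The same
  -- comparison with `N/2 + N/4 + N/4` bounds `e₂`, and with `N/2 + N/3 + N/6` bounds `e₃`.
  have h1 : e₁ = 2 := by
    by_contra h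
    have h3 : 3 ≤ e₁ := by omega
    have := Nat.mul_le_mul_left n₁ h3
    have := Nat.mul_le_mul_left n₂ (h3.trans h12)
    have := Nat.mul_le_mul_left n₃ ((h3.trans h12).trans h23)
    omega
  subst h1
  have h2 : e₂ = 2 ∨ e₂ = 3 := by
    by_contra h
    have h4 : 4 ≤ e₂ := by omega
    have := Nat.mul_le_mul_left n₂ h4
    have := Nat.mul_le_mul_left n₃ (h4.trans h23)
    omega
  rcases h2 with rfl | rfl
  · left; omega
  · right
    have h6 : e₃ < 6 := by
      by_contra h
      have := Nat.mul_le_mul_left n₃ (not_lt.1 h)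
      omega
    interval_cases e₃ <;> omega

/-- This keeps only what the involution argument uses: outside the cyclic and dihedral situations,
stabilizers have order two or odd order, except for a single orbit with stabilizers of order four
when `N = 24`. -/
theorem platonic_arith {N n₁ n₂ n₃ e₁ e₂ e₃ : ℕ} (h₁ : n₁ * e₁ = N)
    (h₂ : n₂ * e₂ = N) (h₃ : n₃ * e₃ = N) (he₁ : 2 ≤ e₁) (he₂ : 2 ≤ e₂) (he₃ : 2 ≤ e₃)
    (hs : n₁ + n₂ + n₃ = N + 2) :
    (n₁ = 2 ∨ n₂ = 2 ∨ n₃ = 2) ∨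
      ((N = 12 ∨ N = 60) ∧ (e₁ = 2 ∨ Odd e₁) ∧ (e₂ = 2 ∨ Odd e₂) ∧ (e₃ = 2 ∨ Odd e₃)) ∨
      (N = 24 ∧ ((e₁ = 4 ∧ (e₂ = 2 ∨ Odd e₂) ∧ (e₃ = 2 ∨ Odd e₃)) ∨
        (e₂ = 4 ∧ (e₁ = 2 ∨ Odd e₁) ∧ (e₃ = 2 ∨ Odd e₃)) ∨
        (e₃ = 4 ∧ (e₁ = 2 ∨ Odd e₁) ∧ (e₂ = 2 ∨ Odd e₂)))) := by
  have o3 : Odd 3 := by decide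
  have o5 : Odd 5 := by decide
  rcases le_total e₁ e₂ with a | a <;> rcases le_total e₂ e₃ with b | b <;>
    rcases le_total e₁ e₃ with c | c
  · rcases platonic_arith_aux h₁ h₂ h₃ he₁ a b (by omega) with
      h | ⟨h, rfl, rfl, rfl⟩ | ⟨h, rfl, rfl, rfl⟩ | ⟨h, rfl, rfl, rfl⟩ <;> simp [*]
  · rcases platonic_arith_aux h₁ h₂ h₃ he₁ a b (by omega) with
      h | ⟨h, rfl, rfl, rfl⟩ | ⟨h, rfl, rfl, rfl⟩ | ⟨h, rfl, rfl, rfl⟩ <;> simp [*]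
  · rcases platonic_arith_aux h₁ h₃ h₂ he₁ c b (by omega) with
      h | ⟨h, rfl, rfl, rfl⟩ | ⟨h, rfl, rfl, rfl⟩ | ⟨h, rfl, rfl, rfl⟩ <;> simp [*]
  · rcases platonic_arith_aux h₃ h₁ h₂ he₃ c a (by omega) with
      h | ⟨h, rfl, rfl, rfl⟩ | ⟨h, rfl, rfl, rfl⟩ | ⟨h, rfl, rfl, rfl⟩ <;> simp [*]
  · rcases platonic_arith_aux h₂ h₁ h₃ he₂ a c (by omega) with
      h | ⟨h, rfl, rfl, rfl⟩ | ⟨h, rfl, rfl, rfl⟩ | ⟨h, rfl, rfl, rfl⟩ <;> simp [*]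
  · rcases platonic_arith_aux h₂ h₃ h₁ he₂ b c (by omega) with
      h | ⟨h, rfl, rfl, rfl⟩ | ⟨h, rfl, rfl, rfl⟩ | ⟨h, rfl, rfl, rfl⟩ <;> simp [*]
  · rcases platonic_arith_aux h₃ h₂ h₁ he₃ b a (by omega) with
      h | ⟨h, rfl, rfl, rfl⟩ | ⟨h, rfl, rfl, rfl⟩ | ⟨h, rfl, rfl, rfl⟩ <;> simp [*]
  · rcases platonic_arith_aux h₃ h₂ h₁ he₃ b a (by omega) with
      h | ⟨h, rfl, rfl, rfl⟩ | ⟨h, rfl, rfl, rfl⟩ | ⟨h, rfl, rfl, rfl⟩ <;> simp [*]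

/-- An element outside a subgroup of index two has even order, so it cannot lie in a stabilizer of
odd order. -/
theorem sq_eq_one_of_card_stabilizer {Γ' : Subgroup Γ} (hΓ' : Γ'.index = 2) {γ : Γ}
    (hγ : γ ∉ Γ') {s : S} (hs : γ • s = s)
    (he : Nat.card (stabilizer Γ s) = 2 ∨ Odd (Nat.card (stabilizer Γ s))) : γ ^ 2 = 1 := by
  have h1 : γ ^ Nat.card (stabilizer Γ s) = 1 := by
    have := pow_card_eq_one' (x := (⟨γ, hs⟩ : stabilizer Γ s))
    simpa using congrArg Subtype.val this
  rcases he with he | ⟨m, he⟩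
  · rwa [he] at h1
  · exfalso
    apply hγ
    have h2 : γ ^ (2 * m) ∈ Γ' := by
      rw [pow_mul]
      exact Γ'.pow_mem (Subgroup.sq_mem_of_index_two hΓ' γ) m
    rw [he, pow_succ] at h1
    have h3 : γ = (γ ^ (2 * m))⁻¹ := by
      rw [eq_inv_iff_mul_eq_one, ← h1]; exact ((Commute.refl γ).pow_right _).eq
    rw [h3]
    exact Γ'.inv_mem h2

/-- A stabilizer of order four type leaves too few elements outside a subgroup of index two. -/
theorem exists_sq_eq_one_of_order_24 [Finite Γ] [Fintype S] (h2 : ∀ γ : Γ, γ ≠ 1 → (fixedBy S γ).ncard = 2)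
    (hN : Nat.card Γ = 24) (s : S) (hs : Nat.card (stabilizer Γ s) = 4)
    (hall : ∀ t : S, Nat.card (stabilizer Γ t) ≠ 1 → t ∈ orbit Γ s ∨
      Nat.card (stabilizer Γ t) = 2 ∨ Odd (Nat.card (stabilizer Γ t)))
    {Γ' : Subgroup Γ} (hΓ' : Γ'.index = 2) : ∃ γ, γ ∉ Γ' ∧ γ ^ 2 = 1 := by
  classical
  have := Fintype.ofFinite Γ
  by_contra! hcon
  have key : ∀ γ ∉ Γ', ∀ t, γ • t = t → t ∈ orbit Γ s := by
    intro γ hγ t ht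
    have hγ1 : γ ≠ 1 := fun h => hγ (h ▸ Γ'.one_mem)
    have hst : Nat.card (stabilizer Γ t) ≠ 1 := fun h => hγ1 (by
      have h3 : γ ∈ stabilizer Γ t := ht
      rwa [Subgroup.card_eq_one.1 h] at h3)
    rcases hall t hst with h | h
    · exact h
    · exact absurd (sq_eq_one_of_card_stabilizer hΓ' hγ ht h) (hcon γ hγ)
  set C : Finset Γ := Finset.univ.filter fun γ => γ ∉ Γ' with hC
  set T : Finset S := Finset.univ.filter fun t => t ∈ orbit Γ s with hT
  have hTc : T.card = 6 := by
    have h3 := ncard_orbit_mul_card_stabilizer (Γ := Γ) s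
    have h4 : T.card = (orbit Γ s).ncard := by
      rw [← Set.ncard_coe_finset]; congr 1; ext t; simp [hT]
    rw [hs, hN] at h3
    omega
  have hCc : C.card = 12 := by
    have h3 := Γ'.card_mul_index
    rw [hΓ', hN] at h3
    have h4 : (Finset.univ.filter fun γ : Γ => γ ∈ Γ').card = Nat.card Γ' := by
      rw [Nat.card_eq_fintype_card, Fintype.card_subtype]
    have h5 := Finset.card_filter_add_card_filter_not (s := (Finset.univ : Finset Γ))
      (fun γ => γ ∈ Γ')
    rw [Finset.card_univ, ← Nat.card_eq_fintype_card, hN, h4] at h5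
    have h6 : C.card = (Finset.univ.filter fun γ : Γ => ¬ γ ∈ Γ').card := by
      rw [hC]
    omega
  have hcount : ∑ γ ∈ C, (T.filter fun t => γ • t = t).card
      = ∑ t ∈ T, (C.filter fun γ => γ • t = t).card := by
    simp only [Finset.card_filter]
    exact Finset.sum_comm
  have hl : ∀ γ ∈ C, (T.filter fun t => γ • t = t).card = 2 := by
    intro γ hγ
    have hγ' : γ ∉ Γ' := by simpa [hC] using hγ
    rw [← h2 γ (fun h => hγ' (h ▸ Γ'.one_mem)), ← Set.ncard_coe_finset]
    congr 1
    ext t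
    simp only [hT, Finset.coe_filter, Finset.mem_filter, Finset.mem_univ, true_and,
      Set.mem_ofPred_eq, mem_fixedBy]
    exact ⟨fun h => h.2, fun h => ⟨key γ hγ' t h, h⟩⟩
  have hr : ∀ t ∈ T, (C.filter fun γ => γ • t = t).card ≤ 3 := by
    intro t ht
    have h3 : Nat.card (stabilizer Γ t) = 4 := by
      rw [card_stabilizer_of_mem_orbit (by simpa [hT] using ht), hs]
    have h4 : (Finset.univ.filter fun γ : Γ => γ • t = t).card = 4 := by
      rw [← h3, Nat.card_eq_fintype_card, Fintype.card_subtype]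
      simp only [mem_stabilizer_iff]
    have h5 : (C.filter fun γ => γ • t = t) ⊆
        (Finset.univ.filter fun γ : Γ => γ • t = t).erase 1 := by
      intro γ hγ
      simp only [hC, Finset.mem_filter, Finset.mem_univ, true_and, Finset.mem_erase] at hγ ⊢
      exact ⟨fun h => hγ.1 (h ▸ Γ'.one_mem), hγ.2⟩
    have h6 := Finset.card_le_card h5
    rw [Finset.card_erase_of_mem (by simp), h4] at h6
    exact h6
  -- Twelve elements outside `Γ'`, each fixing two of the six points, give 24 incidences. Six
  -- stabilizers with at most three nontrivial elements each allow only 18.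
  rw [Finset.sum_congr rfl hl, Finset.sum_const, hCc] at hcount
  have := Finset.sum_le_card_nsmul T _ 3 hr
  rw [hTc] at this
  simp only [smul_eq_mul] at *
  omega

/-- The points `p` and `q` may coincide, so a global fixed point and an orbit of size two are
treated alike. -/
theorem pair_of_ncard_orbit_le_two [Finite S] {s : S} (h : (orbit Γ s).ncard = 1 ∨ (orbit Γ s).ncard = 2) :
    ∃ p q : S, ∀ γ : Γ, (γ • p = p ∧ γ • q = q) ∨ (γ • p = q ∧ γ • q = p) := by
  rcases h with h | h
  · obtain ⟨p, hp⟩ := Set.ncard_eq_one.1 h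
    refine ⟨p, p, fun γ => Or.inl ?_⟩
    have h1 : p ∈ orbit Γ s := by rw [hp]; rfl
    have h2 : γ • p ∈ orbit Γ s := by
      rw [← orbit_eq_iff.2 h1]; exact mem_orbit _ _
    rw [hp] at h2
    exact ⟨h2, h2⟩
  · obtain ⟨p, q, hpq, hp⟩ := Set.ncard_eq_two.1 h
    refine ⟨p, q, fun γ => ?_⟩
    have hst : ∀ t ∈ orbit Γ s, γ • t ∈ orbit Γ s := fun t ht => by
      rw [← orbit_eq_iff.2 ht]; exact mem_orbit _ _
    have h1 := hst p (by rw [hp]; simp)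
    have h2 := hst q (by rw [hp]; simp)
    have hne : γ • p ≠ γ • q := fun h => hpq (smul_left_cancel γ h)
    rw [hp] at h1 h2
    simp only [Set.mem_insert_iff, Set.mem_singleton_iff] at h1 h2
    rcases h1 with h1 | h1 <;> rcases h2 with h2 | h2
    · exact absurd (h1.trans h2.symm) hne
    · exact Or.inl ⟨h1, h2⟩
    · exact Or.inr ⟨h1, h2⟩
    · exact absurd (h1.trans h2.symm) hne

set_option maxHeartbeats 1000000 in
/-- A finite group acting so that each nontrivial element fixes exactly two points
either preserves a set of at most two points or is of one of the three exceptional orders. -/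
theorem stable_pair_or_exceptional [Finite Γ] [Finite S] [Nonempty S]
    (h2 : ∀ γ : Γ, γ ≠ 1 → (fixedBy S γ).ncard = 2) :
    (∃ p q : S, ∀ γ : Γ, (γ • p = p ∧ γ • q = q) ∨ (γ • p = q ∧ γ • q = p)) ∨
      ((Nat.card Γ = 12 ∨ Nat.card Γ = 24 ∨ Nat.card Γ = 60) ∧
        ∀ Γ' : Subgroup Γ, Γ'.index = 2 → ∃ γ, γ ∉ Γ' ∧ γ ^ 2 = 1) := by
  classical
  have := Fintype.ofFinite S
  set N := Nat.card Γ with hNdef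
  have hN0 : 0 < N := Nat.card_pos
  rcases Nat.lt_or_ge N 2 with hN | hN
  · left
    have h1 : N = 1 := by omega
    have := (Nat.card_eq_one_iff_unique.1 h1).1
    obtain ⟨p⟩ := ‹Nonempty S›
    exact ⟨p, p, fun γ => Or.inl (by rw [Subsingleton.elim γ 1]; simp)⟩
  set f : S → ℕ := fun s => Nat.card (stabilizer Γ s) - 1 with hf
  have htot : ∑ s, f s = 2 * (N - 1) := sum_card_stabilizer_sub_one h2
  let O : S → Finset S := fun s => Finset.univ.filter fun t => t ∈ orbit Γ s
  have hO : ∀ s, ∑ t ∈ O s, f t + (orbit Γ s).ncard = N := fun s =>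
    sum_orbit_card_stabilizer s (O s) (by simp [O])
  have hdisj : ∀ s t, t ∉ O s → Disjoint (O s) (O t) := by
    intro s t hst
    rw [Finset.disjoint_left]
    intro x hx hx'
    simp only [O, Finset.mem_filter, Finset.mem_univ, true_and] at hx hx' hst
    apply hst
    rw [← orbit_eq_iff.2 hx, orbit_eq_iff.2 hx']
    exact mem_orbit_self t
  have hne : ∀ s : S, (orbit Γ s).ncard * Nat.card (stabilizer Γ s) = N :=
    ncard_orbit_mul_card_stabilizer
  have hpos : ∀ s : S, 0 < (orbit Γ s).ncard := fun s => by
    rw [Set.ncard_pos (Set.toFinite _)]; exact ⟨s, mem_orbit_self s⟩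
  have hhalf : ∀ s, f s ≠ 0 → 2 ≤ Nat.card (stabilizer Γ s) ∧ 2 * (orbit Γ s).ncard ≤ N := by
    intro s hs
    have h3 : 2 ≤ Nat.card (stabilizer Γ s) := by change Nat.card (stabilizer Γ s) - 1 ≠ 0 at hs; omega
    exact ⟨h3, by rw [← hne s, mul_comm]; exact Nat.mul_le_mul_left _ h3⟩
  have pick : ∀ T : Finset S, ∑ t ∈ T, f t < 2 * (N - 1) → ∃ s, s ∉ T ∧ f s ≠ 0 := by
    intro T hT
    by_contra! hcon
    have : ∑ t ∈ T, f t = ∑ s, f s := Finset.sum_subset (Finset.subset_univ _) (fun x _ hx => hcon x hx)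
    omega
  -- An orbit contributes `N` minus its size to the total `2 * (N - 1)`. One orbit never exhausts
  -- this total, and two exhaust it only if both are single points.
  obtain ⟨s₁, -, hs₁⟩ := pick ∅ (by simp; omega)
  obtain ⟨s₂, hs₂', hs₂⟩ := pick (O s₁) (by have := hO s₁; have := hpos s₁; omega)
  have hd12 := hdisj s₁ s₂ hs₂'
  have hsum12 : ∑ t ∈ O s₁ ∪ O s₂, f t = ∑ t ∈ O s₁, f t + ∑ t ∈ O s₂, f t :=
    Finset.sum_union hd12
  have e₁ := hO s₁
  have e₂ := hO s₂
  by_cases h12 : (orbit Γ s₁).ncard = 1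
  · exact Or.inl (pair_of_ncard_orbit_le_two (Or.inl h12))
  obtain ⟨s₃, hs₃', hs₃⟩ := pick (O s₁ ∪ O s₂) (by have := hpos s₁; have := hpos s₂; omega)
  have hd3 : Disjoint (O s₁ ∪ O s₂) (O s₃) := by
    rw [Finset.notMem_union] at hs₃'
    rw [Finset.disjoint_union_left]
    exact ⟨hdisj _ _ hs₃'.1, hdisj _ _ hs₃'.2⟩
  have hsum3 : ∑ t ∈ O s₁ ∪ O s₂ ∪ O s₃, f t
      = ∑ t ∈ O s₁, f t + ∑ t ∈ O s₂, f t + ∑ t ∈ O s₃, f t := by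
    rw [Finset.sum_union hd3, hsum12]
  have e₃ := hO s₃
  have b₁ := hhalf s₁ hs₁
  have b₂ := hhalf s₂ hs₂
  have b₃ := hhalf s₃ hs₃
  have hle : ∀ T : Finset S, ∑ t ∈ T, f t ≤ 2 * (N - 1) := fun T =>
    htot ▸ Finset.sum_le_sum_of_subset (Finset.subset_univ T)
  -- An orbit with nontrivial stabilizers contributes at least `N / 2`, so four of them would exceed
  -- `2 * (N - 1)`.
  have hlast : ∀ s, s ∉ O s₁ ∪ O s₂ ∪ O s₃ → f s = 0 := by
    intro s hs
    by_contra h0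
    have b := hhalf s h0
    have e := hO s
    have hd : Disjoint (O s₁ ∪ O s₂ ∪ O s₃) (O s) := by
      rw [Finset.notMem_union, Finset.notMem_union] at hs
      rw [Finset.disjoint_union_left, Finset.disjoint_union_left]
      exact ⟨⟨hdisj _ _ hs.1.1, hdisj _ _ hs.1.2⟩, hdisj _ _ hs.2⟩
    have h3 := hle (O s₁ ∪ O s₂ ∪ O s₃ ∪ O s)
    rw [Finset.sum_union hd, hsum3] at h3
    omega
  have hsum : (orbit Γ s₁).ncard + (orbit Γ s₂).ncard + (orbit Γ s₃).ncard = N + 2 := by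
    have : ∑ t ∈ O s₁ ∪ O s₂ ∪ O s₃, f t = ∑ s, f s :=
      Finset.sum_subset (Finset.subset_univ _) (fun x _ hx => hlast x hx)
    omega
  have hcover : ∀ t, Nat.card (stabilizer Γ t) ≠ 1 → t ∈ orbit Γ s₁ ∨ t ∈ orbit Γ s₂ ∨
      t ∈ orbit Γ s₃ := by
    intro t ht
    by_contra! hcon
    have h3 := hlast t (by simp [O, hcon.1, hcon.2.1, hcon.2.2])
    have h4 : 0 < Nat.card (stabilizer Γ t) := Nat.card_pos
    simp only [hf] at h3
    omega
  have hfix : ∀ γ : Γ, γ ≠ 1 → ∃ t : S, γ • t = t ∧ Nat.card (stabilizer Γ t) ≠ 1 := by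
    intro γ hγ
    obtain ⟨t, u, -, htu⟩ := Set.ncard_eq_two.1 (h2 γ hγ)
    have ht : t ∈ fixedBy S γ := by rw [htu]; simp
    refine ⟨t, ht, fun h => hγ ?_⟩
    have h3 : γ ∈ stabilizer Γ t := ht
    rw [Subgroup.card_eq_one.1 h] at h3
    simpa using h3
  rcases platonic_arith (hne s₁) (hne s₂) (hne s₃) b₁.1 b₂.1 b₃.1 hsum with
    h | ⟨h, h'⟩ | ⟨h, h'⟩
  · left
    rcases h with h | h | h <;> exact pair_of_ncard_orbit_le_two (Or.inr h)
  · right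
    refine ⟨h.imp_right Or.inr, fun Γ' hΓ' => ?_⟩
    obtain ⟨γ, hγ⟩ : ∃ γ, γ ∉ Γ' := by
      by_contra! hcon
      rw [(Subgroup.eq_top_iff' Γ').2 hcon, Subgroup.index_top] at hΓ'
      omega
    refine ⟨γ, hγ, ?_⟩
    obtain ⟨t, ht, ht1⟩ := hfix γ (fun h => hγ (h ▸ Γ'.one_mem))
    refine sq_eq_one_of_card_stabilizer hΓ' hγ ht ?_
    rcases hcover t ht1 with h3 | h3 | h3 <;> rw [card_stabilizer_of_mem_orbit h3]
    exacts [h'.1, h'.2.1, h'.2.2]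
  · right
    refine ⟨Or.inr (Or.inl h), fun Γ' hΓ' => ?_⟩
    rcases h' with ⟨h4, h5, h6⟩ | ⟨h4, h5, h6⟩ | ⟨h4, h5, h6⟩
    · refine exists_sq_eq_one_of_order_24 h2 h s₁ h4 (fun t ht => ?_) hΓ'
      rcases hcover t ht with h3 | h3 | h3
      · exact Or.inl h3
      · right; rwa [card_stabilizer_of_mem_orbit h3]
      · right; rwa [card_stabilizer_of_mem_orbit h3]
    · refine exists_sq_eq_one_of_order_24 h2 h s₂ h4 (fun t ht => ?_) hΓ'
      rcases hcover t ht with h3 | h3 | h3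
      · right; rwa [card_stabilizer_of_mem_orbit h3]
      · exact Or.inl h3
      · right; rwa [card_stabilizer_of_mem_orbit h3]
    · refine exists_sq_eq_one_of_order_24 h2 h s₃ h4 (fun t ht => ?_) hΓ'
      rcases hcover t ht with h3 | h3 | h3
      · right; rwa [card_stabilizer_of_mem_orbit h3]
      · right; rwa [card_stabilizer_of_mem_orbit h3]
      · exact Or.inl h3

end Counting

/-! ### Eigenlines, discriminants and traces of `2 × 2` matrices -/

section TwoByTwo

variable {F : Type*} [Field F]

/-- The determinant of two vectors of the plane. -/
def cross (v w : Fin 2 → F) : F := v 0 * w 1 - v 1 * w 0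

/-- The discriminant of the characteristic polynomial of a `2 × 2` matrix. -/
def disc (a : Matrix (Fin 2) (Fin 2) F) : F := a.trace ^ 2 - 4 * a.det

/-- `a` is a scalar matrix. -/
def IsScal (a : Matrix (Fin 2) (Fin 2) F) : Prop := a 0 1 = 0 ∧ a 1 0 = 0 ∧ a 0 0 = a 1 1

theorem disc_eq (a : Matrix (Fin 2) (Fin 2) F) :
    disc a = (a 0 0 - a 1 1) ^ 2 + 4 * (a 0 1 * a 1 0) := by
  rw [disc, Matrix.trace_fin_two, Matrix.det_fin_two]; ring

theorem mulVec_zero_eq (a : Matrix (Fin 2) (Fin 2) F) (v : Fin 2 → F) :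
    (a *ᵥ v) 0 = a 0 0 * v 0 + a 0 1 * v 1 := by
  simp [Matrix.mulVec, dotProduct, Fin.sum_univ_two]

theorem mulVec_one_eq (a : Matrix (Fin 2) (Fin 2) F) (v : Fin 2 → F) :
    (a *ᵥ v) 1 = a 1 0 * v 0 + a 1 1 * v 1 := by
  simp [Matrix.mulVec, dotProduct, Fin.sum_univ_two]

theorem cross_mulVec (a : Matrix (Fin 2) (Fin 2) F) (v : Fin 2 → F) :
    cross v (a *ᵥ v) = a 1 0 * v 0 ^ 2 + (a 1 1 - a 0 0) * (v 0 * v 1) - a 0 1 * v 1 ^ 2 := by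
  rw [cross, mulVec_zero_eq, mulVec_one_eq]; ring

theorem cross_mulVec_mulVec (a : Matrix (Fin 2) (Fin 2) F) (v w : Fin 2 → F) :
    cross (a *ᵥ v) (a *ᵥ w) = a.det * cross v w := by
  simp only [cross, mulVec_zero_eq, mulVec_one_eq, Matrix.det_fin_two]; ring

theorem cross_self (v : Fin 2 → F) : cross v v = 0 := by rw [cross]; ring

theorem cross_comm (v w : Fin 2 → F) : cross v w = - cross w v := by simp only [cross]; ring

theorem cross_eq_zero_comm {v w : Fin 2 → F} : cross v w = 0 ↔ cross w v = 0 := by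
  rw [cross_comm, neg_eq_zero]

theorem cross_smul_right (c : F) (v w : Fin 2 → F) : cross v (c • w) = c * cross v w := by
  simp only [cross, Pi.smul_apply, smul_eq_mul]; ring

theorem vec_ne_zero_iff {v : Fin 2 → F} : v ≠ 0 ↔ v 0 ≠ 0 ∨ v 1 ≠ 0 := by
  rw [Ne, funext_iff, Fin.forall_fin_two, not_and_or]; rfl

theorem exists_smul_of_cross {v w : Fin 2 → F} (hv : v ≠ 0) (h : cross v w = 0) :
    ∃ c : F, w = c • v := by
  rw [cross] at h
  rcases vec_ne_zero_iff.1 hv with h0 | h0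
  · refine ⟨w 0 / v 0, ?_⟩
    ext i; fin_cases i
    · simp [h0]
    · simp only [Fin.mk_one, Pi.smul_apply, smul_eq_mul]; field_simp; linear_combination h
  · refine ⟨w 1 / v 1, ?_⟩
    ext i; fin_cases i
    · simp only [Fin.zero_eta, Pi.smul_apply, smul_eq_mul]; field_simp; linear_combination -h
    · simp [h0]

theorem cross_trans {u v w : Fin 2 → F} (hv : v ≠ 0) (h1 : cross u v = 0) (h2 : cross v w = 0) :
    cross u w = 0 := by
  obtain ⟨c, rfl⟩ := exists_smul_of_cross hv h2
  rw [cross_smul_right, h1, mul_zero]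

theorem IsScal.mulVec {a : Matrix (Fin 2) (Fin 2) F} (h : IsScal a) (v : Fin 2 → F) :
    a *ᵥ v = a 0 0 • v := by
  ext i; fin_cases i
  · simp [mulVec_zero_eq, h.1]
  · simp [mulVec_one_eq, h.2.1, h.2.2]

theorem IsScal.cross {a : Matrix (Fin 2) (Fin 2) F} (h : IsScal a) (v : Fin 2 → F) :
    cross v (a *ᵥ v) = 0 := by
  rw [h.mulVec, cross_smul_right, cross_self, mul_zero]

/-- The three equations are the coefficients of `cross u (a *ᵥ u) = c * (cross v u * cross w u)`.
The zeros of this quadratic form are the eigenlines of `a`, and `disc a` is its discriminant. -/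
theorem exists_factors {a : Matrix (Fin 2) (Fin 2) F} (h2 : (2 : F) ≠ 0) {δ : F}
    (hδ : disc a = δ ^ 2) (hδ0 : δ ≠ 0) : ∃ v w : Fin 2 → F, cross v w ≠ 0 ∧
      ∃ c : F, c ≠ 0 ∧ a 1 0 = c * (v 1 * w 1) ∧ a 1 1 - a 0 0 = -c * (v 0 * w 1 + v 1 * w 0) ∧
        - a 0 1 = c * (v 0 * w 0) := by
  rw [disc_eq] at hδ
  by_cases h : a 1 0 = 0
  · have h3 : a 1 1 - a 0 0 ≠ 0 := by
      intro h4
      apply hδ0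
      have : a 0 0 - a 1 1 = 0 := by linear_combination -h4
      rw [this, h] at hδ
      apply pow_eq_zero_iff two_ne_zero |>.1
      rw [← hδ]; ring
    refine ⟨![1, 0], ![a 0 1, a 1 1 - a 0 0], ?_, -1, by simp, ?_, ?_, ?_⟩
    · simpa [cross] using h3
    · simp [h]
    · simp
    · simp
  · refine ⟨![a 0 0 - a 1 1 + δ, 2 * a 1 0], ![a 0 0 - a 1 1 - δ, 2 * a 1 0], ?_,
      (4 * a 1 0)⁻¹, ?_, ?_, ?_, ?_⟩
    · have : cross ![a 0 0 - a 1 1 + δ, 2 * a 1 0] ![a 0 0 - a 1 1 - δ, 2 * a 1 0]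
          = 2 * 2 * (δ * a 1 0) := by simp [cross]; ring
      rw [this]
      exact mul_ne_zero (mul_ne_zero h2 h2) (mul_ne_zero hδ0 h)
    · apply inv_ne_zero
      rw [show (4 : F) = 2 * 2 by norm_num]
      exact mul_ne_zero (mul_ne_zero h2 h2) h
    all_goals
      have h4 : (4 : F) ≠ 0 := by
        rw [show (4 : F) = 2 * 2 by norm_num]; exact mul_ne_zero h2 h2
      simp only [Matrix.cons_val_zero, Matrix.cons_val_one]
      field_simp
    · ring
    · ring
    · linear_combination -hδ

/-- An eigenvector is a rational zero of the quadratic form `u ↦ cross u (a *ᵥ u)`; completing the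
square exhibits the root of the discriminant. -/
theorem isSquare_disc_of_cross {a : Matrix (Fin 2) (Fin 2) F} {v : Fin 2 → F} (hv : v ≠ 0)
    (h : cross v (a *ᵥ v) = 0) : IsSquare (disc a) := by
  rw [cross_mulVec] at h
  rw [disc_eq]
  by_cases h1 : v 1 = 0
  · have h0 : v 0 ≠ 0 := by
      rcases vec_ne_zero_iff.1 hv with h0 | h0
      · exact h0
      · exact absurd h1 h0
    have h3 : a 1 0 = 0 := by
      rw [h1] at h
      have : a 1 0 * v 0 ^ 2 = 0 := by linear_combination h
      exact (mul_eq_zero.1 this).resolve_right (pow_ne_zero 2 h0)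
    exact ⟨a 0 0 - a 1 1, by rw [h3]; ring⟩
  · refine ⟨(2 * a 1 0 * v 0 + (a 1 1 - a 0 0) * v 1) / v 1, ?_⟩
    field_simp
    linear_combination -4 * a 1 0 * h

theorem exists_cross_of_isSquare_disc {a : Matrix (Fin 2) (Fin 2) F} (h2 : (2 : F) ≠ 0)
    (h : IsSquare (disc a)) : ∃ v : Fin 2 → F, v ≠ 0 ∧ cross v (a *ᵥ v) = 0 := by
  obtain ⟨δ, hδ⟩ := h
  rw [disc_eq] at hδ
  by_cases h1 : a 1 0 = 0
  · refine ⟨![1, 0], by rw [vec_ne_zero_iff]; simp, ?_⟩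
    rw [cross_mulVec]; simp [h1]
  · refine ⟨![a 0 0 - a 1 1 + δ, 2 * a 1 0], ?_, ?_⟩
    · rw [vec_ne_zero_iff]; right; simpa using ⟨h2, h1⟩
    · rw [cross_mulVec]; simp only [Matrix.cons_val_zero, Matrix.cons_val_one]
      linear_combination -a 1 0 * hδ

theorem trace_eq_zero_of_swap {a : Matrix (Fin 2) (Fin 2) F} {v w : Fin 2 → F}
    (hvw : cross v w ≠ 0) (h1 : cross w (a *ᵥ v) = 0) (h2 : cross v (a *ᵥ w) = 0) :
    a.trace = 0 := by
  have : a.trace * cross v w = cross v (a *ᵥ w) - cross w (a *ᵥ v) := by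
    simp only [cross, mulVec_zero_eq, mulVec_one_eq, Matrix.trace_fin_two]; ring
  rw [h1, h2, sub_zero] at this
  exact (mul_eq_zero.1 this).resolve_right hvw

theorem isScal_of_three {a : Matrix (Fin 2) (Fin 2) F}
    (h : ∀ v : Fin 2 → F, v ≠ 0 → cross v (a *ᵥ v) = 0) : IsScal a := by
  have h0 := h ![1, 0] (by rw [vec_ne_zero_iff]; simp)
  have h1 := h ![0, 1] (by rw [vec_ne_zero_iff]; simp)
  have h2 := h ![1, 1] (by rw [vec_ne_zero_iff]; simp)
  rw [cross_mulVec] at h0 h1 h2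
  simp at h0 h1 h2
  refine ⟨h1, h0, ?_⟩
  rw [h0, h1] at h2
  linear_combination -h2

/-- By Cayley–Hamilton `a ^ 2` is `a.trace • a` plus a scalar. Projective involutions are thus
recognised by their trace. -/
theorem isScal_sq_iff {a : Matrix (Fin 2) (Fin 2) F} (h : ¬ IsScal a) :
    IsScal (a ^ 2) ↔ a.trace = 0 := by
  simp only [IsScal, pow_two, Matrix.mul_apply, Fin.sum_univ_two, Matrix.trace_fin_two] at *
  constructor
  · rintro ⟨h1, h2, h3⟩
    by_contra ht
    apply h
    have e1 : (a 0 0 + a 1 1) * a 0 1 = 0 := by linear_combination h1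
    have e2 : (a 0 0 + a 1 1) * a 1 0 = 0 := by linear_combination h2
    have e3 : (a 0 0 + a 1 1) * (a 0 0 - a 1 1) = 0 := by linear_combination h3
    refine ⟨(mul_eq_zero.1 e1).resolve_left ht, (mul_eq_zero.1 e2).resolve_left ht, ?_⟩
    exact sub_eq_zero.1 ((mul_eq_zero.1 e3).resolve_left ht)
  · intro ht
    refine ⟨by linear_combination a 0 1 * ht, by linear_combination a 1 0 * ht,
      by linear_combination (a 0 0 - a 1 1) * ht⟩

theorem isScal_iff_mem_scalars (a : GL (Fin 2) F) : IsScal a.1 ↔ a ∈ scalars 2 F := by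
  constructor
  · intro h
    have h0 : a.1 0 0 ≠ 0 := by
      intro h0
      have := a.isUnit.map Matrix.detMonoidHom
      have hd : a.1.det ≠ 0 := by simpa using this
      rw [Matrix.det_fin_two, h.1, h0] at hd
      simp at hd
    refine ⟨Units.mk0 _ h0, ?_⟩
    ext i j
    fin_cases i <;> fin_cases j <;> simp [h.1, h.2.1, h.2.2]
  · rintro ⟨c, rfl⟩
    simp [IsScal]

end TwoByTwo

/-! ### The action on the projective line over an extension field -/

section Projective

open scoped LinearAlgebra.Projectivization
open Projectivization

variable {F : Type*} [Field F] {k : Type*} [Field k]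

theorem GL_smul_vec (g : GL (Fin 2) k) (v : Fin 2 → k) : g • v = g.1 *ᵥ v := rfl

theorem smul_mk_eq_mk_iff (g : GL (Fin 2) k) {v w : Fin 2 → k} (hv : v ≠ 0) (hw : w ≠ 0) :
    g • mk k v hv = mk k w hw ↔ cross w (g.1 *ᵥ v) = 0 := by
  rw [smul_mk, mk_eq_mk_iff', ]
  simp only [GL_smul_vec]
  constructor
  · rintro ⟨a, ha⟩
    rw [← ha, cross_smul_right, cross_self, mul_zero]
  · intro h
    obtain ⟨c, hc⟩ := exists_smul_of_cross hw h
    exact ⟨c, hc.symm⟩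

theorem mk_eq_mk_iff_cross {v w : Fin 2 → k} (hv : v ≠ 0) (hw : w ≠ 0) :
    mk k v hv = mk k w hw ↔ cross w v = 0 := by
  simpa using smul_mk_eq_mk_iff (1 : GL (Fin 2) k) hv hw

theorem isScal_of_smul_eq {g : GL (Fin 2) k} (h : ∀ p : ℙ k (Fin 2 → k), g • p = p) :
    IsScal g.1 :=
  isScal_of_three fun _ hv => (smul_mk_eq_mk_iff g hv hv).1 (h _)

theorem ncard_fixedBy_eq_two {g : GL (Fin 2) k} (h2 : (2 : k) ≠ 0) (hs : IsSquare (disc g.1))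
    (h0 : disc g.1 ≠ 0) : (MulAction.fixedBy (ℙ k (Fin 2 → k)) g).ncard = 2 := by
  obtain ⟨δ, hδ⟩ := hs
  obtain ⟨v, w, hvw, c, hc, e1, e2, e3⟩ := exists_factors (a := g.1) h2 (δ := δ) (by rw [hδ]; ring)
    (by rintro rfl; apply h0; rw [hδ]; ring)
  have hv : v ≠ 0 := by rintro rfl; simp [cross] at hvw
  have hw : w ≠ 0 := by rintro rfl; simp [cross] at hvw
  rw [Set.ncard_eq_two]
  refine ⟨mk k v hv, mk k w hw, ?_, ?_⟩
  · rw [Ne, mk_eq_mk_iff_cross, cross_eq_zero_comm]; exact hvw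
  · ext p
    induction p using Projectivization.ind with | h u hu =>
    rw [MulAction.mem_fixedBy, smul_mk_eq_mk_iff, Set.mem_insert_iff, Set.mem_singleton_iff,
      mk_eq_mk_iff_cross, mk_eq_mk_iff_cross, cross_mulVec]
    have : g.1 1 0 * u 0 ^ 2 + (g.1 1 1 - g.1 0 0) * (u 0 * u 1) - g.1 0 1 * u 1 ^ 2
        = c * (cross v u * cross w u) := by
      simp only [cross]
      linear_combination u 0 ^ 2 * e1 + u 0 * u 1 * e2 + u 1 ^ 2 * e3
    rw [this]
    simp [hc]

variable [Algebra F k]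

/-- The base change of a `2 × 2` matrix. -/
def bc (a : Matrix (Fin 2) (Fin 2) F) : Matrix (Fin 2) (Fin 2) k := a.map (algebraMap F k)

theorem disc_bc (a : Matrix (Fin 2) (Fin 2) F) :
    disc (bc a : Matrix (Fin 2) (Fin 2) k) = algebraMap F k (disc a) := by
  simp [disc_eq, bc, map_ofNat]

theorem isScal_bc {a : Matrix (Fin 2) (Fin 2) F} :
    IsScal (bc a : Matrix (Fin 2) (Fin 2) k) ↔ IsScal a := by
  simp [IsScal, bc]

theorem trace_bc (a : Matrix (Fin 2) (Fin 2) F) :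
    (bc a : Matrix (Fin 2) (Fin 2) k).trace = algebraMap F k a.trace := by
  simp [bc, Matrix.trace_fin_two]

variable (F k) in
/-- The action of `GL₂(F)` on the projective line over an extension field. -/
def lineAction : GL (Fin 2) F →* Equiv.Perm (ℙ k (Fin 2 → k)) :=
  (MulAction.toPermHom (GL (Fin 2) k) _).comp (Matrix.GeneralLinearGroup.map (algebraMap F k))

theorem lineAction_mk (g : GL (Fin 2) F) {v w : Fin 2 → k} (hv : v ≠ 0) (hw : w ≠ 0) :
    lineAction F k g (mk k v hv) = mk k w hw ↔ cross w (bc g.1 *ᵥ v) = 0 :=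
  smul_mk_eq_mk_iff _ hv hw

theorem lineAction_eq_one_iff (g : GL (Fin 2) F) : lineAction F k g = 1 ↔ IsScal g.1 := by
  rw [← isScal_bc (k := k)]
  constructor
  · intro h
    exact isScal_of_smul_eq (g := Matrix.GeneralLinearGroup.map (algebraMap F k) g)
      fun p => Equiv.congr_fun h p
  · intro h
    ext p
    induction p using Projectivization.ind with | h u hu =>
    rw [Equiv.Perm.one_apply]
    exact (lineAction_mk g hu hu).2 (h.cross u)

/-- `H` preserves the pair of lines spanned by `v` and `w`. -/
def PreservesPair (H : Subgroup (GL (Fin 2) F)) (v w : Fin 2 → k) : Prop :=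
  ∀ h ∈ H, (cross v (bc h.1 *ᵥ v) = 0 ∧ cross w (bc h.1 *ᵥ w) = 0) ∨
    (cross w (bc h.1 *ᵥ v) = 0 ∧ cross v (bc h.1 *ᵥ w) = 0)

/-- Every discriminant becomes a square in `k`, and `hss` excludes the nonscalar matrices with a
double eigenvalue, so each nontrivial element of the image in `Perm (ℙ k (Fin 2 → k))` fixes exactly
two points and Klein's count applies. The subgroup `H'` of index two is presented by a coset
representative `m`. -/
theorem preservesPair_or_exceptional [Finite k] (h2 : (2 : F) ≠ 0)
    (hsq : ∀ x : F, IsSquare (algebraMap F k x)) (H : Subgroup (GL (Fin 2) F))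
    (hss : ∀ h ∈ H, disc h.1 = 0 → IsScal h.1) :
    (∃ v w : Fin 2 → k, v ≠ 0 ∧ w ≠ 0 ∧ PreservesPair H v w) ∨
      ((Nat.card (H.map (lineAction F k)) = 12 ∨ Nat.card (H.map (lineAction F k)) = 24 ∨
          Nat.card (H.map (lineAction F k)) = 60) ∧
        ∀ H' ≤ H, (∀ h ∈ H, IsScal h.1 → h ∈ H') →
          (∃ m ∈ H, m ∉ H' ∧ ∀ x ∈ H, x ∉ H' → x * m ∈ H') →
          ∃ m ∈ H, m ∉ H' ∧ IsScal (m.1 ^ 2)) := by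
  have h2k : (2 : k) ≠ 0 := by
    have := (map_ne_zero (algebraMap F k)).2 h2
    rwa [map_ofNat] at this
  have hfix : ∀ γ : H.map (lineAction F k), γ ≠ 1 →
      (MulAction.fixedBy (ℙ k (Fin 2 → k)) γ).ncard = 2 := by
    rintro ⟨_, h, hh, rfl⟩ h1
    have h1' : ¬ IsScal h.1 := fun hs => h1 (Subtype.ext ((lineAction_eq_one_iff h).2 hs))
    refine ncard_fixedBy_eq_two (g := Matrix.GeneralLinearGroup.map (algebraMap F k) h) h2k ?_ ?_
    · exact (disc_bc (k := k) h.1) ▸ hsq _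
    · have : disc (bc h.1 : Matrix (Fin 2) (Fin 2) k) ≠ 0 := by
        rw [disc_bc]
        exact (map_ne_zero (algebraMap F k)).2 fun h0 => h1' (hss h hh h0)
      exact this
  have : Nonempty (ℙ k (Fin 2 → k)) := ⟨mk k ![1, 0] (by rw [vec_ne_zero_iff]; simp)⟩
  rcases stable_pair_or_exceptional hfix with ⟨p, q, hpq⟩ | ⟨hN, hinv⟩
  · left
    induction p using Projectivization.ind with | h v hv =>
    induction q using Projectivization.ind with | h w hw =>
    refine ⟨v, w, hv, hw, fun h hh => ?_⟩
    have := hpq ⟨lineAction F k h, Subgroup.mem_map_of_mem _ hh⟩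
    rw [← lineAction_mk h hv hv, ← lineAction_mk h hw hw, ← lineAction_mk h hv hw,
      ← lineAction_mk h hw hv]
    exact this
  · right
    refine ⟨hN, fun H' hH' hsc ⟨m, hm, hm', hmm⟩ => ?_⟩
    -- The kernel of the action is the scalars, which lie in `H'`, so the index two survives in the
    -- image.
    have hker : ∀ x ∈ H, lineAction F k x ∈ H'.map (lineAction F k) → x ∈ H' := by
      rintro x hx ⟨y, hy, hxy⟩
      have h1 : IsScal (y⁻¹ * x).1 := by
        rw [← lineAction_eq_one_iff (k := k), map_mul, map_inv, hxy, inv_mul_cancel]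
      have h2 := hsc _ (H.mul_mem (H.inv_mem (hH' hy)) hx) h1
      simpa using H'.mul_mem hy h2
    have hidx : ((H'.map (lineAction F k)).subgroupOf (H.map (lineAction F k))).index = 2 := by
      rw [Subgroup.index_eq_two_iff]
      refine ⟨⟨lineAction F k m, Subgroup.mem_map_of_mem _ hm⟩, ?_⟩
      rintro ⟨_, x, hx, rfl⟩
      simp only [Subgroup.mem_subgroupOf, Subgroup.coe_mul]
      by_cases hx' : x ∈ H'
      · right
        refine ⟨Subgroup.mem_map_of_mem _ hx', fun h => hm' ?_⟩
        rw [← map_mul] at h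
        have := hker _ (H.mul_mem hx hm) h
        simpa using H'.mul_mem (H'.inv_mem hx') this
      · left
        refine ⟨?_, fun h => hx' (hker x hx h)⟩
        rw [← map_mul]
        exact Subgroup.mem_map_of_mem _ (hmm x hx hx')
    obtain ⟨⟨_, x, hx, rfl⟩, hγ, hγ2⟩ := hinv _ hidx
    refine ⟨x, hx, fun h => hγ ?_, ?_⟩
    · rw [Subgroup.mem_subgroupOf]; exact Subgroup.mem_map_of_mem _ h
    · have h3 : lineAction F k (x ^ 2) = 1 := by
        rw [map_pow]; exact congrArg Subtype.val hγ2
      simpa using (lineAction_eq_one_iff _).1 h3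

/-- A line over the extension field fixed by a rationally diagonalizable matrix is rational. -/
theorem exists_rational_of_cross {a : Matrix (Fin 2) (Fin 2) F} (h2 : (2 : F) ≠ 0)
    (hs : IsSquare (disc a)) (h0 : disc a ≠ 0) {v : Fin 2 → k}
    (hv : cross v (bc a *ᵥ v) = 0) :
    ∃ u : Fin 2 → F, u ≠ 0 ∧ cross v (fun i => algebraMap F k (u i)) = 0 := by
  obtain ⟨δ, hδ⟩ := hs
  obtain ⟨x, y, hxy, c, hc, e1, e2, e3⟩ := exists_factors (a := a) h2 (δ := δ) (by rw [hδ]; ring)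
    (by rintro rfl; apply h0; rw [hδ]; ring)
  have hx : x ≠ 0 := by rintro rfl; simp [cross] at hxy
  have hy : y ≠ 0 := by rintro rfl; simp [cross] at hxy
  have key : algebraMap F k c * (cross v (fun i => algebraMap F k (x i)) *
      cross v (fun i => algebraMap F k (y i))) = 0 := by
    rw [← hv, cross_mulVec]
    have f1 := congrArg (algebraMap F k) e1
    have f2 := congrArg (algebraMap F k) e2
    have f3 := congrArg (algebraMap F k) e3
    simp only [map_mul, map_neg, map_add, map_sub] at f1 f2 f3
    simp only [bc, Matrix.map_apply, cross]
    linear_combination -v 0 ^ 2 * f1 - v 0 * v 1 * f2 - v 1 ^ 2 * f3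
  rcases mul_eq_zero.1 key with h | h
  · exact absurd h ((map_ne_zero _).2 hc)
  · rcases mul_eq_zero.1 h with h | h
    exacts [⟨x, hx, h⟩, ⟨y, hy, h⟩]

theorem cross_bc_mulVec (a : Matrix (Fin 2) (Fin 2) F) (u v : Fin 2 → F) :
    cross (fun i => algebraMap F k (u i)) (bc a *ᵥ fun i => algebraMap F k (v i))
      = algebraMap F k (cross u (a *ᵥ v)) := by
  simp [cross, mulVec_zero_eq, mulVec_one_eq, bc]

theorem mulVec_ne_zero (g : GL (Fin 2) F) {v : Fin 2 → F} (hv : v ≠ 0) : g.1 *ᵥ v ≠ 0 := by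
  intro h
  apply hv
  have : (g⁻¹).1 *ᵥ (g.1 *ᵥ v) = v := by
    rw [Matrix.mulVec_mulVec, ← Units.val_mul, inv_mul_cancel, Units.val_one, Matrix.one_mulVec]
  rw [← this, h, Matrix.mulVec_zero]

/-- If an `a` fixing both lines of a preserved pair is rationally diagonalizable and not
scalar, the lines are rational. -/
theorem PreservesPair.rational {H : Subgroup (GL (Fin 2) F)} {v w : Fin 2 → k}
    (h : PreservesPair H v w) (h2 : (2 : F) ≠ 0) (hv : v ≠ 0) (hw : w ≠ 0)
    {a : GL (Fin 2) F} (hs : IsSquare (disc a.1)) (h0 : disc a.1 ≠ 0)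
    (hav : cross v (bc a.1 *ᵥ v) = 0) (haw : cross w (bc a.1 *ᵥ w) = 0) :
    ∃ x y : Fin 2 → F, x ≠ 0 ∧ y ≠ 0 ∧ cross x (a.1 *ᵥ x) = 0 ∧ cross y (a.1 *ᵥ y) = 0 ∧ ∀ b ∈ H,
      (cross x (b.1 *ᵥ x) = 0 ∧ cross y (b.1 *ᵥ y) = 0) ∨
        (cross y (b.1 *ᵥ x) = 0 ∧ cross x (b.1 *ᵥ y) = 0) := by
  obtain ⟨x, hx, hxv⟩ := exists_rational_of_cross h2 hs h0 hav
  obtain ⟨y, hy, hyw⟩ := exists_rational_of_cross h2 hs h0 haw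
  have key : ∀ (b : GL (Fin 2) F) {z u : Fin 2 → F} {z' u' : Fin 2 → k}, u ≠ 0 → z' ≠ 0 → u' ≠ 0 →
      cross z' (fun i => algebraMap F k (z i)) = 0 →
      cross u' (fun i => algebraMap F k (u i)) = 0 →
      cross z' (bc b.1 *ᵥ u') = 0 → cross z (b.1 *ᵥ u) = 0 := by
    intro b z u z' u' hu hz' hu' h1 h2 h3
    obtain ⟨c, hc⟩ := exists_smul_of_cross hu' h2
    have h4 : cross z' (bc b.1 *ᵥ fun i => algebraMap F k (u i)) = 0 := by
      rw [hc, Matrix.mulVec_smul, cross_smul_right, h3, mul_zero]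
    have h5 := cross_trans hz' (cross_eq_zero_comm.1 h1) h4
    rw [cross_bc_mulVec] at h5
    exact (map_eq_zero _).1 h5
  refine ⟨x, y, hx, hy, key a hx hv hv hxv hxv hav, key a hy hw hw hyw hyw haw, fun b hb => ?_⟩
  rcases h b hb with ⟨h3, h4⟩ | ⟨h3, h4⟩
  · exact Or.inl ⟨key b hx hv hv hxv hxv h3, key b hy hw hw hyw hyw h4⟩
  · exact Or.inr ⟨key b hx hw hv hyw hxv h3, key b hy hv hw hxv hyw h4⟩

end Projective

/-! ### Transvections, generation of `SL₂`, and non-split elements -/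

section Transvections

variable {F : Type*} [Field F]

/-- No line of the plane is stable under `H`. -/
def NoCommonLine (H : Subgroup (GL (Fin 2) F)) : Prop :=
  ∀ v : Fin 2 → F, v ≠ 0 → ∃ h ∈ H, cross v (h.1 *ᵥ v) ≠ 0

/-- The invertible matrix with given columns. -/
def ofColumns (v w : Fin 2 → F) (h : cross v w ≠ 0) : GL (Fin 2) F :=
  Matrix.GeneralLinearGroup.mkOfDetNeZero !![v 0, w 0; v 1, w 1]
    (by rw [Matrix.det_fin_two_of, mul_comm (w 0)]; exact h)

theorem ofColumns_val (v w : Fin 2 → F) (h : cross v w ≠ 0) :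
    (ofColumns v w h).1 = !![v 0, w 0; v 1, w 1] := rfl

/-- Upper unitriangular matrices. -/
def upperGL (x : F) : GL (Fin 2) F :=
  ⟨!![1, x; 0, 1], !![1, -x; 0, 1], by ext i j; fin_cases i <;> fin_cases j <;> simp,
    by ext i j; fin_cases i <;> fin_cases j <;> simp⟩

/-- Lower unitriangular matrices. -/
def lowerGL (x : F) : GL (Fin 2) F :=
  ⟨!![1, 0; x, 1], !![1, 0; -x, 1], by ext i j; fin_cases i <;> fin_cases j <;> simp,
    by ext i j; fin_cases i <;> fin_cases j <;> simp⟩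

theorem det_ne_zero (g : GL (Fin 2) F) : g.1.det ≠ 0 := by
  have := g.isUnit.map Matrix.detMonoidHom
  simpa using this

/-- A matrix of determinant one with nonzero lower left entry is a product upper · lower · upper. A
zero entry is first made nonzero by `lowerGL 1`. -/
theorem mem_of_unitriangular (H : Subgroup (GL (Fin 2) F)) (hU : ∀ x, upperGL x ∈ H)
    (hL : ∀ x, lowerGL x ∈ H) (S : GL (Fin 2) F) (hS : S.1.det = 1) : S ∈ H := by
  have key : ∀ S : GL (Fin 2) F, S.1.det = 1 → S.1 1 0 ≠ 0 → S ∈ H := by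
    intro S hS hc
    rw [Matrix.det_fin_two] at hS
    have : S = upperGL ((S.1 0 0 - 1) / S.1 1 0) * lowerGL (S.1 1 0) *
        upperGL ((S.1 1 1 - 1) / S.1 1 0) := by
      apply Units.ext
      ext i j
      fin_cases i <;> fin_cases j <;>
        simp [upperGL, lowerGL, Matrix.mul_apply, Fin.sum_univ_two] <;> field_simp <;>
        first | ring1 | linear_combination -hS
    rw [this]
    exact H.mul_mem (H.mul_mem (hU _) (hL _)) (hU _)
  by_cases hc : S.1 1 0 = 0
  · have h1 : lowerGL 1 * S ∈ H := by
      apply key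
      · rw [Units.val_mul, Matrix.det_mul, hS]; simp [lowerGL]
      · rw [Matrix.det_fin_two, hc] at hS
        simp only [Units.val_mul, lowerGL, Matrix.mul_apply, Fin.sum_univ_two]
        simp [hc]
        rintro h; rw [h] at hS; simp at hS
    simpa using H.mul_mem (H.inv_mem (hL 1)) h1
  · exact key S hS hc

variable {ℓ : ℕ} [Fact ℓ.Prime]

/-- Write `a = s + n₀` with `s` the double eigenvalue and `n₀ ^ 2 = 0`. By Fermat `a ^ (ℓ - 1) = 1 -
s ^ (ℓ - 2) n₀`, and the powers of this element fill a whole group of transvections. -/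
theorem exists_nilpotent_of_disc_eq_zero (hℓ : ℓ ≠ 2) {a : GL (Fin 2) (ZMod ℓ)}
    (h0 : disc a.1 = 0) (ha : ¬ IsScal a.1) : ∃ n : Matrix (Fin 2) (Fin 2) (ZMod ℓ),
      n * n = 0 ∧ n ≠ 0 ∧ ∀ m : ℕ, (a ^ ((ℓ - 1) * m)).1 = 1 + (m : ZMod ℓ) • n := by
  have hp := (Fact.out : ℓ.Prime)
  have h2 : (2 : ZMod ℓ) ≠ 0 := by
    intro h
    have : (ℓ : ℕ) ∣ 2 := (ZMod.natCast_eq_zero_iff 2 ℓ).1 (by exact_mod_cast h)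
    exact hℓ ((Nat.prime_dvd_prime_iff_eq hp Nat.prime_two).1 this)
  set s : ZMod ℓ := a.1.trace / 2 with hs
  set n : Matrix (Fin 2) (Fin 2) (ZMod ℓ) := a.1 - s • 1 with hn
  have hst : a.1 0 0 + a.1 1 1 = 2 * s := by rw [hs, Matrix.trace_fin_two]; field_simp
  rw [disc_eq] at h0
  have hnn : n * n = 0 := by
    have h4 : (4 : ZMod ℓ) ≠ 0 := by
      rw [show (4 : ZMod ℓ) = 2 * 2 by norm_num]; exact mul_ne_zero h2 h2
    ext i j
    fin_cases i <;> fin_cases j <;>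
      simp [hn, Matrix.mul_apply, Fin.sum_univ_two]
    · apply mul_left_cancel₀ h4
      linear_combination h0 + (3 * a.1 0 0 - a.1 1 1 - 2 * s) * hst
    · linear_combination a.1 0 1 * hst
    · linear_combination a.1 1 0 * hst
    · apply mul_left_cancel₀ h4
      linear_combination h0 + (3 * a.1 1 1 - a.1 0 0 - 2 * s) * hst
  have hn0 : n ≠ 0 := by
    intro h
    apply ha
    have h' : a.1 = s • 1 := sub_eq_zero.1 h
    rw [h']
    simp [IsScal]
  have hs0 : s ≠ 0 := by
    intro h
    have hd := det_ne_zero a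
    rw [Matrix.det_fin_two] at hd
    apply hd
    rw [h] at hst
    have h4 : (4 : ZMod ℓ) ≠ 0 := by
      rw [show (4 : ZMod ℓ) = 2 * 2 by norm_num]; exact mul_ne_zero h2 h2
    apply mul_left_cancel₀ h4
    linear_combination -h0 + (a.1 0 0 + a.1 1 1) * hst
  have ha' : a.1 = s • 1 + n := by rw [hn]; abel
  have hpow : ∀ m : ℕ, a.1 ^ m = s ^ m • 1 + ((m : ZMod ℓ) * s ^ (m - 1)) • n := by
    intro m
    induction m with
    | zero => simp
    | succ m ih =>
      rw [pow_succ, ih]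
      nth_rewrite 1 [ha']
      rw [add_mul, mul_add, mul_add, smul_mul_smul_comm, smul_mul_smul_comm, smul_mul_assoc,
        smul_mul_assoc, hnn, smul_zero, mul_one, mul_one, one_mul, add_zero, add_assoc,
        ← add_smul, pow_succ]
      congr 2
      rcases m with _ | m
      · simp
      · simp only [Nat.add_sub_cancel]; push_cast; ring
  have hun : a.1 ^ (ℓ - 1) = 1 + (-(s ^ (ℓ - 1 - 1))) • n := by
    rw [hpow, ZMod.pow_card_sub_one_eq_one hs0, one_smul]
    congr 2
    rw [Nat.cast_sub hp.one_le]; simp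
  have hpow' : ∀ (n : Matrix (Fin 2) (Fin 2) (ZMod ℓ)), n * n = 0 → ∀ m : ℕ,
      (1 + n) ^ m = 1 + (m : ZMod ℓ) • n := by
    intro n hnn m
    induction m with
    | zero => simp
    | succ m ih =>
      rw [pow_succ, ih, add_mul, mul_add, smul_mul_assoc, mul_add, hnn]
      push_cast
      rw [add_smul]
      simp
      abel
  refine ⟨(-(s ^ (ℓ - 1 - 1))) • n, ?_, ?_, fun m => ?_⟩
  · rw [smul_mul_smul_comm, hnn, smul_zero]
  · exact smul_ne_zero (neg_ne_zero.2 (pow_ne_zero _ hs0)) hn0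
  · rw [pow_mul, Units.val_pow_eq_pow_val, Units.val_pow_eq_pow_val, hun]
    apply hpow'
    rw [smul_mul_smul_comm, hnn, smul_zero]

/-- Powers of `a` give all transvections along a line `v`, and conjugating by an `h ∈ H` that moves
this line gives those along `h v`. In the basis `v, h v` these are the upper and lower unitriangular
groups, which generate `SL₂`. -/
theorem mem_of_disc_eq_zero (hℓ : ℓ ≠ 2) {H : Subgroup (GL (Fin 2) (ZMod ℓ))}
    (hH : NoCommonLine H) {a : GL (Fin 2) (ZMod ℓ)} (haH : a ∈ H)
    (h0 : disc a.1 = 0) (ha : ¬ IsScal a.1) (S : GL (Fin 2) (ZMod ℓ)) (hS : S.1.det = 1) :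
    S ∈ H := by
  obtain ⟨n, hnn, hn0, hpow⟩ := exists_nilpotent_of_disc_eq_zero hℓ h0 ha
  obtain ⟨u, hu⟩ : ∃ u, n *ᵥ u ≠ 0 := by
    by_contra! hcon
    apply hn0
    apply Matrix.ext_of_mulVec_single
    intro i
    rw [hcon, Matrix.zero_mulVec]
  set v := n *ᵥ u with hv
  have hnv : n *ᵥ v = 0 := by rw [hv, Matrix.mulVec_mulVec, hnn, Matrix.zero_mulVec]
  obtain ⟨h, hh, hc⟩ := hH v hu
  set w := h.1 *ᵥ v with hw
  set P := ofColumns v w hc with hP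
  have hmem : ∀ x : ZMod ℓ, ∃ t ∈ H, t.1 = 1 + x • n := by
    intro x
    refine ⟨a ^ ((ℓ - 1) * x.val), H.pow_mem haH _, ?_⟩
    rw [hpow, ZMod.natCast_zmod_val]
  -- the nilpotent part in the basis `v, w`
  have nv : ∀ i, n i 0 * v 0 + n i 1 * v 1 = 0 := by
    intro i
    have := congrFun hnv i
    simpa [Matrix.mulVec, dotProduct, Fin.sum_univ_two] using this
  -- The image of `n` is the line of `v`: since `n` kills its own image, a second direction there
  -- would force `n = 0`.
  have hcu : cross v (n *ᵥ w) = 0 := by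
    have e := hnn
    have hn1 : ∀ z, cross v (n *ᵥ z) = 0 := by
      intro z
      by_contra hne
      apply hn0
      have h1 : n *ᵥ (n *ᵥ z) = 0 := by rw [Matrix.mulVec_mulVec, hnn, Matrix.zero_mulVec]
      have nz : ∀ i, n i 0 * (n *ᵥ z) 0 + n i 1 * (n *ᵥ z) 1 = 0 := by
        intro i
        have := congrFun h1 i
        simpa [Matrix.mulVec, dotProduct, Fin.sum_univ_two] using this
      have hi0 : ∀ i, n i 0 * cross v (n *ᵥ z) = 0 := fun i => by
        rw [cross]; linear_combination (n *ᵥ z) 1 * nv i - v 1 * nz i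
      have hi1 : ∀ i, n i 1 * cross v (n *ᵥ z) = 0 := fun i => by
        rw [cross]; linear_combination v 0 * nz i - (n *ᵥ z) 0 * nv i
      ext i j
      fin_cases j
      · exact (mul_eq_zero.1 (hi0 i)).resolve_right hne
      · exact (mul_eq_zero.1 (hi1 i)).resolve_right hne
    exact hn1 w
  obtain ⟨c, hcw⟩ := exists_smul_of_cross hu hcu
  have hc0 : c ≠ 0 := by
    rintro rfl
    rw [zero_smul] at hcw
    have nz : ∀ i, n i 0 * w 0 + n i 1 * w 1 = 0 := by
      intro i
      have := congrFun hcw i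
      simpa [Matrix.mulVec, dotProduct, Fin.sum_univ_two] using this
    apply hn0
    have hi0 : ∀ i, n i 0 * cross v w = 0 := fun i => by
      rw [cross]; linear_combination w 1 * nv i - v 1 * nz i
    have hi1 : ∀ i, n i 1 * cross v w = 0 := fun i => by
      rw [cross]; linear_combination v 0 * nz i - w 0 * nv i
    ext i j
    fin_cases j
    · exact (mul_eq_zero.1 (hi0 i)).resolve_right hc
    · exact (mul_eq_zero.1 (hi1 i)).resolve_right hc
  have hPcol : ∀ (M : Matrix (Fin 2) (Fin 2) (ZMod ℓ)), M * P.1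
      = !![(M *ᵥ v) 0, (M *ᵥ w) 0; (M *ᵥ v) 1, (M *ᵥ w) 1] := by
    intro M
    rw [hP, ofColumns_val]
    ext i j
    fin_cases i <;> fin_cases j <;>
      simp [Matrix.mul_apply, Fin.sum_univ_two, mulVec_zero_eq, mulVec_one_eq]
  have hU : ∀ x, P * upperGL x * P⁻¹ ∈ H := by
    intro x
    obtain ⟨t, ht, hte⟩ := hmem (x / c)
    have : P * upperGL x * P⁻¹ = t := by
      rw [mul_inv_eq_iff_eq_mul]
      apply Units.ext
      rw [Units.val_mul, Units.val_mul, hPcol, hte, Matrix.add_mulVec, Matrix.add_mulVec,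
        Matrix.smul_mulVec, Matrix.smul_mulVec, hnv, hcw, Matrix.one_mulVec, Matrix.one_mulVec, hP,
        ofColumns_val]
      ext i j
      fin_cases i <;> fin_cases j <;> simp [upperGL, Matrix.mul_apply, Fin.sum_univ_two] <;>
        field_simp <;> ring
    rw [this]; exact ht
  -- conjugating by `h` gives a nilpotent matrix killing `w`
  have hinv : (h⁻¹).1 *ᵥ w = v := by
    rw [hw, Matrix.mulVec_mulVec, ← Units.val_mul, inv_mul_cancel, Units.val_one,
      Matrix.one_mulVec]
  obtain ⟨α, β, hαβ⟩ : ∃ α β : ZMod ℓ, (h⁻¹).1 *ᵥ v = α • v + β • w := by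
    set z := (h⁻¹).1 *ᵥ v
    refine ⟨cross z w / cross v w, cross v z / cross v w, ?_⟩
    ext i
    fin_cases i <;> simp only [Pi.add_apply, Pi.smul_apply, smul_eq_mul, Fin.zero_eta, Fin.mk_one]
    · field_simp; simp only [cross]; ring
    · field_simp; simp only [cross]; ring
  have hβ : β ≠ 0 := by
    rintro rfl
    rw [zero_smul, add_zero] at hαβ
    have := cross_mulVec_mulVec (h⁻¹).1 v w
    rw [hαβ, hinv, cross_comm, cross_smul_right, cross_self, mul_zero, neg_zero] at this
    exact mul_ne_zero (det_ne_zero h⁻¹) hc this.symm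
  have hL : ∀ x, P * lowerGL x * P⁻¹ ∈ H := by
    intro x
    -- The conjugate `h n h⁻¹` kills `w` and sends `v` to `(c * β) • w`, whence the parameter.
    obtain ⟨t, ht, hte⟩ := hmem (x / (c * β))
    have : P * lowerGL x * P⁻¹ = h * t * h⁻¹ := by
      rw [mul_inv_eq_iff_eq_mul]
      apply Units.ext
      have e1 : (h * t * h⁻¹).1 *ᵥ v = v + x • w := by
        rw [Units.val_mul, Units.val_mul, ← Matrix.mulVec_mulVec, ← Matrix.mulVec_mulVec, hte,
          hαβ, Matrix.add_mulVec, Matrix.smul_mulVec, Matrix.mulVec_add n, Matrix.mulVec_smul n,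
          Matrix.mulVec_smul n, hnv, hcw, Matrix.one_mulVec, Matrix.mulVec_add, ← hαβ,
          Matrix.mulVec_mulVec, ← Units.val_mul, mul_inv_cancel, Units.val_one, Matrix.one_mulVec,
          smul_zero, zero_add, smul_smul, smul_smul, Matrix.mulVec_smul, ← hw]
        congr 2
        field_simp
      have e2 : (h * t * h⁻¹).1 *ᵥ w = w := by
        rw [Units.val_mul, Units.val_mul, ← Matrix.mulVec_mulVec, ← Matrix.mulVec_mulVec, hte,
          hinv, Matrix.add_mulVec, Matrix.smul_mulVec, hnv, Matrix.one_mulVec, smul_zero, add_zero]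
      rw [Units.val_mul, Units.val_mul, hPcol, e1, e2, hP, ofColumns_val]
      ext i j
      fin_cases i <;> fin_cases j <;> simp [lowerGL, Matrix.mul_apply, Fin.sum_univ_two] <;>
        ring
    rw [this]; exact H.mul_mem (H.mul_mem hh ht) (H.inv_mem hh)
  have hfin := mem_of_unitriangular (H.comap (MulAut.conj P).toMonoidHom)
    (fun x => by simpa [Subgroup.mem_comap] using hU x)
    (fun x => by simpa [Subgroup.mem_comap] using hL x) (P⁻¹ * S * P) (by
      rw [Units.val_mul, Units.val_mul, Matrix.det_mul, Matrix.det_mul, hS, mul_one,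
        ← Matrix.det_mul, ← Units.val_mul, inv_mul_cancel, Units.val_one, Matrix.det_one])
  rw [Subgroup.mem_comap] at hfin
  simpa [mul_assoc] using hfin

theorem two_ne_zero_zmod (hℓ : ℓ ≠ 2) : (2 : ZMod ℓ) ≠ 0 := by
  intro h
  have : (ℓ : ℕ) ∣ 2 := (ZMod.natCast_eq_zero_iff 2 ℓ).1 (by exact_mod_cast h)
  exact hℓ ((Nat.prime_dvd_prime_iff_eq Fact.out Nat.prime_two).1 this)

/-- A companion matrix of determinant one and trace `t` has discriminant `t ^ 2 - 4`, so a `t`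
making this a nonsquare is needed. The nonzero trace ensures later that `S ^ 4 ≠ 1`. -/
theorem exists_not_isSquare_disc (hℓ : ℓ ≠ 2) : ∃ S : GL (Fin 2) (ZMod ℓ), S.1.det = 1 ∧
    ¬ IsSquare (disc S.1) ∧ (ℓ ≠ 3 → S.1.trace ≠ 0) := by
  have h2 := two_ne_zero_zmod hℓ
  obtain ⟨n, hn⟩ := FiniteField.exists_nonsquare (F := ZMod ℓ) (by rwa [ZMod.ringChar_zmod_n])
  -- The trace chosen below vanishes exactly when `u * u = -n`. This cannot hold for both `u = 1`
  -- and `u = 2` unless `3 = 0`.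
  obtain ⟨u, hu0, hu⟩ : ∃ u : ZMod ℓ, u ≠ 0 ∧ (ℓ ≠ 3 → u * u ≠ -n) := by
    by_cases h1 : (1 : ZMod ℓ) * 1 = -n
    · refine ⟨2, h2, fun h3 h => h3 ?_⟩
      have : ((3 : ℕ) : ZMod ℓ) = 0 := by push_cast; linear_combination h - h1
      exact (Nat.prime_dvd_prime_iff_eq Fact.out Nat.prime_three).1
        ((ZMod.natCast_eq_zero_iff 3 ℓ).1 this)
    · exact ⟨1, one_ne_zero, fun _ => h1⟩
  obtain ⟨e, he⟩ : ∃ e, e = n / u - u := ⟨_, rfl⟩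
  have hne : n = u * (e + u) := by rw [he]; field_simp; ring
  have hs : e ≠ 0 := by
    rintro rfl
    exact hn ⟨u, by rw [hne, zero_add]⟩
  -- With `n = u * (e + u)` this parametrises the conic: `t ^ 2 - 4 = n * (4 / e) ^ 2`.
  obtain ⟨t, ht⟩ : ∃ t, t = 2 * (e + 2 * u) / e := ⟨_, rfl⟩
  refine ⟨⟨!![0, -1; 1, t], !![t, 1; -1, 0],
    by ext i j; fin_cases i <;> fin_cases j <;> simp,
    by ext i j; fin_cases i <;> fin_cases j <;> simp⟩, by simp, ?_, fun h3 => ?_⟩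
  · have : disc (!![0, -1; 1, t] : Matrix (Fin 2) (Fin 2) (ZMod ℓ)) = n * (4 / e) ^ 2 := by
      rw [disc_eq, ht, hne]
      simp
      field_simp
      ring
    change ¬ IsSquare (disc (!![0, -1; 1, t] : Matrix (Fin 2) (Fin 2) (ZMod ℓ)))
    rw [this]
    rintro ⟨r, hr⟩
    apply hn
    have h4 : (4 : ZMod ℓ) ≠ 0 := by
      rw [show (4 : ZMod ℓ) = 2 * 2 by norm_num]; exact mul_ne_zero h2 h2
    refine ⟨r * (e / 4), ?_⟩
    field_simp at hr ⊢
    linear_combination hr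
  · have : t ≠ 0 := by
      rw [ht]
      refine div_ne_zero (mul_ne_zero h2 ?_) hs
      intro h
      apply hu h3
      linear_combination u * h + hne
    simpa [Matrix.trace_fin_two] using this

end Transvections

/-! ### Groups of split matrices with a normalising coset -/

section IsotropicCore

variable {ℓ : ℕ} [Fact ℓ.Prime]

/-- Euler's criterion: `(ℓ ^ 2 - 1) / 2` is a multiple of `ℓ - 1`. -/
theorem isSquare_algebraMap_galoisField (hℓ : ℓ ≠ 2) (x : ZMod ℓ) :
    IsSquare (algebraMap (ZMod ℓ) (GaloisField ℓ 2) x) := by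
  have hp : ℓ.Prime := Fact.out
  by_cases hx : x = 0
  · exact ⟨0, by simp [hx]⟩
  have := Fintype.ofFinite (GaloisField ℓ 2)
  have hchar : ringChar (GaloisField ℓ 2) ≠ 2 := by
    rw [ringChar.eq (GaloisField ℓ 2) ℓ]; exact hℓ
  rw [FiniteField.isSquare_iff hchar ((map_ne_zero _).2 hx), ← map_pow]
  have hodd : Odd ℓ := hp.odd_of_ne_two hℓ
  obtain ⟨m, hm⟩ := hodd
  have hcard : Fintype.card (GaloisField ℓ 2) / 2 = (ℓ - 1) * (m + 1) := by
    rw [← Nat.card_eq_fintype_card, GaloisField.card ℓ 2 two_ne_zero, hm]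
    have : (2 * m + 1) ^ 2 = 2 * ((2 * m + 1 - 1) * (m + 1)) + 1 := by
      simp only [Nat.add_sub_cancel]; ring
    omega
  rw [hcard, pow_mul, ZMod.pow_card_sub_one_eq_one hx, one_pow, map_one]

theorem isSquare_mul_of_not_isSquare {a b : ZMod ℓ} (ha : ¬ IsSquare a) (hb : ¬ IsSquare b) :
    IsSquare (a * b) := by
  have ha0 : a ≠ 0 := by rintro rfl; exact ha ⟨0, by ring⟩
  have hb0 : b ≠ 0 := by rintro rfl; exact hb ⟨0, by ring⟩
  rw [← quadraticChar_one_iff_isSquare (mul_ne_zero ha0 hb0), map_mul,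
    quadraticChar_neg_one_iff_not_isSquare.2 ha, quadraticChar_neg_one_iff_not_isSquare.2 hb]
  rfl

theorem disc_sq {F : Type*} [Field F] (a : Matrix (Fin 2) (Fin 2) F) :
    disc (a ^ 2) = a.trace ^ 2 * disc a := by
  simp only [disc_eq, pow_two, Matrix.mul_apply, Fin.sum_univ_two, Matrix.trace_fin_two]; ring

theorem trace_sq_fin_two {F : Type*} [Field F] (a : Matrix (Fin 2) (Fin 2) F) :
    (a ^ 2).trace = a.trace ^ 2 - 2 * a.det := by
  simp only [pow_two, Matrix.mul_apply, Fin.sum_univ_two, Matrix.trace_fin_two,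
    Matrix.det_fin_two]; ring

/-- Otherwise `H` would contain all of `SL₂`, including a non-split matrix. -/
theorem isScal_of_disc_eq_zero (hℓ : ℓ ≠ 2) {H : Subgroup (GL (Fin 2) (ZMod ℓ))}
    (hsplit : ∀ h ∈ H, IsSquare (disc h.1)) (hirr : NoCommonLine H) :
    ∀ h ∈ H, disc h.1 = 0 → IsScal h.1 := by
  intro h hh h0
  by_contra hs
  obtain ⟨S, hS, hS', -⟩ := exists_not_isSquare_disc (ℓ := ℓ) hℓ
  exact hS' (hsplit S (mem_of_disc_eq_zero hℓ hirr hh h0 hs S hS))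

section Field

variable {F : Type*} [Field F] {k : Type*} [Field k] [Algebra F k]

/-- A nonscalar element of `H` has both its eigenlines over `F`, so a fixed line over `k` is already
rational. If all elements are scalar, every line is stable. -/
theorem not_noCommonLine_of_fixed (h2 : (2 : F) ≠ 0) {H : Subgroup (GL (Fin 2) F)}
    (hsplit : ∀ h ∈ H, IsSquare (disc h.1)) (hss : ∀ h ∈ H, disc h.1 = 0 → IsScal h.1)
    {v : Fin 2 → k} (hv : v ≠ 0) (hfix : ∀ h ∈ H, cross v (bc h.1 *ᵥ v) = 0) :
    ¬ NoCommonLine H := by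
  intro hirr
  by_cases hr : ∃ r ∈ H, ¬ IsScal r.1
  · obtain ⟨r, hr, hrs⟩ := hr
    obtain ⟨u, hu, huv⟩ := exists_rational_of_cross h2 (hsplit r hr)
      (fun h0 => hrs (hss r hr h0)) (hfix r hr)
    obtain ⟨h, hh, hne⟩ := hirr u hu
    apply hne
    obtain ⟨c, hc⟩ := exists_smul_of_cross hv huv
    rw [← map_eq_zero (algebraMap F k), ← cross_bc_mulVec, hc, Matrix.mulVec_smul,
      cross_smul_right, cross_comm, cross_smul_right, cross_comm, hfix h hh]
    simp
  · push Not at hr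
    obtain ⟨h, hh, hne⟩ := hirr ![1, 0] (by rw [vec_ne_zero_iff]; simp)
    exact hne ((hr h hh).cross _)

theorem isSquare_neg_det_of_trace {a : Matrix (Fin 2) (Fin 2) F} (h2 : (2 : F) ≠ 0)
    (hs : IsSquare (disc a)) (ht : a.trace = 0) : IsSquare (-a.det) := by
  obtain ⟨s, hs⟩ := hs
  refine ⟨s / 2, ?_⟩
  rw [disc, ht] at hs
  field_simp
  linear_combination hs

/-- A split matrix of trace zero has `-det` a square. Applying this to `x`, `y` and `x * y` and
comparing determinants makes `-1` a quotient of squares. -/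
theorem isSquare_neg_one_of_klein {x y : GL (Fin 2) F} (h2 : (2 : F) ≠ 0)
    (hx : IsSquare (disc x.1)) (hy : IsSquare (disc y.1)) (hxy : IsSquare (disc (x * y).1))
    (tx : x.1.trace = 0) (ty : y.1.trace = 0) (txy : (x * y).1.trace = 0) :
    IsSquare (-1 : F) := by
  obtain ⟨a, ha⟩ := isSquare_neg_det_of_trace h2 hx tx
  obtain ⟨b, hb⟩ := isSquare_neg_det_of_trace h2 hy ty
  obtain ⟨c, hc⟩ := isSquare_neg_det_of_trace h2 hxy txy
  have hx0 := det_ne_zero x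
  have hy0 := det_ne_zero y
  have ha0 : a ≠ 0 := by rintro rfl; apply hx0; linear_combination -ha
  have hb0 : b ≠ 0 := by rintro rfl; apply hy0; linear_combination -hb
  rw [Units.val_mul, Matrix.det_mul] at hc
  refine ⟨c / (a * b), ?_⟩
  field_simp
  linear_combination hc - x.1.det * hb + b ^ 2 * ha

/-- A nonscalar square whose own square is scalar has trace zero, so `trace ^ 2 = 2 * det` for `x`,
and the discriminant of `x` equals `-trace ^ 2`. -/
theorem isSquare_neg_one_of_order_four {x : GL (Fin 2) F} (h2 : (2 : F) ≠ 0)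
    (hx : IsSquare (disc x.1)) (h4 : IsScal ((x.1 ^ 2) ^ 2)) (hn : ¬ IsScal (x.1 ^ 2)) :
    IsSquare (-1 : F) := by
  have ht := (isScal_sq_iff hn).1 h4
  rw [trace_sq_fin_two] at ht
  obtain ⟨s, hs⟩ := hx
  rw [disc] at hs
  have ht0 : x.1.trace ≠ 0 := by
    intro h0
    rw [h0] at ht
    have : (2 : F) * x.1.det = 0 := by linear_combination -ht
    exact det_ne_zero x ((mul_eq_zero.1 this).resolve_left h2)
  refine ⟨s / x.1.trace, ?_⟩
  field_simp
  linear_combination -2 * ht + hs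

/-- If `-1` is not a square, a group of rationally split matrices has no subgroup of order four
modulo scalars. -/
theorem not_four_dvd_card_map [Finite k] (h2 : (2 : F) ≠ 0) (hneg : ¬ IsSquare (-1 : F))
    {H : Subgroup (GL (Fin 2) F)} (hsplit : ∀ h ∈ H, IsSquare (disc h.1)) :
    ¬ 4 ∣ Nat.card (H.map (lineAction F k)) := by
  intro hdvd
  have : Fact (Nat.Prime 2) := ⟨Nat.prime_two⟩
  obtain ⟨Q, hQ⟩ := Sylow.exists_subgroup_card_pow_prime (G := H.map (lineAction F k)) 2 (n := 2)
    (by simpa using hdvd)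
  norm_num at hQ
  have lift : ∀ γ : H.map (lineAction F k), ∃ h ∈ H, lineAction F k h = γ := fun γ => γ.2
  have hp4 : ∀ γ ∈ Q, γ ^ 4 = 1 := by
    intro γ hγ
    have := pow_card_eq_one' (x := (⟨γ, hγ⟩ : Q))
    rw [hQ] at this
    simpa using congrArg Subtype.val this
  by_cases hsq : ∀ γ ∈ Q, γ ^ 2 = 1
  · have hc : 1 < Nat.card Q := by omega
    obtain ⟨⟨x, hx⟩, hx1⟩ : ∃ x : Q, x ≠ 1 := by
      have : Nontrivial Q := Finite.one_lt_card_iff_nontrivial.1 hc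
      exact exists_ne 1
    obtain ⟨⟨y, hy⟩, hy1⟩ : ∃ y : Q, y ∉ ({1, ⟨x, hx⟩} : Set Q) := by
      by_contra! hcon
      have : (Set.univ : Set Q) ⊆ {1, ⟨x, hx⟩} := fun z _ => hcon z
      have h3 := Set.ncard_le_ncard this (Set.toFinite _)
      rw [Set.ncard_univ, hQ] at h3
      have h4 := Set.ncard_insert_le (1 : Q) {⟨x, hx⟩}
      rw [Set.ncard_singleton] at h4
      omega
    simp only [Set.mem_insert_iff, Set.mem_singleton_iff, not_or, Subtype.mk.injEq] at hy1
    have hx1' : x ≠ 1 := fun h => hx1 (Subtype.ext h)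
    have hy1' : y ≠ 1 := fun h => hy1.1 (Subtype.ext h)
    have hxy : x * y ≠ 1 := by
      intro h
      have h3 : x * x = 1 := by rw [← pow_two]; exact hsq x hx
      exact hy1.2 (mul_left_cancel (h.trans h3.symm))
    obtain ⟨a, ha, hax⟩ := lift x
    obtain ⟨b, hb, hby⟩ := lift y
    have key : ∀ g ∈ H, ∀ γ ∈ Q, lineAction F k g = γ.1 → γ ≠ 1 → g.1.trace = 0 := by
      intro g hg γ hγ he h1
      have hns : ¬ IsScal g.1 := fun hs => h1 (Subtype.ext (by
        rw [← he]; exact (lineAction_eq_one_iff g).2 hs))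
      rw [← isScal_sq_iff hns, ← Units.val_pow_eq_pow_val, ← lineAction_eq_one_iff (k := k),
        map_pow, he]
      exact congrArg Subtype.val (hsq γ hγ)
    exact hneg (isSquare_neg_one_of_klein h2 (hsplit a ha) (hsplit b hb)
      (hsplit _ (H.mul_mem ha hb)) (key a ha x hx hax hx1') (key b hb y hy hby hy1')
      (key _ (H.mul_mem ha hb) _ (Q.mul_mem hx hy) (by rw [map_mul, hax, hby]; rfl) hxy))
  · push Not at hsq
    obtain ⟨γ, hγ, hγ2⟩ := hsq
    obtain ⟨a, ha, hax⟩ := lift γ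
    refine hneg (isSquare_neg_one_of_order_four h2 (hsplit a ha) ?_ ?_)
    · rw [← pow_mul, ← Units.val_pow_eq_pow_val, ← lineAction_eq_one_iff (k := k), map_pow, hax]
      exact congrArg Subtype.val (hp4 γ hγ)
    · rw [← Units.val_pow_eq_pow_val, ← lineAction_eq_one_iff (k := k), map_pow, hax]
      intro h
      exact hγ2 (Subtype.ext h)

end Field

/-- `a` fixes the lines spanned by `x` and `y`. -/
def Fixes {F : Type*} [Field F] (a : Matrix (Fin 2) (Fin 2) F) (x y : Fin 2 → F) : Prop :=
  cross x (a *ᵥ x) = 0 ∧ cross y (a *ᵥ y) = 0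

/-- `a` exchanges the lines spanned by `x` and `y`. -/
def Swaps {F : Type*} [Field F] (a : Matrix (Fin 2) (Fin 2) F) (x y : Fin 2 → F) : Prop :=
  cross y (a *ᵥ x) = 0 ∧ cross x (a *ᵥ y) = 0

section Lines

variable {F : Type*} [Field F] {x y : Fin 2 → F}

theorem cross_mul_mulVec {a b : Matrix (Fin 2) (Fin 2) F} {u v w : Fin 2 → F} (hv : v ≠ 0)
    (hb : cross v (b *ᵥ w) = 0) (ha : cross u (a *ᵥ v) = 0) : cross u ((a * b) *ᵥ w) = 0 := by
  obtain ⟨c, hc⟩ := exists_smul_of_cross hv hb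
  rw [← Matrix.mulVec_mulVec, hc, Matrix.mulVec_smul, cross_smul_right, ha, mul_zero]

theorem Fixes.mul_swaps {a b : Matrix (Fin 2) (Fin 2) F} (hx : x ≠ 0) (hy : y ≠ 0)
    (ha : Fixes a x y) (hb : Swaps b x y) : Swaps (a * b) x y :=
  ⟨cross_mul_mulVec hy hb.1 ha.2, cross_mul_mulVec hx hb.2 ha.1⟩

theorem Swaps.mul_fixes {a b : Matrix (Fin 2) (Fin 2) F} (hx : x ≠ 0) (hy : y ≠ 0)
    (ha : Swaps a x y) (hb : Fixes b x y) : Swaps (a * b) x y :=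
  ⟨cross_mul_mulVec hx hb.1 ha.1, cross_mul_mulVec hy hb.2 ha.2⟩

theorem Swaps.mul_swaps {a b : Matrix (Fin 2) (Fin 2) F} (hx : x ≠ 0) (hy : y ≠ 0)
    (ha : Swaps a x y) (hb : Swaps b x y) : Fixes (a * b) x y :=
  ⟨cross_mul_mulVec hy hb.1 ha.2, cross_mul_mulVec hx hb.2 ha.1⟩

theorem Swaps.trace_eq_zero {a : Matrix (Fin 2) (Fin 2) F} (hxy : cross x y ≠ 0)
    (h : Swaps a x y) : a.trace = 0 := trace_eq_zero_of_swap hxy h.1 h.2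

theorem ne_zero_left_of_cross (hxy : cross x y ≠ 0) : x ≠ 0 := by
  rintro rfl; simp [cross] at hxy

theorem ne_zero_right_of_cross (hxy : cross x y ≠ 0) : y ≠ 0 := by
  rintro rfl; simp [cross] at hxy

/-- A non-scalar matrix fixing two lines fixes no other line. -/
theorem Fixes.eq_of_cross {a : Matrix (Fin 2) (Fin 2) F} (hxy : cross x y ≠ 0)
    (h : Fixes a x y) (ha : ¬ IsScal a) {z : Fin 2 → F} (hz : cross z (a *ᵥ z) = 0) :
    cross x z = 0 ∨ cross y z = 0 := by
  obtain ⟨α, hα⟩ := exists_smul_of_cross (ne_zero_left_of_cross hxy) h.1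
  obtain ⟨β, hβ⟩ := exists_smul_of_cross (ne_zero_right_of_cross hxy) h.2
  have hz' : ∀ z : Fin 2 → F, cross x y • z = cross z y • x + cross x z • y := by
    intro z
    ext i
    fin_cases i <;> simp [cross] <;> ring
  have haz : ∀ z : Fin 2 → F,
      cross x y • (a *ᵥ z) = (cross z y * α) • x + (cross x z * β) • y := by
    intro z
    rw [← Matrix.mulVec_smul, hz', Matrix.mulVec_add, Matrix.mulVec_smul, Matrix.mulVec_smul,
      hα, hβ, smul_smul, smul_smul]
  have key : ∀ z : Fin 2 → F,
      cross x y * cross z (a *ᵥ z) = (β - α) * (cross x z * cross z y) := by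
    intro z
    rw [← cross_smul_right, haz]
    simp only [cross, Pi.add_apply, Pi.smul_apply, smul_eq_mul]; ring
  by_cases hαβ : α = β
  · exfalso
    apply ha
    apply isScal_of_three
    intro v _
    have := key v
    rw [hαβ, sub_self, zero_mul] at this
    exact (mul_eq_zero.1 this).resolve_left hxy
  · have := key z
    rw [hz, mul_zero] at this
    rcases mul_eq_zero.1 (mul_eq_zero.1 this.symm |>.resolve_left
      (sub_ne_zero.2 (Ne.symm hαβ))) with h | h
    · exact Or.inl h
    · exact Or.inr (cross_eq_zero_comm.1 h)

end Lines

/-- The group generated by `H` and an element `m` normalising it with `m ^ 2 ∈ H`. -/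
def adjoinNormalizing {G : Type*} [Group G] (H : Subgroup G) (m : G)
    (hm : ∀ a ∈ H, m * a * m⁻¹ ∈ H) (hm2 : m * m ∈ H) : Subgroup G where
  carrier := {x | x ∈ H ∨ x * m⁻¹ ∈ H}
  one_mem' := Or.inl H.one_mem
  mul_mem' := by
    rintro x y (hx | hx) (hy | hy)
    · exact Or.inl (H.mul_mem hx hy)
    · exact Or.inr (by rw [mul_assoc]; exact H.mul_mem hx hy)
    · refine Or.inr ?_
      have := H.mul_mem hx (hm y hy)
      simpa [mul_assoc] using this
    · refine Or.inl ?_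
      have := H.mul_mem (H.mul_mem hx (hm _ hy)) hm2
      simpa [mul_assoc] using this
  inv_mem' := by
    rintro x (hx | hx)
    · exact Or.inl (H.inv_mem hx)
    · refine Or.inr ?_
      have h1 := hm _ (H.inv_mem hx)
      have h2 := H.mul_mem (H.inv_mem hm2) h1
      simpa [mul_assoc] using h2

/-- When `-1` is a square, a coset of elements of nonzero trace cannot be adjoined to a group of
split matrices without stable line. -/
theorem false_of_coset_trace_ne_zero (hℓ : ℓ ≠ 2) {H : Subgroup (GL (Fin 2) (ZMod ℓ))}
    (hsplit : ∀ h ∈ H, IsSquare (disc h.1)) (hirr : NoCommonLine H) (hsc : scalars 2 (ZMod ℓ) ≤ H)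
    {m : GL (Fin 2) (ZMod ℓ)} (hm : ∀ a ∈ H, m * a * m⁻¹ ∈ H) (hm2 : m * m ∈ H) (hmH : m ∉ H)
    (htr : ∀ a ∈ H, (a * m).1.trace ≠ 0) : False := by
  have h2 := two_ne_zero_zmod hℓ
  have hss := isScal_of_disc_eq_zero hℓ hsplit hirr
  have hcos : ∀ x, x * m⁻¹ ∈ H → x.1.trace ≠ 0 := fun x hx => by
    have := htr _ hx
    rwa [inv_mul_cancel_right] at this
  have hsq : ∀ x, x * m⁻¹ ∈ H → x ^ 2 ∈ H := by
    intro x hx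
    have := H.mul_mem (H.mul_mem hx (hm _ hx)) hm2
    simpa [mul_assoc, pow_two] using this
  have hns : ∀ x, x * m⁻¹ ∈ H → ¬ IsScal x.1 := by
    intro x hx hs
    apply hmH
    have h1 := hsc ((isScal_iff_mem_scalars x).1 hs)
    have := H.mul_mem (H.inv_mem hx) h1
    simpa using this
  set H2 := adjoinNormalizing H m hm hm2 with hH2
  have hss2 : ∀ h ∈ H2, disc h.1 = 0 → IsScal h.1 := by
    rintro x (hx | hx) h0
    · exact hss x hx h0
    · exfalso
      have h3 := hss _ (hsq x hx) (by rw [Units.val_pow_eq_pow_val, disc_sq, h0, mul_zero])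
      rw [Units.val_pow_eq_pow_val, isScal_sq_iff (hns x hx)] at h3
      exact hcos x hx h3
  rcases preservesPair_or_exceptional (k := GaloisField ℓ 2) h2
    (isSquare_algebraMap_galoisField hℓ) H2 hss2 with ⟨v, w, hv, hw, hpair⟩ | ⟨-, h⟩
  · have hfixH : ∀ a ∈ H2, cross w (bc a.1 *ᵥ v) = 0 → cross v (bc a.1 *ᵥ w) = 0 →
        cross v w ≠ 0 → a.1.trace = 0 := by
      intro a _ h3 h4 h5
      have := trace_eq_zero_of_swap h5 h3 h4
      rw [trace_bc] at this
      exact (map_eq_zero _).1 this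
    -- So some `h ∈ H` exchanges the two lines. Then `m` or `h * m` exchanges them as well, and that
    -- element of the coset has trace zero.
    have hno : ¬ ∀ h ∈ H, cross v (bc h.1 *ᵥ v) = 0 := fun hall =>
      not_noCommonLine_of_fixed h2 hsplit hss hv hall hirr
    push Not at hno
    obtain ⟨h, hh, hne⟩ := hno
    have hsw := (hpair h (Or.inl hh)).resolve_left fun h3 => hne h3.1
    have hvw : cross v w ≠ 0 := by
      intro h0
      exact hne (cross_trans hw h0 hsw.1)
    have hmm : m ∈ H2 := Or.inr (by rw [mul_inv_cancel]; exact H.one_mem)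
    have hhm : (h * m) * m⁻¹ ∈ H := by rwa [mul_inv_cancel_right]
    rcases hpair m hmm with h3 | h3
    · have hbc : (bc (h * m).1 : Matrix _ _ (GaloisField ℓ 2)) = bc h.1 * bc m.1 := by
        simp [bc, Matrix.map_mul]
      refine hcos _ hhm (hfixH _ (Or.inr hhm) ?_ ?_ hvw)
      · rw [hbc]; exact cross_mul_mulVec hv h3.1 hsw.1
      · rw [hbc]; exact cross_mul_mulVec hw h3.2 hsw.2
    · exact hcos m (by rw [mul_inv_cancel]; exact H.one_mem) (hfixH m hmm h3.1 h3.2 hvw)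
  -- In the exceptional orders the coset contains a projective involution, again an element of trace
  -- zero.
  · obtain ⟨x, hx, hxH, hx2⟩ := h H (fun a ha => Or.inl ha)
      (fun a _ hs => hsc ((isScal_iff_mem_scalars a).1 hs))
      ⟨m, Or.inr (by rw [mul_inv_cancel]; exact H.one_mem), hmH, fun x hx hxH => by
        have := H.mul_mem (hx.resolve_left hxH) hm2
        simpa [mul_assoc] using this⟩
    have hx' := hx.resolve_left hxH
    exact hcos x hx' ((isScal_sq_iff (hns x hx')).1 hx2)

/-- The exceptional orders are all divisible by four, which is impossible when `-1` is a nonsquare,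
so a pair over `F_{ℓ²}` is preserved. A nonscalar split element fixing both lines then makes them
rational. -/
theorem exists_rational_pair (hℓ : ℓ ≠ 2) {H : Subgroup (GL (Fin 2) (ZMod ℓ))}
    (hsplit : ∀ h ∈ H, IsSquare (disc h.1)) (hirr : NoCommonLine H)
    (hneg : ¬ IsSquare (-1 : ZMod ℓ)) :
    ∃ x y : Fin 2 → ZMod ℓ, cross x y ≠ 0 ∧ (∀ a ∈ H, Fixes a.1 x y ∨ Swaps a.1 x y) ∧
      (∃ r ∈ H, ¬ IsScal r.1 ∧ Fixes r.1 x y) ∧ ∃ h ∈ H, Swaps h.1 x y := by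
  have h2 := two_ne_zero_zmod hℓ
  have hss := isScal_of_disc_eq_zero hℓ hsplit hirr
  rcases preservesPair_or_exceptional (k := GaloisField ℓ 2) h2
    (isSquare_algebraMap_galoisField hℓ) H hss with ⟨v, w, hv, hw, hpair⟩ | ⟨h, -⟩
  · have hno : ¬ ∀ h ∈ H, cross v (bc h.1 *ᵥ v) = 0 := fun hall =>
      not_noCommonLine_of_fixed h2 hsplit hss hv hall hirr
    push Not at hno
    obtain ⟨h, hh, hne⟩ := hno
    have hsw := (hpair h hh).resolve_left fun h3 => hne h3.1
    -- Without such an `r`, the image of `H` modulo scalars would have order two, generated by `h`,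
    -- and a rational eigenline of `h` would be stable under `H`.
    obtain ⟨r, hr, hrs, hrf⟩ : ∃ r ∈ H, ¬ IsScal r.1 ∧
        cross v (bc r.1 *ᵥ v) = 0 ∧ cross w (bc r.1 *ᵥ w) = 0 := by
      by_contra! hcon
      obtain ⟨u, hu, huh⟩ := exists_cross_of_isSquare_disc h2 (hsplit h hh)
      obtain ⟨b, hb, hbu⟩ := hirr u hu
      apply hbu
      have hscal : IsScal b.1 ∨ IsScal (b * h).1 := by
        by_contra! hcon2
        have hbsw := (hpair b hb).resolve_left fun h3 => hcon b hb hcon2.1 h3.1 h3.2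
        refine hcon _ (H.mul_mem hb hh) hcon2.2 ?_ ?_
        · rw [show (bc (b * h).1 : Matrix _ _ (GaloisField ℓ 2)) = bc b.1 * bc h.1 by
            simp [bc, Matrix.map_mul]]
          exact cross_mul_mulVec hw hsw.1 hbsw.2
        · rw [show (bc (b * h).1 : Matrix _ _ (GaloisField ℓ 2)) = bc b.1 * bc h.1 by
            simp [bc, Matrix.map_mul]]
          exact cross_mul_mulVec hv hsw.2 hbsw.1
      rcases hscal with hs | hs
      · exact hs.cross u
      · obtain ⟨c, hc⟩ := exists_smul_of_cross hu huh
        have h3 : c • (b.1 *ᵥ u) = (b * h).1 0 0 • u := by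
          rw [← hs.mulVec, Units.val_mul, ← Matrix.mulVec_mulVec, hc, Matrix.mulVec_smul]
        have hc0 : c ≠ 0 := by
          rintro rfl
          rw [zero_smul] at hc
          exact mulVec_ne_zero h hu hc
        have h4 : c * cross u (b.1 *ᵥ u) = 0 := by
          rw [← cross_smul_right, h3, cross_smul_right, cross_self, mul_zero]
        exact (mul_eq_zero.1 h4).resolve_left hc0
    obtain ⟨x, y, hx, hy, hrx, hry, hxy⟩ := hpair.rational h2 hv hw (hsplit r hr)
      (fun h0 => hrs (hss r hr h0)) hrf.1 hrf.2
    obtain ⟨h', hh', hne'⟩ := hirr x hx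
    have hsw' := (hxy h' hh').resolve_left fun h3 => hne' h3.1
    have hcr : cross x y ≠ 0 := fun h0 => hne' (cross_trans hy h0 hsw'.1)
    exact ⟨x, y, hcr, hxy, ⟨r, hr, hrs, hrx, hry⟩, h', hh', hsw'⟩
  · exfalso
    apply not_four_dvd_card_map (k := GaloisField ℓ 2) h2 hneg hsplit
    rcases h with h | h | h <;> rw [h] <;> norm_num

/-- The structure of a group of split matrices together with a normalizing coset coming from
similitudes that exchange two totally isotropic planes. -/
theorem exists_pair_of_coset (hℓ : ℓ ≠ 2) {H : Subgroup (GL (Fin 2) (ZMod ℓ))}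
    (hsplit : ∀ h ∈ H, IsSquare (disc h.1)) (hirr : NoCommonLine H) (hsc : scalars 2 (ZMod ℓ) ≤ H)
    {m : GL (Fin 2) (ZMod ℓ)} (hm : ∀ a ∈ H, m * a * m⁻¹ ∈ H) (hm2 : m * m ∈ H)
    (hcos : ∀ a ∈ H, ((a * m).1.trace = 0 ∧ ¬ IsSquare (-1 : ZMod ℓ)) ∨
      ((a * m).1.trace ≠ 0 ∧ ¬ IsSquare (a * m).1.det)) :
    ¬ IsSquare (-1 : ZMod ℓ) ∧ ∃ x y : Fin 2 → ZMod ℓ, cross x y ≠ 0 ∧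
      (∀ a ∈ H, (Fixes a.1 x y ∧ IsSquare a.1.det) ∨ (Swaps a.1 x y ∧ IsSquare (-a.1.det))) ∧
      ∃ a ∈ H, Swaps (a * m).1 x y ∧ IsSquare (a * m).1.det := by
  have h2 := two_ne_zero_zmod hℓ
  have hneg : ¬ IsSquare (-1 : ZMod ℓ) := by
    intro hneg
    have hcos' : ∀ a ∈ H, (a * m).1.trace ≠ 0 ∧ ¬ IsSquare (a * m).1.det := fun a ha =>
      (hcos a ha).resolve_left fun h => h.2 hneg
    -- If `m` were in `H`, the identity would belong to the coset, yet its determinant is a square.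
    refine false_of_coset_trace_ne_zero hℓ hsplit hirr hsc hm hm2 (fun hmH => ?_)
      (fun a ha => (hcos' a ha).1)
    have := (hcos' _ (H.inv_mem hmH)).2
    rw [inv_mul_cancel, Units.val_one, Matrix.det_one] at this
    exact this ⟨1, by ring⟩
  refine ⟨hneg, ?_⟩
  obtain ⟨x, y, hxy, hpair, ⟨r, hr, hrs, hrf⟩, h, hh, hsw⟩ :=
    exists_rational_pair hℓ hsplit hirr hneg
  have hx := ne_zero_left_of_cross hxy
  have hy := ne_zero_right_of_cross hxy
  have hsq : ∀ a ∈ H, Swaps a.1 x y → IsSquare (-a.1.det) := fun a ha hs =>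
    isSquare_neg_det_of_trace h2 (hsplit a ha) (hs.trace_eq_zero hxy)
  have hnsq : ∀ {s : ZMod ℓ}, s ≠ 0 → IsSquare (-s) → ¬ IsSquare s := by
    rintro s hs ⟨b, hb⟩ ⟨a, ha⟩
    have ha0 : a ≠ 0 := by rintro rfl; simp [ha] at hs
    apply hneg
    refine ⟨b / a, ?_⟩
    field_simp
    linear_combination hb + ha
  have hquot : ∀ {s t u : ZMod ℓ}, s ≠ 0 → IsSquare s → u = s * t → IsSquare u → IsSquare t := by
    rintro s t u hs ⟨a, ha⟩ hu ⟨b, hb⟩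
    have ha0 : a ≠ 0 := by rintro rfl; simp [ha] at hs
    refine ⟨b / a, ?_⟩
    field_simp
    linear_combination hb - hu - t * ha
  refine ⟨x, y, hxy, fun a ha => ?_, ?_⟩
  · rcases hpair a ha with h3 | h3
    · left
      refine ⟨h3, ?_⟩
      -- Both `h` and `h * a` exchange the lines, so both have `-det` a square; dividing gives `det
      -- a`.
      have h4 := hsq _ (H.mul_mem hh ha) (hsw.mul_fixes hx hy h3)
      exact hquot (neg_ne_zero.2 (det_ne_zero h)) (hsq h hh hsw)
        (by rw [Units.val_mul, Matrix.det_mul]; ring) h4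
    · exact Or.inr ⟨h3, hsq a ha h3⟩
  -- `m` preserves the pair of lines
  have hm' : m⁻¹ * r * m ∈ H := by
    have := H.mul_mem (H.mul_mem (H.inv_mem hm2) (hm r hr)) hm2
    simpa [mul_assoc] using this
  have hm'f : Fixes (m⁻¹ * r * m).1 x y := by
    -- If the conjugate exchanged the lines, `r` would have trace zero, and `h`, `r`, `h * r` would
    -- form a projective Klein four-group.
    refine (hpair _ hm').resolve_right fun hs => hneg ?_
    have t1 : r.1.trace = 0 := by
      have := hs.trace_eq_zero hxy
      rwa [Units.val_mul, Matrix.trace_mul_comm, ← Units.val_mul,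
        mul_inv_cancel_left] at this
    exact isSquare_neg_one_of_klein h2 (hsplit h hh) (hsplit r hr) (hsplit _ (H.mul_mem hh hr))
      (hsw.trace_eq_zero hxy) t1 ((hsw.mul_fixes hx hy hrf).trace_eq_zero hxy)
  -- Eigenlines of `m⁻¹ * r * m` are carried by `m` to eigenlines of `r`, of which there are only
  -- two. Hence `m` preserves the pair.
  have himg : ∀ z : Fin 2 → ZMod ℓ, cross z ((m⁻¹ * r * m).1 *ᵥ z) = 0 →
      cross x (m.1 *ᵥ z) = 0 ∨ cross y (m.1 *ᵥ z) = 0 := by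
    intro z hz
    refine hrf.eq_of_cross hxy hrs ?_
    have h3 := cross_mulVec_mulVec m.1 z ((m⁻¹ * r * m).1 *ᵥ z)
    rw [hz, mul_zero, Matrix.mulVec_mulVec, ← Units.val_mul, mul_assoc m⁻¹,
      mul_inv_cancel_left, Units.val_mul, ← Matrix.mulVec_mulVec] at h3
    exact h3
  have hdist : ∀ z, z ≠ 0 → cross z (m.1 *ᵥ x) = 0 → cross z (m.1 *ᵥ y) ≠ 0 := by
    intro z hz h3 h4
    have h5 := cross_mulVec_mulVec m.1 x y
    rw [cross_trans hz (cross_eq_zero_comm.1 h3) h4] at h5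
    exact mul_ne_zero (det_ne_zero m) hxy h5.symm
  have hmp : Fixes m.1 x y ∨ Swaps m.1 x y := by
    rcases himg x hm'f.1 with h3 | h3 <;> rcases himg y hm'f.2 with h4 | h4
    · exact absurd h4 (hdist x hx h3)
    · exact Or.inl ⟨h3, h4⟩
    · exact Or.inr ⟨h3, h4⟩
    · exact absurd h4 (hdist y hy h3)
  have hdet : ∀ a ∈ H, ¬ IsSquare (a * m).1.det ∨ (a * m).1.trace = 0 := by
    intro a ha
    rcases hcos a ha with h3 | h3
    · exact Or.inr h3.1
    · exact Or.inl h3.2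
  have hfixdet : ∀ a ∈ H, Fixes (a * m).1 x y → ¬ IsSquare (a * m).1.det := by
    intro a ha hf
    rcases hdet a ha with h3 | h3
    · exact h3
    · refine hnsq (det_ne_zero _) (isSquare_neg_det_of_trace h2 ?_ h3)
      exact isSquare_disc_of_cross hx hf.1
  -- Multiplying by `h` turns an exchanging element of the coset into a fixing one, of nonsquare
  -- determinant. As `det h` is itself a nonsquare, the original determinant is a square.
  have hfin : ∀ a ∈ H, Swaps (a * m).1 x y → IsSquare (a * m).1.det := by
    intro a ha hs
    have h3 : Fixes (h * (a * m)).1 x y := hsw.mul_swaps hx hy hs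
    have h4 : ¬ IsSquare (h * a * m).1.det :=
      hfixdet _ (H.mul_mem hh ha) (by rw [mul_assoc]; exact h3)
    have h5 : ¬ IsSquare h.1.det := hnsq (det_ne_zero h) (hsq h hh hsw)
    rw [mul_assoc, Units.val_mul, Matrix.det_mul] at h4
    by_contra h6
    apply h4
    exact isSquare_mul_of_not_isSquare h5 h6
  rcases hmp with h3 | h3
  · have h4 : Swaps (h * m).1 x y := hsw.mul_fixes hx hy h3
    exact ⟨h, hh, h4, hfin h hh h4⟩
  · have h4 : Swaps (1 * m).1 x y := by rwa [one_mul]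
    exact ⟨1, H.one_mem, h4, hfin 1 H.one_mem h4⟩

end IsotropicCore

/-! ### Subgroups of `SL₂ × SL₂` whose elements have a split component -/

section NonsingularCore

/-- Each fibre of `f` lies in a translate of `R`. No multiplicativity of `f` is needed. -/
theorem card_le_mul_ncard {G β : Type*} [Group G] [Finite β] (f : G → β)
    (R : Set G) (hR : R.Finite) (h : ∀ g g', f g = f g' → g⁻¹ * g' ∈ R) :
    Nat.card G ≤ Nat.card β * R.ncard := by
  classical
  have hr : ∀ g, f (Function.invFun f (f g)) = f g := fun g => Function.invFun_eq ⟨g, rfl⟩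
  have := hR.to_subtype
  rw [← Nat.card_coe_set_eq, ← Nat.card_prod]
  refine Nat.card_le_card_of_injective
    (fun g => (f g, (⟨(Function.invFun f (f g))⁻¹ * g, h _ _ (hr g)⟩ : R))) ?_
  intro g g' hgg
  simp only [Prod.mk.injEq, Subtype.mk.injEq] at hgg
  obtain ⟨h1, h2⟩ := hgg
  rw [h1] at h2
  exact mul_left_cancel h2

theorem eq_one_or_neg_one_of_isScal {F : Type*} [Field F] {a : GL (Fin 2) F} (h : IsScal a.1)
    (hd : a.1.det = 1) : a = 1 ∨ a = -1 := by
  rw [Matrix.det_fin_two, h.1, h.2.2] at hd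
  have : (a.1 1 1 - 1) * (a.1 1 1 + 1) = 0 := by linear_combination hd
  rcases mul_eq_zero.1 this with h3 | h3
  · left
    ext i j
    fin_cases i <;> fin_cases j <;> simp [h.1, h.2.1, h.2.2, sub_eq_zero.1 h3]
  · right
    ext i j
    fin_cases i <;> fin_cases j <;> simp [h.1, h.2.1, h.2.2, eq_neg_of_add_eq_zero_left h3]

section Field

variable {F : Type*} [Field F] {k : Type*} [Field k] [Algebra F k]

theorem Fixes.inv {a : GL (Fin 2) F} {x y : Fin 2 → F} (h : Fixes a.1 x y) :
    Fixes (a⁻¹).1 x y := by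
  have key : ∀ u v, cross u (a.1 *ᵥ v) = 0 → cross v ((a⁻¹).1 *ᵥ u) = 0 := by
    intro u v huv
    have h1 := cross_mulVec_mulVec (a⁻¹).1 u (a.1 *ᵥ v)
    rw [huv, mul_zero, Matrix.mulVec_mulVec, ← Units.val_mul, inv_mul_cancel, Units.val_one,
      Matrix.one_mulVec] at h1
    exact cross_eq_zero_comm.1 h1
  exact ⟨key _ _ h.1, key _ _ h.2⟩

theorem Swaps.inv {a : GL (Fin 2) F} {x y : Fin 2 → F} (h : Swaps a.1 x y) :
    Swaps (a⁻¹).1 x y := by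
  have key : ∀ u v, cross u (a.1 *ᵥ v) = 0 → cross v ((a⁻¹).1 *ᵥ u) = 0 := by
    intro u v huv
    have h1 := cross_mulVec_mulVec (a⁻¹).1 u (a.1 *ᵥ v)
    rw [huv, mul_zero, Matrix.mulVec_mulVec, ← Units.val_mul, inv_mul_cancel, Units.val_one,
      Matrix.one_mulVec] at h1
    exact cross_eq_zero_comm.1 h1
  exact ⟨key _ _ h.2, key _ _ h.1⟩

theorem Fixes.conj {a z : GL (Fin 2) F} {x y : Fin 2 → F} (hx : x ≠ 0) (hy : y ≠ 0)
    (h : Fixes a.1 x y) (hz : Fixes z.1 x y ∨ Swaps z.1 x y) : Fixes (z * a * z⁻¹).1 x y := by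
  rw [Units.val_mul, Units.val_mul]
  rcases hz with hz | hz
  · have h1 := hz.inv
    exact ⟨cross_mul_mulVec hx h1.1 (cross_mul_mulVec hx h.1 hz.1),
      cross_mul_mulVec hy h1.2 (cross_mul_mulVec hy h.2 hz.2)⟩
  · exact Swaps.mul_swaps hx hy (hz.mul_fixes hx hy h) hz.inv

theorem bc_mul (a b : Matrix (Fin 2) (Fin 2) F) :
    (bc (a * b) : Matrix (Fin 2) (Fin 2) k) = bc a * bc b := by
  simp [bc, Matrix.map_mul]

theorem IsScal.of_conj {a z : GL (Fin 2) F} (h : IsScal (z * a * z⁻¹).1) : IsScal a.1 := by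
  rw [isScal_iff_mem_scalars] at *
  obtain ⟨c, hc⟩ := h
  refine ⟨c, ?_⟩
  have h1 : a = z⁻¹ * (z * a * z⁻¹) * z := by group
  rw [h1, ← hc]
  have h2 : Matrix.GeneralLinearGroup.scalar (Fin 2) c ∈ Subgroup.center (GL (Fin 2) F) := by
    rw [Matrix.GeneralLinearGroup.center_eq_range_scalar]; exact ⟨c, rfl⟩
  rw [Subgroup.mem_center_iff.1 h2 z⁻¹, mul_assoc, inv_mul_cancel, mul_one]

end Field

/-- A subgroup covered by two subgroups is contained in one of them. -/
theorem forall_or_forall_of_cover {G : Type*} [Group G] (R A B : Subgroup G)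
    (h : ∀ x ∈ R, x ∈ A ∨ x ∈ B) : (∀ x ∈ R, x ∈ A) ∨ ∀ x ∈ R, x ∈ B := by
  by_contra! hcon
  obtain ⟨⟨x, hx, hxA⟩, y, hy, hyB⟩ := hcon
  have hxB := (h x hx).resolve_left hxA
  have hyA := (h y hy).resolve_right hyB
  rcases h _ (R.mul_mem hx hy) with h1 | h1
  · exact hxA (by simpa using A.mul_mem h1 (A.inv_mem hyA))
  · exact hyB (by simpa using B.mul_mem (B.inv_mem hxB) h1)

variable {ℓ : ℕ} [Fact ℓ.Prime]

/-- Diagonalizable matrices are killed by `ℓ - 1`; the factor `ℓ` takes care of a double eigenvalue.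
-/
theorem pow_eq_one_of_isSquare_disc (hℓ : ℓ ≠ 2) {d : GL (Fin 2) (ZMod ℓ)}
    (hs : IsSquare (disc d.1)) : d ^ ((ℓ - 1) * ℓ) = 1 := by
  have h2 := two_ne_zero_zmod hℓ
  have heig : ∀ x : Fin 2 → ZMod ℓ, x ≠ 0 → cross x (d.1 *ᵥ x) = 0 →
      (d.1 ^ (ℓ - 1)) *ᵥ x = x := by
    intro x hx hc
    obtain ⟨α, hα⟩ := exists_smul_of_cross hx hc
    have hα0 : α ≠ 0 := by
      rintro rfl
      rw [zero_smul] at hα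
      exact mulVec_ne_zero d hx hα
    have : ∀ n : ℕ, (d.1 ^ n) *ᵥ x = α ^ n • x := by
      intro n
      induction n with
      | zero => simp
      | succ n ih => rw [pow_succ, ← Matrix.mulVec_mulVec, hα, Matrix.mulVec_smul, ih, smul_smul,
          pow_succ, mul_comm]
    rw [this, ZMod.pow_card_sub_one_eq_one hα0, one_smul]
  by_cases h0 : disc d.1 = 0
  · by_cases hsc : IsScal d.1
    · have h1 : d ^ (ℓ - 1) = 1 := by
        apply Units.ext
        rw [Units.val_pow_eq_pow_val, Units.val_one]
        apply Matrix.ext_of_mulVec_single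
        intro i
        rw [heig _ _ (hsc.cross _), Matrix.one_mulVec]
        simp
      rw [pow_mul, h1, one_pow]
    · obtain ⟨n, -, -, hn⟩ := exists_nilpotent_of_disc_eq_zero hℓ h0 hsc
      apply Units.ext
      rw [hn, CharP.cast_eq_zero, zero_smul, add_zero, Units.val_one]
  · obtain ⟨δ, hδ⟩ := hs
    obtain ⟨v, w, hvw, c, hc, e1, e2, e3⟩ := exists_factors (a := d.1) h2 (δ := δ)
      (by rw [hδ]; ring) (by rintro rfl; apply h0; rw [hδ]; ring)
    have hq : ∀ u, cross u (d.1 *ᵥ u) = c * (cross v u * cross w u) := by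
      intro u
      rw [cross_mulVec]
      simp only [cross]
      linear_combination u 0 ^ 2 * e1 + u 0 * u 1 * e2 + u 1 ^ 2 * e3
    have hv := heig v (ne_zero_left_of_cross hvw) (by rw [hq, cross_self]; ring)
    have hw := heig w (ne_zero_right_of_cross hvw) (by rw [hq, cross_self]; ring)
    have h1 : d ^ (ℓ - 1) = 1 := by
      apply Units.ext
      rw [Units.val_pow_eq_pow_val, Units.val_one]
      apply Matrix.ext_of_mulVec_single
      intro i
      rw [Matrix.one_mulVec]
      set z : Fin 2 → ZMod ℓ := Pi.single i 1
      have hz : cross v w • z = cross z w • v + cross v z • w := by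
        ext i
        fin_cases i <;> simp [cross] <;> ring
      have h3 : cross v w • ((d.1 ^ (ℓ - 1)) *ᵥ z) = cross v w • z := by
        rw [← Matrix.mulVec_smul, hz, Matrix.mulVec_add, Matrix.mulVec_smul, Matrix.mulVec_smul,
          hv, hw]
      exact smul_right_injective _ hvw h3
    rw [pow_mul, h1, one_pow]

theorem sq_eq_of_det_one {S : Matrix (Fin 2) (Fin 2) (ZMod ℓ)} (hS : S.det = 1) :
    S * S = S.trace • S - 1 := by
  rw [Matrix.det_fin_two] at hS
  ext i j
  fin_cases i <;> fin_cases j <;>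
    simp [Matrix.mul_apply, Fin.sum_univ_two, Matrix.trace_fin_two] <;>
    first | ring1 | linear_combination -hS

/-- The `ℓ`-th power changes the sign of `2 S - t`, whose square is a nonsquare scalar. Therefore `S
^ ℓ = t - S`, which is the inverse of `S` by Cayley–Hamilton. -/
theorem pow_succ_eq_one_of_not_isSquare_disc (hℓ : ℓ ≠ 2) {S : Matrix (Fin 2) (Fin 2) (ZMod ℓ)}
    (hS : S.det = 1) (hs : ¬ IsSquare (disc S)) : S ^ (ℓ + 1) = 1 := by
  have hp : ℓ.Prime := Fact.out
  have h2 := two_ne_zero_zmod hℓ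
  have hSS := sq_eq_of_det_one hS
  set t := S.trace with ht
  have hΔ : ((2 : ZMod ℓ) • S - t • 1) ^ 2 = disc S • (1 : Matrix (Fin 2) (Fin 2) (ZMod ℓ)) := by
    rw [pow_two, sub_mul, mul_sub, mul_sub, smul_mul_smul_comm, hSS, disc, hS, ← ht]
    simp only [smul_mul_smul_comm, Matrix.mul_one, Matrix.one_mul]
    module
  have hd0 : disc S ≠ 0 := fun h => hs (by rw [h]; exact ⟨0, by ring⟩)
  obtain ⟨m, hm⟩ := hp.odd_of_ne_two hℓ
  have hE : disc S ^ m = -1 := by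
    have h1 := ZMod.pow_div_two_eq_neg_one_or_one ℓ hd0
    have h3 : ℓ / 2 = m := by omega
    rw [h3] at h1
    refine h1.resolve_left fun h4 => hs ?_
    rw [ZMod.euler_criterion ℓ hd0, h3]; exact h4
  have h3 : ((2 : ZMod ℓ) • S - t • 1) ^ ℓ = -((2 : ZMod ℓ) • S - t • 1) := by
    have h5 : ∀ (X : Matrix (Fin 2) (Fin 2) (ZMod ℓ)), X ^ ℓ = X ^ (2 * m + 1) := fun X => by
      conv_rhs => rw [← hm]
    rw [h5, pow_succ, pow_mul, hΔ, smul_pow, hE, one_pow]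
    simp
  have hcomm : Commute ((2 : ZMod ℓ) • S) (t • (1 : Matrix (Fin 2) (Fin 2) (ZMod ℓ))) := by
    rw [Commute, SemiconjBy]; simp [smul_smul, mul_comm]
  rw [sub_pow_char_of_commute ℓ hcomm, smul_pow, smul_pow, ZMod.pow_card, ZMod.pow_card,
    one_pow] at h3
  have h4 : S ^ ℓ = t • 1 - S := by
    have : (2 : ZMod ℓ) • S ^ ℓ = (2 : ZMod ℓ) • (t • 1 - S) := by
      rw [sub_eq_iff_eq_add] at h3
      rw [h3]; module
    exact smul_right_injective _ h2 this
  rw [pow_succ, h4, sub_mul, hSS, smul_mul_assoc, one_mul]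
  abel

/-- Reducing `S ^ 4` by Cayley–Hamilton gives `(t ^ 3 - 2 t) S + (1 - t ^ 2)`. Since `S` is not
scalar, `S ^ 4 = 1` would force `t ^ 2 = 0`. -/
theorem pow_four_ne_one {S : GL (Fin 2) (ZMod ℓ)} (hS : S.1.det = 1)
    (hs : ¬ IsSquare (disc S.1)) (ht : S.1.trace ≠ 0) : S.1 ^ 4 ≠ 1 := by
  intro h4
  have hns : ¬ IsScal S.1 := fun h => hs (by
    rw [disc_eq, h.1, h.2.2]; exact ⟨0, by ring⟩)
  have hSS := sq_eq_of_det_one hS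
  set t := S.1.trace with htd
  have h5 : S.1 ^ 4 = (t ^ 3 - 2 * t) • S.1 + (1 - t ^ 2) • 1 := by
    have : S.1 ^ 4 = (S.1 * S.1) * (S.1 * S.1) := by noncomm_ring
    rw [this, hSS, sub_mul, mul_sub, smul_mul_smul_comm, hSS]
    simp only [Matrix.mul_one, Matrix.one_mul]
    module
  rw [h4] at h5
  have hzero : t ^ 3 - 2 * t = 0 := by
    by_contra hne
    apply hns
    have e01 := congrFun (congrFun h5 0) 1
    have e10 := congrFun (congrFun h5 1) 0
    have e00 := congrFun (congrFun h5 0) 0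
    have e11 := congrFun (congrFun h5 1) 1
    simp at e01 e10 e00 e11
    refine ⟨e01.resolve_left hne, e10.resolve_left hne, ?_⟩
    exact mul_left_cancel₀ hne (by linear_combination e11 - e00)
  rw [hzero, zero_smul, zero_add] at h5
  have e00 := congrFun (congrFun h5 0) 0
  simp only [Matrix.one_apply_eq, Matrix.smul_apply, smul_eq_mul, mul_one] at e00
  exact ht (pow_eq_zero_iff two_ne_zero |>.1 (by linear_combination e00))

theorem disc_mul_of_isScal {F : Type*} [Field F] {a b : Matrix (Fin 2) (Fin 2) F}
    (h : IsScal b) : disc (a * b) = b 0 0 ^ 2 * disc a := by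
  simp only [disc_eq, Matrix.mul_apply, Fin.sum_univ_two, h.1, h.2.1, ← h.2.2]
  ring

/-- A subgroup of `SL₂ × SL₂` with full projections contains a pair of non-split elements. -/
theorem exists_pair_not_isSquare_disc (hℓ : 5 ≤ ℓ)
    (GG : Subgroup (GL (Fin 2) (ZMod ℓ) × GL (Fin 2) (ZMod ℓ)))
    (hdet : ∀ p ∈ GG, p.1.1.det = 1 ∧ p.2.1.det = 1)
    (h1 : ∀ S : GL (Fin 2) (ZMod ℓ), S.1.det = 1 → ∃ d, (S, d) ∈ GG)
    (h2 : ∀ S : GL (Fin 2) (ZMod ℓ), S.1.det = 1 → ∃ a, (a, S) ∈ GG) :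
    ∃ p ∈ GG, ¬ IsSquare (disc p.1.1) ∧ ¬ IsSquare (disc p.2.1) := by
  have hℓ2 : ℓ ≠ 2 := by omega
  obtain ⟨S, hS, hSs, hSt⟩ := exists_not_isSquare_disc (ℓ := ℓ) hℓ2
  replace hSt := hSt (by omega)
  let SL := Matrix.SpecialLinearGroup (Fin 2) (ZMod ℓ)
  -- Goursat's subgroup: its normality comes from the surjectivity of the first projection, and
  -- simplicity of `PSL₂` leaves two possibilities for its image.
  let N : Subgroup SL := GG.comap
    ((Matrix.SpecialLinearGroup.toGL : SL →* GL (Fin 2) (ZMod ℓ)).prod 1)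
  have hN : ∀ n : SL, n ∈ N ↔ (Matrix.SpecialLinearGroup.toGL n, 1) ∈ GG := fun n => Iff.rfl
  have hNn : N.Normal := by
    constructor
    intro n hn g
    obtain ⟨d, hd⟩ := h1 (Matrix.SpecialLinearGroup.toGL g) g.2
    rw [hN] at hn ⊢
    have := GG.mul_mem (GG.mul_mem hd hn) (GG.inv_mem hd)
    simpa using this
  have hsimple : IsSimpleGroup (Matrix.ProjectiveSpecialLinearGroup (Fin 2) (ZMod ℓ)) :=
    Matrix.ProjectiveSpecialLinearGroup.rank_two_simple (by rw [Nat.card_zmod]; omega)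
  have hmapn : (N.map (QuotientGroup.mk' (Subgroup.center SL))).Normal :=
    hNn.map _ (QuotientGroup.mk'_surjective _)
  have hscal : ∀ c ∈ Subgroup.center SL, IsScal c.1 := by
    intro c hc
    obtain ⟨r, -, hr⟩ := Matrix.SpecialLinearGroup.mem_center_iff.1 hc
    rw [← hr]
    simp [IsScal]
  rcases hsimple.eq_bot_or_eq_top_of_normal _ hmapn with hbot | htop
  -- If `N` is central and the partner `d` of `S` were split, a power killing `d` would send `S`
  -- into the centre. This contradicts the order of `S`, which divides `ℓ + 1` but not four.
  · obtain ⟨d, hd⟩ := h1 S hS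
    refine ⟨_, hd, hSs, fun hds => ?_⟩
    have h3 := GG.pow_mem hd ((ℓ - 1) * ℓ)
    rw [Prod.pow_mk, pow_eq_one_of_isSquare_disc hℓ2 hds] at h3
    let S' : SL := ⟨S.1, hS⟩
    have hS' : Matrix.SpecialLinearGroup.toGL S' = S := Units.ext rfl
    have h4 : S' ^ ((ℓ - 1) * ℓ) ∈ N := by
      rw [hN, map_pow, hS']; exact h3
    have h5 : S' ^ ((ℓ - 1) * ℓ) ∈ Subgroup.center SL := by
      have := Subgroup.mem_map_of_mem (QuotientGroup.mk' (Subgroup.center SL)) h4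
      rw [hbot, Subgroup.mem_bot] at this
      exact (QuotientGroup.eq_one_iff _).1 this
    have h6 : S ^ ((ℓ - 1) * ℓ) = 1 ∨ S ^ ((ℓ - 1) * ℓ) = -1 := by
      refine eq_one_or_neg_one_of_isScal ?_ (by
        rw [Units.val_pow_eq_pow_val, Matrix.det_pow, hS, one_pow])
      have := hscal _ h5
      rw [Matrix.SpecialLinearGroup.coe_pow] at this
      rw [Units.val_pow_eq_pow_val]; exact this
    have h7 : S ^ (2 * ((ℓ - 1) * ℓ)) = 1 := by
      rw [mul_comm 2, pow_mul]
      rcases h6 with h6 | h6 <;> rw [h6] <;> simp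
    have h8 : S ^ (ℓ + 1) = 1 := by
      apply Units.ext
      rw [Units.val_pow_eq_pow_val]
      exact pow_succ_eq_one_of_not_isSquare_disc hℓ2 hS hSs
    have h9 : S ^ 4 = 1 := by
      have e : 2 * ((ℓ - 1) * ℓ) = (ℓ + 1) * (2 * (ℓ - 2)) + 4 := by
        obtain ⟨r, rfl⟩ : ∃ r, ℓ = r + 5 := ⟨ℓ - 5, by omega⟩
        simp only [show r + 5 - 1 = r + 4 by omega, show r + 5 - 2 = r + 3 by omega]
        ring
      rw [e, pow_add, pow_mul, h8, one_pow, one_mul] at h7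
      exact h7
    exact pow_four_ne_one hS hSs hSt (by rw [← Units.val_pow_eq_pow_val, h9, Units.val_one])
  -- If `N` maps onto `PSL₂`, the first component over `S` can be adjusted within `N` to be `S`
  -- times a central element, hence non-split.
  · obtain ⟨b, hb⟩ := h2 S hS
    let S' : SL := ⟨S.1, hS⟩
    let b' : SL := ⟨b.1, (hdet _ hb).1⟩
    have hb' : Matrix.SpecialLinearGroup.toGL b' = b := Units.ext rfl
    have h3 : (QuotientGroup.mk' (Subgroup.center SL)) (S' * b'⁻¹) ∈
        N.map (QuotientGroup.mk' (Subgroup.center SL)) := by rw [htop]; trivial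
    obtain ⟨n, hn, hnS⟩ := h3
    obtain ⟨c, hc, hcn⟩ := (QuotientGroup.mk'_eq_mk' _).1 hnS.symm
    have h4 : n * b' = S' * c := by
      rw [← hcn, mul_assoc, mul_assoc, ← Subgroup.mem_center_iff.1 hc b', inv_mul_cancel_left]
    refine ⟨(Matrix.SpecialLinearGroup.toGL n, 1) * (b, S), GG.mul_mem hn hb, ?_, by simpa using hSs⟩
    have h5 : ((Matrix.SpecialLinearGroup.toGL n, (1 : GL (Fin 2) (ZMod ℓ))) * (b, S)).1.1
        = S.1 * c.1 := by
      have := congrArg (fun x : SL => x.1) h4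
      exact this
    rw [h5, disc_mul_of_isScal (hscal c hc)]
    rintro ⟨r, hr⟩
    have hc0 : c.1 0 0 ≠ 0 := by
      intro h0
      have := c.2
      rw [Matrix.det_fin_two, (hscal c hc).1, h0] at this
      simp at this
    apply hSs
    refine ⟨r / c.1 0 0, ?_⟩
    field_simp
    linear_combination hr

/-- Subgroups of `SL₂ × SL₂` in which every element has a split component and which admit a
symmetry exchanging the two components. -/
theorem exists_pair_or_card_le (hℓ : ℓ ≠ 2)
    (GG : Subgroup (GL (Fin 2) (ZMod ℓ) × GL (Fin 2) (ZMod ℓ)))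
    (hdet : ∀ p ∈ GG, p.1.1.det = 1 ∧ p.2.1.det = 1)
    (hspl : ∀ p ∈ GG, IsSquare (disc p.1.1) ∨ IsSquare (disc p.2.1))
    (hirr : NoCommonLine (GG.map (MonoidHom.fst _ _))) {z : GL (Fin 2) (ZMod ℓ)}
    (hz : (z, z) ∈ GG) (hsym : ∀ a d, (a, d) ∈ GG → (z * d * z⁻¹, a) ∈ GG) :
    (IsSquare (-1 : ZMod ℓ) ∧ ∃ x y : Fin 2 → ZMod ℓ, cross x y ≠ 0 ∧ ∀ p ∈ GG,
      (Fixes p.1.1 x y ∨ Swaps p.1.1 x y) ∧ (Fixes p.2.1 x y ∨ Swaps p.2.1 x y)) ∨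
    Nat.card GG ≤ 14400 := by
  have h2 := two_ne_zero_zmod hℓ
  set A := GG.map (MonoidHom.fst _ _) with hA
  have hA1 : ∀ p ∈ GG, p.1 ∈ A := fun p hp => Subgroup.mem_map_of_mem (MonoidHom.fst _ _) hp
  have hzA : z ∈ A := hA1 _ hz
  have hA2 : ∀ p ∈ GG, p.2 ∈ A := by
    rintro ⟨a, d⟩ hp
    have := A.mul_mem (A.mul_mem (A.inv_mem hzA) (hA1 _ (hsym a d hp))) hzA
    simpa [mul_assoc] using this
  have hex1 : ∀ a ∈ A, ∃ d, (a, d) ∈ GG := by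
    rintro _ ⟨⟨a, d⟩, hp, rfl⟩
    exact ⟨d, hp⟩
  have hex2 : ∀ d ∈ A, ∃ a, (a, d) ∈ GG := by
    intro a ha
    obtain ⟨d, hd⟩ := hex1 a ha
    exact ⟨_, hsym a d hd⟩
  have hAdet : ∀ a ∈ A, a.1.det = 1 := fun a ha => by
    obtain ⟨d, hd⟩ := hex1 a ha
    exact (hdet _ hd).1
  have hcardA : Nat.card GG ≤ Nat.card A * Nat.card A := by
    rw [← Nat.card_prod]
    refine Nat.card_le_card_of_injective
      (fun p : GG => ((⟨p.1.1, hA1 _ p.2⟩ : A), (⟨p.1.2, hA2 _ p.2⟩ : A))) ?_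
    rintro ⟨⟨a, d⟩, hp⟩ ⟨⟨a', d'⟩, hp'⟩ h
    simpa using h
  -- Failure of `hss` makes `A` contain `SL₂`. For `ℓ = 3`, where `PSL₂` is not simple, the crude
  -- bound `81 ^ 2` suffices.
  by_cases hss : ∀ h ∈ A, disc h.1 = 0 → IsScal h.1
  swap
  · push Not at hss
    obtain ⟨h, hh, h0, hs⟩ := hss
    have hall := mem_of_disc_eq_zero hℓ hirr hh h0 hs
    by_cases h3 : ℓ = 3
    · right
      subst h3
      have h4 : Nat.card A ≤ Nat.card (Matrix (Fin 2) (Fin 2) (ZMod 3)) :=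
        Nat.card_le_card_of_injective (fun a : A => a.1.1) (fun a b hab =>
          Subtype.ext (Units.ext hab))
      have h5 : Nat.card (Matrix (Fin 2) (Fin 2) (ZMod 3)) = 81 := by
        change Nat.card (Fin 2 → Fin 2 → ZMod 3) = 81
        rw [Nat.card_fun, Nat.card_fun]; simp
      rw [h5] at h4
      have := Nat.mul_le_mul h4 h4
      omega
    · exfalso
      have hp : ℓ.Prime := Fact.out
      have h5 : 5 ≤ ℓ := by
        have := hp.two_le
        have h4 : ℓ ≠ 4 := by rintro rfl; exact absurd hp (by decide)
        omega
      obtain ⟨p, hp, hp1, hp2⟩ := exists_pair_not_isSquare_disc h5 GG hdet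
        (fun S hS => hex1 S (hall S hS)) (fun S hS => hex2 S (hall S hS))
      rcases hspl p hp with h6 | h6
      exacts [hp1 h6, hp2 h6]
  have hcen : Set.ncard {a : GL (Fin 2) (ZMod ℓ) | a = 1 ∨ a = -1} ≤ 2 := by
    have := Set.ncard_insert_le (1 : GL (Fin 2) (ZMod ℓ)) {-1}
    rw [Set.ncard_singleton] at this
    exact this
  rcases preservesPair_or_exceptional (k := GaloisField ℓ 2) h2
    (isSquare_algebraMap_galoisField hℓ) A hss with ⟨v, w, hv, hw, hpair⟩ | ⟨hN, -⟩
  swap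
  · right
    have h3 : Nat.card A ≤ Nat.card (A.map (lineAction (ZMod ℓ) (GaloisField ℓ 2))) *
        Set.ncard {a : A | a = 1 ∨ a.1 = -1} := by
      refine card_le_mul_ncard (fun a : A => (⟨lineAction (ZMod ℓ) (GaloisField ℓ 2) a.1,
        Subgroup.mem_map_of_mem _ a.2⟩ : A.map (lineAction (ZMod ℓ) (GaloisField ℓ 2)))) _
        (Set.toFinite _) ?_
      intro g g' hgg
      have h4 : lineAction (ZMod ℓ) (GaloisField ℓ 2) (g⁻¹ * g').1 = 1 := by
        rw [Subgroup.coe_mul, map_mul, Subgroup.coe_inv, map_inv,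
          inv_mul_eq_one]
        exact congrArg Subtype.val hgg
      rcases eq_one_or_neg_one_of_isScal ((lineAction_eq_one_iff _).1 h4)
        (hAdet _ (g⁻¹ * g').2) with h5 | h5
      · exact Or.inl (Subtype.ext h5)
      · exact Or.inr h5
    have h4 : Set.ncard {a : A | a = 1 ∨ a.1 = -1} ≤ 2 := by
      refine le_trans ?_ hcen
      refine Set.ncard_le_ncard_of_injOn (fun a : A => a.1) ?_ Subtype.val_injective.injOn
        (Set.toFinite _)
      rintro a (rfl | h)
      · exact Or.inl rfl
      · exact Or.inr h
    -- The factor two counts the scalars `±1`. The constant 14400 is the square of this bound.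
    have h5 : Nat.card A ≤ 60 * 2 := h3.trans (Nat.mul_le_mul (by omega) h4)
    have := Nat.mul_le_mul h5 h5
    omega
  let fx : GL (Fin 2) (ZMod ℓ) → Prop := fun a =>
    Fixes (bc a.1 : Matrix (Fin 2) (Fin 2) (GaloisField ℓ 2)) v w
  by_cases hr : ∃ r ∈ A, fx r ∧ IsSquare (disc r.1) ∧ ¬ IsScal r.1
  · left
    obtain ⟨r, hr, hrf, hrs, hrn⟩ := hr
    obtain ⟨x, y, hx, hy, -, -, hxy⟩ := hpair.rational h2 hv hw hrs
      (fun h0 => hrn (hss r hr h0)) hrf.1 hrf.2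
    obtain ⟨h, hh, hne⟩ := hirr x hx
    have hsw : Swaps h.1 x y := (hxy h hh).resolve_left fun h3 => hne h3.1
    have hcr : cross x y ≠ 0 := fun h0 => hne (cross_trans hy h0 hsw.1)
    -- Using the symmetry, an element of `GG` is found that exchanges the lines in both components.
    -- Its split component has trace zero and determinant one.
    have hneg : IsSquare (-1 : ZMod ℓ) := by
      obtain ⟨a, d, had, ha, hd⟩ : ∃ a d, (a, d) ∈ GG ∧ Swaps a.1 x y ∧ Swaps d.1 x y := by
        obtain ⟨d, hd⟩ := hex1 h hh
        rcases hxy d (hA2 _ hd) with h3 | h3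
        · refine ⟨_, _, GG.mul_mem hd (hsym h d hd), ?_, ?_⟩
          · exact hsw.mul_fixes hx hy (Fixes.conj hx hy h3 (hxy z hzA))
          · exact Fixes.mul_swaps hx hy h3 hsw
        · exact ⟨h, d, hd, hsw, h3⟩
      rcases hspl _ had with h3 | h3
      · have := isSquare_neg_det_of_trace h2 h3 (ha.trace_eq_zero hcr)
        rwa [(hdet _ had).1] at this
      · have := isSquare_neg_det_of_trace h2 h3 (hd.trace_eq_zero hcr)
        rwa [(hdet _ had).2] at this
    exact ⟨hneg, x, y, hcr, fun p hp => ⟨hxy _ (hA1 p hp), hxy _ (hA2 p hp)⟩⟩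
  · right
    push Not at hr
    have fx_mul : ∀ a b, fx a → fx b → fx (a * b) := fun a b ha hb => by
      change Fixes (bc (a.1 * b.1)) v w
      rw [bc_mul]
      exact ⟨cross_mul_mulVec hv hb.1 ha.1, cross_mul_mulVec hw hb.2 ha.2⟩
    have bcGL : ∀ a : GL (Fin 2) (ZMod ℓ), (bc a.1 : Matrix (Fin 2) (Fin 2) (GaloisField ℓ 2))
        = (Matrix.GeneralLinearGroup.map (algebraMap (ZMod ℓ) (GaloisField ℓ 2)) a).1 :=
      fun _ => rfl
    have fx_inv : ∀ a, fx a → fx a⁻¹ := fun a ha => by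
      have h3 := Fixes.inv (a := Matrix.GeneralLinearGroup.map
        (algebraMap (ZMod ℓ) (GaloisField ℓ 2)) a) ha
      rw [← map_inv] at h3
      exact h3
    have fx_conj : ∀ a, fx a → fx (z * a * z⁻¹) := fun a ha => by
      have h3 := Fixes.conj (a := Matrix.GeneralLinearGroup.map
        (algebraMap (ZMod ℓ) (GaloisField ℓ 2)) a) (z := Matrix.GeneralLinearGroup.map
        (algebraMap (ZMod ℓ) (GaloisField ℓ 2)) z) hv hw ha (hpair z hzA)
      rw [← map_inv, ← map_mul, ← map_mul] at h3
      exact h3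
    have fx_one : fx 1 := by
      refine ⟨?_, ?_⟩ <;> simp [bc, cross_self]
    let FX : Subgroup (GL (Fin 2) (ZMod ℓ)) :=
      { carrier := {a | fx a}, one_mem' := fx_one, mul_mem' := fun ha hb => fx_mul _ _ ha hb,
        inv_mem' := fun ha => fx_inv _ ha }
    let R := GG ⊓ FX.prod FX
    have hRsym : ∀ a d, (a, d) ∈ R → (z * d * z⁻¹, a) ∈ R := fun a d h =>
      ⟨hsym a d h.1, fx_conj _ h.2.2, h.2.1⟩
    have hscR : ∀ p ∈ R, p.1 ∈ scalars 2 (ZMod ℓ) ∨ p.2 ∈ scalars 2 (ZMod ℓ) := by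
      intro p hp
      rw [← isScal_iff_mem_scalars, ← isScal_iff_mem_scalars]
      rcases hspl p hp.1 with h3 | h3
      · exact Or.inl (hr _ (hA1 p hp.1) hp.2.1 h3)
      · exact Or.inr (hr _ (hA2 p hp.1) hp.2.2 h3)
    -- On `R` one component is always scalar, and a group is not the union of two proper subgroups,
    -- so a single component is scalar throughout. The symmetry transfers this to the other.
    have hboth : ∀ p ∈ R, IsScal p.1.1 ∧ IsScal p.2.1 := by
      rcases forall_or_forall_of_cover R ((scalars 2 (ZMod ℓ)).comap (MonoidHom.fst _ _))
        ((scalars 2 (ZMod ℓ)).comap (MonoidHom.snd _ _)) hscR with h3 | h3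
      · rintro ⟨a, d⟩ hp
        refine ⟨(isScal_iff_mem_scalars _).2 (h3 _ hp), ?_⟩
        exact IsScal.of_conj ((isScal_iff_mem_scalars _).2 (h3 _ (hRsym a d hp)))
      · rintro ⟨a, d⟩ hp
        exact ⟨(isScal_iff_mem_scalars _).2 (h3 _ (hRsym a d hp)),
          (isScal_iff_mem_scalars _).2 (h3 _ hp)⟩
    have hquot : ∀ a ∈ A, ∀ b ∈ A, (fx a ↔ fx b) → fx (a⁻¹ * b) := by
      intro a ha b hb hab
      by_cases h3 : fx a
      · exact fx_mul _ _ (fx_inv _ h3) (hab.1 h3)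
      · have ha' := (hpair a ha).resolve_left h3
        have hb' := (hpair b hb).resolve_left (fun h4 => h3 (hab.2 h4))
        have h5 := Swaps.inv (a := Matrix.GeneralLinearGroup.map
          (algebraMap (ZMod ℓ) (GaloisField ℓ 2)) a) ha'
        rw [← map_inv] at h5
        have h6 := Swaps.mul_swaps hv hw h5 hb'
        change Fixes (bc (a⁻¹.1 * b.1)) v w
        rw [bc_mul]
        exact h6
    -- Elements with the same fixing pattern in both components differ by an element of `R`, which
    -- lies in `{±1} × {±1}`. Four patterns times four elements bound `GG`.
    have hcard := card_le_mul_ncard (fun p : GG => (fx p.1.1, fx p.1.2))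
      {p : GG | (p.1.1 = 1 ∨ p.1.1 = -1) ∧ (p.1.2 = 1 ∨ p.1.2 = -1)} (Set.toFinite _) (by
        intro p q hpq
        simp only [Prod.mk.injEq, eq_iff_iff] at hpq
        have hR : (p⁻¹ * q).1 ∈ R := ⟨(p⁻¹ * q).2,
          hquot _ (hA1 _ p.2) _ (hA1 _ q.2) hpq.1, hquot _ (hA2 _ p.2) _ (hA2 _ q.2) hpq.2⟩
        have h3 := hboth _ hR
        have h4 := hdet _ (p⁻¹ * q).2
        exact ⟨eq_one_or_neg_one_of_isScal h3.1 h4.1, eq_one_or_neg_one_of_isScal h3.2 h4.2⟩)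
    have h3 : Set.ncard {p : GG | (p.1.1 = 1 ∨ p.1.1 = -1) ∧ (p.1.2 = 1 ∨ p.1.2 = -1)} ≤ 2 * 2 := by
      refine le_trans (Set.ncard_le_ncard_of_injOn (fun p : GG => p.1)
        (t := {a : GL (Fin 2) (ZMod ℓ) | a = 1 ∨ a = -1} ×ˢ
          {a : GL (Fin 2) (ZMod ℓ) | a = 1 ∨ a = -1}) ?_ Subtype.val_injective.injOn
        (Set.toFinite _)) ?_
      · intro p hp
        exact hp
      · rw [Set.ncard_prod]
        exact Nat.mul_le_mul hcen hcen
    have h4 : Nat.card (Prop × Prop) = 4 := by simp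
    rw [h4] at hcard
    omega

end NonsingularCore

/-! ### Scalars, similitudes and multipliers -/

section Generalities

variable {n : ℕ} {F : Type*} [Field F]

theorem scalar_mem_scalars (c : Fˣ) :
    (Matrix.GeneralLinearGroup.scalar (Fin n) c : GL (Fin n) F) ∈ scalars n F := ⟨c, rfl⟩

theorem scalars_le_center : scalars n F ≤ Subgroup.center (GL (Fin n) F) := by
  rw [Matrix.GeneralLinearGroup.center_eq_range_scalar]; exact le_rfl

instance scalars_normal : (scalars n F).Normal := by
  constructor
  intro s hs g
  rw [Subgroup.mem_center_iff.1 (scalars_le_center hs) g, mul_inv_cancel_right]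
  exact hs

theorem scalar_val (c : Fˣ) :
    (Matrix.GeneralLinearGroup.scalar (Fin n) c : GL (Fin n) F).1 = (c : F) • 1 := by
  ext i j
  simp [Matrix.scalar_apply, Matrix.diagonal_apply, Matrix.one_apply]

theorem mul_scalar_comm (g : GL (Fin n) F) (c : Fˣ) :
    g * Matrix.GeneralLinearGroup.scalar (Fin n) c
      = Matrix.GeneralLinearGroup.scalar (Fin n) c * g :=
  Subgroup.mem_center_iff.1 (scalars_le_center (scalar_mem_scalars c)) g

theorem mem_saturation {G : Subgroup (GL (Fin n) F)} {x : GL (Fin n) F} :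
    x ∈ saturation G ↔ ∃ c : Fˣ, ∃ g ∈ G, Matrix.GeneralLinearGroup.scalar (Fin n) c * g = x := by
  rw [saturation, sup_comm, Subgroup.mem_sup_of_normal_left]
  constructor
  · rintro ⟨_, ⟨c, rfl⟩, g, hg, rfl⟩
    exact ⟨c, g, hg, rfl⟩
  · rintro ⟨c, g, hg, rfl⟩
    exact ⟨_, ⟨c, rfl⟩, g, hg, rfl⟩

theorem hasEigenvalue_iff (M : Matrix (Fin n) (Fin n) F) (a : F) :
    Module.End.HasEigenvalue (Matrix.toLin' M) a ↔ ∃ v, v ≠ 0 ∧ M *ᵥ v = a • v := by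
  constructor
  · intro h
    obtain ⟨v, hv⟩ := h.exists_hasEigenvector
    exact ⟨v, hv.2, by simpa using hv.apply_eq_smul⟩
  · rintro ⟨v, hv, h⟩
    exact Module.End.hasEigenvalue_of_hasEigenvector
      (Module.End.hasEigenvector_iff.2 ⟨Module.End.mem_eigenspace_iff.2 (by simpa using h), hv⟩)

theorem ActsIrreducibly.mono {G H : Subgroup (GL (Fin n) F)} (h : ActsIrreducibly G)
    (hGH : G ≤ H) : ActsIrreducibly H :=
  ⟨h.1, fun W hW => h.2 W fun g hg => hW g (hGH hg)⟩

theorem HasPropertyE.saturation {G : Subgroup (GL (Fin n) F)} (h : HasPropertyE G) :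
    HasPropertyE (saturation G) := by
  intro x hx
  obtain ⟨c, g, hg, rfl⟩ := mem_saturation.1 hx
  obtain ⟨a, ha⟩ := h g hg
  obtain ⟨v, hv, hgv⟩ := (hasEigenvalue_iff _ _).1 ha
  refine ⟨c * a, (hasEigenvalue_iff _ _).2 ⟨v, hv, ?_⟩⟩
  rw [Units.val_mul, scalar_val, smul_mul_assoc, one_mul, Matrix.smul_mulVec, hgv, smul_smul]

/-- `M` is a similitude of the form `J` with multiplier `k`. -/
def IsSim (J : Matrix (Fin n) (Fin n) F) (M : GL (Fin n) F) (k : Fˣ) : Prop :=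
  M.1ᵀ * J * M.1 = (k : F) • J

variable {J : Matrix (Fin n) (Fin n) F}

theorem mem_GSp {M : GL (Fin n) F} : M ∈ GSp J ↔ ∃ k, IsSim J M k := Iff.rfl

theorem mem_Sp {M : GL (Fin n) F} : M ∈ Sp J ↔ IsSim J M 1 := by
  rw [IsSim, Units.val_one, one_smul]; rfl

theorem IsSim.mul {M N : GL (Fin n) F} {k m : Fˣ} (hM : IsSim J M k) (hN : IsSim J N m) :
    IsSim J (M * N) (k * m) := by
  rw [IsSim] at *
  rw [Units.val_mul, Matrix.transpose_mul,
    show N.1ᵀ * M.1ᵀ * J * (M.1 * N.1) = N.1ᵀ * (M.1ᵀ * J * M.1) * N.1 by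
      simp only [Matrix.mul_assoc], hM, Matrix.mul_smul, Matrix.smul_mul, hN, smul_smul,
    Units.val_mul]

theorem isSim_scalar (c : Fˣ) : IsSim J (Matrix.GeneralLinearGroup.scalar (Fin n) c) (c ^ 2) := by
  rw [IsSim, scalar_val]
  simp [smul_smul, pow_two]

theorem IsSim.unique (hJ : J ≠ 0) {M : GL (Fin n) F} {k m : Fˣ} (h1 : IsSim J M k)
    (h2 : IsSim J M m) : k = m := by
  rw [IsSim] at *
  rw [h1] at h2
  exact Units.ext (smul_left_injective F hJ h2)

theorem IsSim.inv {M : GL (Fin n) F} {k : Fˣ} (h : IsSim J M k) : IsSim J M⁻¹ k⁻¹ := by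
  have h1 : (M⁻¹).1ᵀ * M.1ᵀ = 1 := by
    rw [← Matrix.transpose_mul, ← Units.val_mul, mul_inv_cancel, Units.val_one,
      Matrix.transpose_one]
  have h2 : M.1 * (M⁻¹).1 = 1 := by rw [← Units.val_mul, mul_inv_cancel, Units.val_one]
  have h3 : (M⁻¹).1ᵀ * (M.1ᵀ * J * M.1) * (M⁻¹).1 = J := by
    simp only [Matrix.mul_assoc]
    rw [h2, Matrix.mul_one, ← Matrix.mul_assoc, h1, Matrix.one_mul]
  rw [h, Matrix.mul_smul, Matrix.smul_mul] at h3
  rw [IsSim]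
  nth_rewrite 2 [← h3]
  rw [smul_smul, Units.inv_mul, one_smul]

theorem IsSim.conj {M g : GL (Fin n) F} {k m : Fˣ} (hM : IsSim J M k) (hg : IsSim J g m) :
    IsSim J (g * M * g⁻¹) k := by
  have := (hg.mul hM).mul hg.inv
  rwa [mul_comm m k, mul_inv_cancel_right] at this

/-- Adjoining scalars preserves eigenvectors, irreducibility and membership in `GSp J`, so
maximality absorbs them. -/
theorem IsMaximalHasseIn.scalars_le {G : Subgroup (GL (Fin n) F)}
    (hG : IsMaximalHasseIn (GSp J) G) : scalars n F ≤ G := by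
  have h : saturation G ≤ GSp J ∧ IsHasse (saturation G) := by
    refine ⟨sup_le hG.prop.1 ?_, hG.prop.2.1.saturation, hG.prop.2.2.mono le_sup_left⟩
    rintro _ ⟨c, rfl⟩
    exact ⟨_, isSim_scalar c⟩
  exact le_sup_right.trans (hG.le_of_ge h le_sup_left)

variable {G : Subgroup (GL (Fin n) F)}

theorem saturation_le_of_scalars_le (hsc : scalars n F ≤ G) : saturation (G ⊓ Sp J) ≤ G :=
  sup_le inf_le_left hsc

/-- A scalar `c` has multiplier `c ^ 2`, so an element of square multiplier can be rescaled into `Sp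
J`. -/
theorem mem_saturation_inf_Sp (hJ : J ≠ 0) (hsc : scalars n F ≤ G) {x : GL (Fin n) F} {k : Fˣ}
    (hx : IsSim J x k) : x ∈ saturation (G ⊓ Sp J) ↔ x ∈ G ∧ IsSquare k := by
  rw [mem_saturation]
  constructor
  · rintro ⟨c, g, hg, rfl⟩
    refine ⟨G.mul_mem (hsc (scalar_mem_scalars c)) hg.1, c, ?_⟩
    have h1 := (isSim_scalar (J := J) c).mul (mem_Sp.1 hg.2)
    rw [mul_one] at h1
    rw [hx.unique hJ h1, pow_two]
  · rintro ⟨hxG, c, rfl⟩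
    refine ⟨c, Matrix.GeneralLinearGroup.scalar (Fin n) c⁻¹ * x,
      ⟨G.mul_mem (hsc (scalar_mem_scalars _)) hxG, ?_⟩, ?_⟩
    · refine mem_Sp.2 ?_
      have h1 := (isSim_scalar (J := J) c⁻¹).mul hx
      rwa [pow_two, mul_mul_mul_comm, inv_mul_cancel, mul_one] at h1
    · rw [← mul_assoc, ← map_mul, mul_inv_cancel, map_one, one_mul]

theorem IsStable.saturation {W : Submodule F (Fin n → F)} (h : IsStable G W) :
    IsStable (saturation G) W := by
  intro x hx v hv
  obtain ⟨c, g, hg, rfl⟩ := mem_saturation.1 hx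
  rw [Units.val_mul, scalar_val, smul_mul_assoc, one_mul, Matrix.smul_mulVec]
  exact W.smul_mem _ (h g hg v hv)

theorem map_mulVec_inv (g : GL (Fin n) F) (v : Fin n → F) : g.1 *ᵥ ((g⁻¹).1 *ᵥ v) = v := by
  rw [Matrix.mulVec_mulVec, ← Units.val_mul, mul_inv_cancel, Units.val_one, Matrix.one_mulVec]

theorem inv_mulVec_map (g : GL (Fin n) F) (v : Fin n → F) : (g⁻¹).1 *ᵥ (g.1 *ᵥ v) = v := by
  rw [Matrix.mulVec_mulVec, ← Units.val_mul, inv_mul_cancel, Units.val_one, Matrix.one_mulVec]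

/-- Membership in the image of a subspace under an invertible matrix. -/
theorem mem_map_toLin' {g : GL (Fin n) F} {W : Submodule F (Fin n → F)} {v : Fin n → F} :
    v ∈ W.map (Matrix.toLin' g.1) ↔ (g⁻¹).1 *ᵥ v ∈ W := by
  rw [Submodule.mem_map]
  constructor
  · rintro ⟨w, hw, rfl⟩
    rw [Matrix.toLin'_apply, inv_mulVec_map]; exact hw
  · intro h
    exact ⟨_, h, by rw [Matrix.toLin'_apply, map_mulVec_inv]⟩

theorem finrank_map_toLin' (g : GL (Fin n) F) (W : Submodule F (Fin n → F)) :
    Module.finrank F (W.map (Matrix.toLin' g.1)) = Module.finrank F W := by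
  refine (Submodule.equivMapOfInjective (Matrix.toLin' g.1) ?_ W).finrank_eq.symm
  intro v w h
  rw [Matrix.toLin'_apply, Matrix.toLin'_apply] at h
  rw [← inv_mulVec_map g v, h, inv_mulVec_map]

end Generalities

/-! ### The index of `K` in `G` and the quotient of `K` by `G¹` -/

section IndexTwo

variable {ℓ : ℕ} [Fact ℓ.Prime] {J : Matrix (Fin 4) (Fin 4) (ZMod ℓ)}
  {G : Subgroup (GL (Fin 4) (ZMod ℓ))}

theorem isSquare_units_iff {F : Type*} [Field F] (k : Fˣ) : IsSquare k ↔ IsSquare (k : F) := by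
  constructor
  · rintro ⟨c, rfl⟩
    exact ⟨c, by simp⟩
  · rintro ⟨c, hc⟩
    have hc0 : c ≠ 0 := by rintro rfl; simp at hc
    exact ⟨Units.mk0 c hc0, Units.ext (by simpa using hc)⟩

theorem isSquare_mul_units {a b : (ZMod ℓ)ˣ} (ha : ¬ IsSquare a) (hb : ¬ IsSquare b) :
    IsSquare (a * b) := by
  rw [isSquare_units_iff] at *
  rw [Units.val_mul]
  exact isSquare_mul_of_not_isSquare ha hb

theorem IsSymplecticForm.ne_zero (hJ : IsSymplecticForm J) : J ≠ 0 := by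
  rintro rfl
  have := hJ.2.1 ![1, 0, 0, 0] (by intro y; simp)
  simpa using congrFun this 0

/-- If all multipliers were squares, `G` would be generated by `G¹` and scalars, and would have the
same stable subspaces as `G¹`. -/
theorem exists_not_isSquare_multiplier (hJ : J ≠ 0) (hG : IsMaximalHasseIn (GSp J) G)
    (hred : ActsReducibly (G ⊓ Sp J)) : ∃ g ∈ G, ∃ k, IsSim J g k ∧ ¬ IsSquare k := by
  by_contra! hcon
  apply hred
  have hsc := hG.scalars_le
  have hle : G ≤ saturation (G ⊓ Sp J) := by
    intro x hx
    obtain ⟨k, hk⟩ := hG.prop.1 hx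
    exact (mem_saturation_inf_Sp hJ hsc hk).2 ⟨hx, hcon x hx k hk⟩
  exact ⟨hG.prop.2.2.1, fun W hW => hG.prop.2.2.2 W fun g hg => hW.saturation g (hle hg)⟩

theorem relIndex_saturation (hJ : J ≠ 0) (hG : IsMaximalHasseIn (GSp J) G)
    (hred : ActsReducibly (G ⊓ Sp J)) : (saturation (G ⊓ Sp J)).relIndex G = 2 := by
  have hsc := hG.scalars_le
  obtain ⟨g, hg, k, hk, hks⟩ := exists_not_isSquare_multiplier hJ hG hred
  rw [Subgroup.relIndex, Subgroup.index_eq_two_iff]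
  refine ⟨⟨g, hg⟩, ?_⟩
  rintro ⟨b, hb⟩
  obtain ⟨m, hm⟩ := hG.prop.1 hb
  rw [Subgroup.mem_subgroupOf, Subgroup.mem_subgroupOf]
  simp only [Subgroup.coe_mul]
  rw [mem_saturation_inf_Sp hJ hsc hm, mem_saturation_inf_Sp hJ hsc (IsSim.mul hm hk)]
  by_cases hms : IsSquare m
  · right
    refine ⟨⟨hb, hms⟩, fun h => hks ?_⟩
    obtain ⟨a, rfl⟩ := hms
    obtain ⟨c, hc⟩ := h.2
    refine ⟨c * a⁻¹, ?_⟩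
    rw [mul_mul_mul_comm, ← hc, mul_comm (a * a) k, mul_assoc, ← mul_inv, mul_inv_cancel, mul_one]
  · left
    exact ⟨⟨G.mul_mem hb hg, isSquare_mul_units hms hks⟩, fun h => hms h.2⟩

theorem normal_inf_Sp_subgroupOf (hG : G ≤ GSp J) (hsc : scalars 4 (ZMod ℓ) ≤ G) :
    ((G ⊓ Sp J).subgroupOf (saturation (G ⊓ Sp J))).Normal := by
  constructor
  rintro ⟨x, hx⟩ hxm ⟨g, hg⟩
  rw [Subgroup.mem_subgroupOf] at hxm ⊢
  have hgG := saturation_le_of_scalars_le hsc hg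
  obtain ⟨k, hk⟩ := hG hgG
  exact ⟨G.mul_mem (G.mul_mem hgG hxm.1) (G.inv_mem hgG), mem_Sp.2 ((mem_Sp.1 hxm.2).conj hk)⟩

theorem card_units_sq_eq_one (hℓ : ℓ ≠ 2) (S : Subgroup (ZMod ℓ)ˣ)
    (hS : ∀ c, c ∈ S ↔ c ^ 2 = 1) : Nat.card S = 2 := by
  have h2 := two_ne_zero_zmod hℓ
  have h1 : (S : Set (ZMod ℓ)ˣ) = {1, -1} := by
    ext c
    rw [SetLike.mem_coe, hS]
    simp only [Set.mem_insert_iff, Set.mem_singleton_iff]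
    rw [← Units.val_inj, ← Units.val_inj, ← Units.val_inj]
    push_cast
    exact sq_eq_one_iff
  rw [← SetLike.coe_sort_coe, h1, Nat.card_coe_set_eq, Set.ncard_pair]
  intro h
  have h3 : (1 : ZMod ℓ) = -1 := by simpa using congrArg Units.val h
  exact h2 (by linear_combination h3)

/-- The scalars surject onto the quotient, and those lying in `Sp J` are the two square roots of
one. -/
theorem nonempty_quotient_mulEquiv (hℓ : ℓ ≠ 2) (hJ : J ≠ 0)
    [hn : ((G ⊓ Sp J).subgroupOf (saturation (G ⊓ Sp J))).Normal]
    (hsc : scalars 4 (ZMod ℓ) ≤ G) :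
    Nonempty ((saturation (G ⊓ Sp J) ⧸ (G ⊓ Sp J).subgroupOf (saturation (G ⊓ Sp J))) ≃*
      Multiplicative (ZMod ((ℓ - 1) / 2))) := by
  set K := saturation (G ⊓ Sp J) with hK
  let f : (ZMod ℓ)ˣ →* K ⧸ (G ⊓ Sp J).subgroupOf K := (QuotientGroup.mk' _).comp
    ((Matrix.GeneralLinearGroup.scalar (Fin 4)).codRestrict K
      (fun c => le_sup_right (a := G ⊓ Sp J) (scalar_mem_scalars c)))
  have hsurj : Function.Surjective f := by
    intro q
    obtain ⟨⟨x, hx⟩, rfl⟩ := QuotientGroup.mk'_surjective _ q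
    obtain ⟨c, g, hg, rfl⟩ := mem_saturation.1 hx
    refine ⟨c, (QuotientGroup.mk'_eq_mk' _).2 ⟨⟨g, le_sup_left (b := scalars 4 (ZMod ℓ)) hg⟩, hg, ?_⟩⟩
    rfl
  have hker : ∀ c, c ∈ f.ker ↔ c ^ 2 = 1 := by
    intro c
    have h1 : c ∈ f.ker ↔ Matrix.GeneralLinearGroup.scalar (Fin 4) c ∈ G ⊓ Sp J := by
      rw [MonoidHom.mem_ker]
      exact QuotientGroup.eq_one_iff _
    rw [h1, Subgroup.mem_inf, mem_Sp]
    constructor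
    · exact fun h => (isSim_scalar c).unique hJ h.2
    · exact fun h => ⟨hsc (scalar_mem_scalars c), h ▸ isSim_scalar c⟩
  have hcyc : IsCyclic (K ⧸ (G ⊓ Sp J).subgroupOf K) := isCyclic_of_surjective f hsurj
  have hcard : Nat.card (K ⧸ (G ⊓ Sp J).subgroupOf K) = (ℓ - 1) / 2 := by
    have h1 := f.ker.card_mul_index
    rw [card_units_sq_eq_one hℓ f.ker hker, Subgroup.index_ker, MonoidHom.range_eq_top.2 hsurj,
      Subgroup.card_top, Nat.card_eq_fintype_card (α := (ZMod ℓ)ˣ), ZMod.card_units] at h1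
    omega
  exact ⟨(hcard ▸ zmodCyclicMulEquiv hcyc).symm⟩

/-- The image of `G` in `PGL₄` has at most twice as many elements as `G ∩ Sp₄`. -/
theorem card_projImage_le (hJ : J ≠ 0) (hG : IsMaximalHasseIn (GSp J) G)
    (hred : ActsReducibly (G ⊓ Sp J)) :
    Nat.card (projImage G) ≤ 2 * Nat.card (G ⊓ Sp J : Subgroup (GL (Fin 4) (ZMod ℓ))) := by
  have hsc := hG.scalars_le
  obtain ⟨g, hg, k, hk, hks⟩ := exists_not_isSquare_multiplier hJ hG hred
  let f : Bool × (G ⊓ Sp J : Subgroup (GL (Fin 4) (ZMod ℓ))) → projImage G := fun p =>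
    ⟨Matrix.ProjGenLinGroup.mk (if p.1 then p.2.1 * g else p.2.1), by
      refine Subgroup.mem_map_of_mem _ ?_
      split
      · exact G.mul_mem p.2.2.1 hg
      · exact p.2.2.1⟩
  have hf : Function.Surjective f := by
    have key : ∀ x ∈ saturation (G ⊓ Sp J), ∃ h : (G ⊓ Sp J : Subgroup (GL (Fin 4) (ZMod ℓ))),
        ∀ y, Matrix.ProjGenLinGroup.mk (h.1 * y) = Matrix.ProjGenLinGroup.mk (x * y) := by
      intro x hx
      obtain ⟨c, h, hh, rfl⟩ := mem_saturation.1 hx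
      refine ⟨⟨h, hh⟩, fun y => ?_⟩
      rw [mul_assoc, map_mul _ (Matrix.GeneralLinearGroup.scalar (Fin 4) c),
        Matrix.ProjGenLinGroup.mk_scalar, one_mul]
    rintro ⟨_, x, hx, rfl⟩
    obtain ⟨m, hm⟩ := hG.prop.1 hx
    by_cases hms : IsSquare m
    · obtain ⟨h, hh⟩ := key x ((mem_saturation_inf_Sp hJ hsc hm).2 ⟨hx, hms⟩)
      refine ⟨(false, h), Subtype.ext ?_⟩
      simpa [f] using hh 1
    · have hks' : ¬ IsSquare k⁻¹ := by rwa [isSquare_inv]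
      obtain ⟨h, hh⟩ := key (x * g⁻¹) ((mem_saturation_inf_Sp hJ hsc (IsSim.mul hm hk.inv)).2
        ⟨G.mul_mem hx (G.inv_mem hg), isSquare_mul_units hms hks'⟩)
      refine ⟨(true, h), Subtype.ext ?_⟩
      simpa [f] using hh g
  have h1 := Nat.card_le_card_of_surjective f hf
  rwa [Nat.card_prod, Nat.card_eq_fintype_card (α := Bool), Fintype.card_bool] at h1

end IndexTwo

/-! ### Transport of stable subspaces -/

section StablePlanes

variable {n : ℕ} {F : Type*} [Field F] {J : Matrix (Fin n) (Fin n) F}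

theorem IsSim.toBilin' {M : GL (Fin n) F} {k : Fˣ} (h : IsSim J M k) (v w : Fin n → F) :
    Matrix.toBilin' J (M.1 *ᵥ v) (M.1 *ᵥ w) = k * Matrix.toBilin' J v w := by
  simp only [Matrix.toBilin'_apply']
  rw [Matrix.mulVec_mulVec, Matrix.dotProduct_mulVec, ← Matrix.vecMul_transpose,
    Matrix.vecMul_vecMul, ← Matrix.mul_assoc, h, ← Matrix.dotProduct_mulVec, Matrix.smul_mulVec,
    dotProduct_smul, smul_eq_mul]

variable {G : Subgroup (GL (Fin n) F)}

/-- A subspace stable under `G ∩ Sp` and under one element of nonsquare multiplier is stable. -/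
theorem IsStable.of_inf_Sp {V : Submodule F (Fin n → F)} {g : GL (Fin n) F}
    (hV : IsStable (G ⊓ Sp J) V) (hgV : ∀ v ∈ V, g.1 *ᵥ v ∈ V)
    (hdec : ∀ x ∈ G, x ∈ HasseSubgroup.saturation (G ⊓ Sp J) ∨
      x * g⁻¹ ∈ HasseSubgroup.saturation (G ⊓ Sp J)) :
    IsStable G V := by
  intro x hx v hv
  rcases hdec x hx with h | h
  · exact hV.saturation x h v hv
  · have := hV.saturation _ h _ (hgV v hv)
    rwa [Matrix.mulVec_mulVec, ← Units.val_mul, inv_mul_cancel_right] at this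

theorem IsStable.map {V : Submodule F (Fin n → F)} {g : GL (Fin n) F} (hG : G ≤ GSp J)
    (hV : IsStable (G ⊓ Sp J) V) (hg : g ∈ G) :
    IsStable (G ⊓ Sp J) (V.map (Matrix.toLin' g.1)) := by
  intro h hh v hv
  rw [mem_map_toLin'] at hv ⊢
  obtain ⟨k, hk⟩ := hG hg
  have h1 : g⁻¹ * h * g ∈ G ⊓ Sp J := by
    refine ⟨G.mul_mem (G.mul_mem (G.inv_mem hg) hh.1) hg, mem_Sp.2 ?_⟩
    have := (mem_Sp.1 hh.2).conj (IsSim.inv hk)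
    rwa [inv_inv] at this
  have h2 := hV _ h1 _ hv
  rwa [Matrix.mulVec_mulVec, ← Units.val_mul, mul_inv_cancel_right, Units.val_mul,
    ← Matrix.mulVec_mulVec] at h2

theorem IsStable.inf {V W : Submodule F (Fin n → F)} (hV : IsStable G V) (hW : IsStable G W) :
    IsStable G (V ⊓ W) := fun g hg v hv => ⟨hV g hg v hv.1, hW g hg v hv.2⟩

theorem IsStable.sup {V W : Submodule F (Fin n → F)} (hV : IsStable G V) (hW : IsStable G W) :
    IsStable G (V ⊔ W) := by
  intro g hg v hv
  obtain ⟨a, ha, b, hb, rfl⟩ := Submodule.mem_sup.1 hv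
  rw [Matrix.mulVec_add]
  exact Submodule.add_mem_sup (hV g hg a ha) (hW g hg b hb)

theorem IsStable.orthogonal {V : Submodule F (Fin n → F)} (hV : IsStable G V) (hG : G ≤ Sp J) :
    IsStable G ((Matrix.toBilin' J).orthogonal V) := by
  intro g hg v hv
  rw [LinearMap.BilinForm.mem_orthogonal_iff] at hv ⊢
  intro w hw
  have h1 := (mem_Sp.1 (hG hg)).toBilin' ((g⁻¹).1 *ᵥ w) v
  rw [map_mulVec_inv, hv _ (hV _ (G.inv_mem hg) _ hw), mul_zero] at h1
  exact h1

end StablePlanes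

/-! ### Clifford theory and the two types of stable plane -/

section Planes

variable {ℓ : ℕ} [Fact ℓ.Prime] {J : Matrix (Fin 4) (Fin 4) (ZMod ℓ)}
  {G : Subgroup (GL (Fin 4) (ZMod ℓ))}

theorem mem_or_mul_inv_mem_saturation (hJ : J ≠ 0) (hG : IsMaximalHasseIn (GSp J) G)
    {g : GL (Fin 4) (ZMod ℓ)} {k : (ZMod ℓ)ˣ} (hg : g ∈ G) (hk : IsSim J g k)
    (hks : ¬ IsSquare k) (x : GL (Fin 4) (ZMod ℓ)) (hx : x ∈ G) :
    x ∈ saturation (G ⊓ Sp J) ∨ x * g⁻¹ ∈ saturation (G ⊓ Sp J) := by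
  have hsc := hG.scalars_le
  obtain ⟨m, hm⟩ := hG.prop.1 hx
  by_cases hms : IsSquare m
  · exact Or.inl ((mem_saturation_inf_Sp hJ hsc hm).2 ⟨hx, hms⟩)
  · have hks' : ¬ IsSquare k⁻¹ := by rwa [isSquare_inv]
    exact Or.inr ((mem_saturation_inf_Sp hJ hsc (IsSim.mul hm hk.inv)).2
      ⟨G.mul_mem hx (G.inv_mem hg), isSquare_mul_units hms hks'⟩)

theorem IsStable.mul_self_mem (hJ : J ≠ 0) (hG : IsMaximalHasseIn (GSp J) G)
    {g : GL (Fin 4) (ZMod ℓ)} {k : (ZMod ℓ)ˣ} (hg : g ∈ G) (hk : IsSim J g k)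
    {W : Submodule (ZMod ℓ) (Fin 4 → ZMod ℓ)} (hW : IsStable (G ⊓ Sp J) W)
    {v : Fin 4 → ZMod ℓ} (hv : v ∈ W) : g.1 *ᵥ (g.1 *ᵥ v) ∈ W := by
  rw [Matrix.mulVec_mulVec, ← Units.val_mul]
  exact hW.saturation _ ((mem_saturation_inf_Sp hJ hG.scalars_le (hk.mul hk)).2
    ⟨G.mul_mem hg hg, k, rfl⟩) v hv

/-- Clifford theory for `G ∩ Sp₄ ≤ G`: a proper stable subspace is complementary to its
translate. -/
theorem IsStable.isCompl_map (hJ : J ≠ 0) (hG : IsMaximalHasseIn (GSp J) G)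
    {g : GL (Fin 4) (ZMod ℓ)} {k : (ZMod ℓ)ˣ} (hg : g ∈ G) (hk : IsSim J g k)
    (hks : ¬ IsSquare k) {W : Submodule (ZMod ℓ) (Fin 4 → ZMod ℓ)}
    (hW : IsStable (G ⊓ Sp J) W) (hb : W ≠ ⊥) (ht : W ≠ ⊤) :
    IsCompl W (W.map (Matrix.toLin' g.1)) := by
  have hdec := mem_or_mul_inv_mem_saturation hJ hG hg hk hks
  have hWg := IsStable.map hG.prop.1 hW hg
  have hmap : ∀ v ∈ W, g.1 *ᵥ v ∈ W.map (Matrix.toLin' g.1) := fun v hv =>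
    ⟨v, hv, Matrix.toLin'_apply _ _⟩
  have hmap2 : ∀ v ∈ W.map (Matrix.toLin' g.1), g.1 *ᵥ v ∈ W := by
    rintro _ ⟨v, hv, rfl⟩
    rw [Matrix.toLin'_apply]
    exact hW.mul_self_mem hJ hG hg hk hv
  constructor
  · rw [disjoint_iff]
    have hs : IsStable G (W ⊓ W.map (Matrix.toLin' g.1)) :=
      IsStable.of_inf_Sp (IsStable.inf hW hWg)
        (fun v hv => ⟨hmap2 v hv.2, hmap v hv.1⟩) hdec
    refine (hG.prop.2.2.2 _ hs).resolve_right fun h => ht ?_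
    exact top_le_iff.1 (h ▸ inf_le_left)
  · rw [codisjoint_iff]
    have hs : IsStable G (W ⊔ W.map (Matrix.toLin' g.1)) := by
      refine IsStable.of_inf_Sp (IsStable.sup hW hWg) (fun v hv => ?_) hdec
      obtain ⟨a, ha, b, hb, rfl⟩ := Submodule.mem_sup.1 hv
      rw [Matrix.mulVec_add, add_comm]
      exact Submodule.add_mem_sup (hmap2 b hb) (hmap a ha)
    refine (hG.prop.2.2.2 _ hs).resolve_left fun h => hb ?_
    exact le_bot_iff.1 (h ▸ le_sup_left)

theorem IsStable.finrank_eq_two (hJ : J ≠ 0) (hG : IsMaximalHasseIn (GSp J) G)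
    (hred : ActsReducibly (G ⊓ Sp J)) {W : Submodule (ZMod ℓ) (Fin 4 → ZMod ℓ)}
    (hW : IsStable (G ⊓ Sp J) W) (hb : W ≠ ⊥) (ht : W ≠ ⊤) :
    Module.finrank (ZMod ℓ) W = 2 := by
  obtain ⟨g, hg, k, hk, hks⟩ := exists_not_isSquare_multiplier hJ hG hred
  have h1 := Submodule.finrank_add_eq_of_isCompl (hW.isCompl_map hJ hG hg hk hks hb ht)
  rw [finrank_map_toLin', Module.finrank_fin_fun] at h1
  omega

/-- A stable line would be a stable subspace of dimension other than two. This is the source of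
`NoCommonLine` in both cases. -/
theorem exists_ne_smul (hJ : J ≠ 0) (hG : IsMaximalHasseIn (GSp J) G)
    (hred : ActsReducibly (G ⊓ Sp J)) {v : Fin 4 → ZMod ℓ} (hv : v ≠ 0) :
    ∃ h ∈ G ⊓ Sp J, ∀ c : ZMod ℓ, h.1 *ᵥ v ≠ c • v := by
  by_contra! hcon
  have hs : IsStable (G ⊓ Sp J) (Submodule.span (ZMod ℓ) {v}) := by
    intro h hh w hw
    obtain ⟨a, rfl⟩ := Submodule.mem_span_singleton.1 hw
    obtain ⟨c, hc⟩ := hcon h hh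
    rw [Matrix.mulVec_smul, hc]
    exact Submodule.smul_mem _ _ (Submodule.smul_mem _ _ (Submodule.mem_span_singleton_self v))
  have h1 := finrank_span_singleton (K := ZMod ℓ) hv
  have h2 := hs.finrank_eq_two hJ hG hred (by simpa using hv) (by
    intro h
    rw [h, finrank_top, Module.finrank_fin_fun] at h1
    omega)
  omega

/-- The radical `W ⊓ Wᗮ` is stable, hence zero or of dimension two, and in the latter case it is all
of `W`. -/
theorem exists_stable_plane (hJ : IsSymplecticForm J) (hG : IsMaximalHasseIn (GSp J) G)
    (hred : ActsReducibly (G ⊓ Sp J)) :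
    ∃ W : Submodule (ZMod ℓ) (Fin 4 → ZMod ℓ), IsStable (G ⊓ Sp J) W ∧
      W ≠ ⊥ ∧ W ≠ ⊤ ∧ Module.finrank (ZMod ℓ) W = 2 ∧
      (IsTotallyIsotropic J W ∨ IsCompl W ((Matrix.toBilin' J).orthogonal W)) := by
  have hJ0 := hJ.ne_zero
  have h1 : ∃ W, IsStable (G ⊓ Sp J) W ∧ W ≠ ⊥ ∧ W ≠ ⊤ := by
    by_contra! hcon
    refine hred ⟨by norm_num, fun W hW => ?_⟩
    by_cases hb : W = ⊥
    · exact Or.inl hb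
    · exact Or.inr (hcon W hW hb)
  obtain ⟨W, hW, hb, ht⟩ := h1
  have h2 := hW.finrank_eq_two hJ0 hG hred hb ht
  refine ⟨W, hW, hb, ht, h2, ?_⟩
  have hO := hW.orthogonal inf_le_right
  by_cases h3 : W ⊓ (Matrix.toBilin' J).orthogonal W = ⊥
  · right
    rw [LinearMap.BilinForm.isCompl_orthogonal_iff_disjoint hJ.1.isRefl]
    exact disjoint_iff.2 h3
  · left
    have h4 := (hW.inf hO).finrank_eq_two hJ0 hG hred h3 (fun h => ht (top_le_iff.1 (h ▸ inf_le_left)))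
    have h5 := Submodule.eq_of_le_of_finrank_eq
      (inf_le_left : W ⊓ (Matrix.toBilin' J).orthogonal W ≤ W) (h4.trans h2.symm)
    intro v hv w hw
    rw [← h5] at hw
    exact hw.2 v hv

theorem two_ne (hJ : J ≠ 0) (hG : IsMaximalHasseIn (GSp J) G)
    (hred : ActsReducibly (G ⊓ Sp J)) : ℓ ≠ 2 := by
  rintro rfl
  obtain ⟨g, hg, k, hk, hks⟩ := exists_not_isSquare_multiplier hJ hG hred
  apply hks
  rw [isSquare_units_iff]
  exact FiniteField.isSquare_of_char_two (by simp [ringChar.eq (ZMod 2) 2]) _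

end Planes

/-! ### Symplectic bases adapted to a decomposition into planes -/

section Frames

variable {F : Type*} [Field F] {J : Matrix (Fin 4) (Fin 4) F}

theorem toBilin'_mulVec_single (P x Q : Matrix (Fin 4) (Fin 4) F) (i j : Fin 4) :
    (Pᵀ * J * (x * Q)) i j =
      Matrix.toBilin' J (P *ᵥ Pi.single i 1) (x *ᵥ (Q *ᵥ Pi.single j 1)) := by
  rw [Matrix.toBilin'_apply', Matrix.mulVec_mulVec, Matrix.mulVec_mulVec, Matrix.mul_assoc J,
    Matrix.mul_assoc Pᵀ]
  generalize J * (x * Q) = N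
  simp [dotProduct, Matrix.mul_apply]

/-- Linear independence of `w` need not be assumed: the determinant of the Gram matrix has that of
`w` as a factor. -/
theorem exists_carriesForm {J' : Matrix (Fin 4) (Fin 4) F} (hJ' : J'.det ≠ 0)
    (w : Fin 4 → Fin 4 → F) (h : ∀ i j, Matrix.toBilin' J (w i) (w j) = J' i j) :
    ∃ P : GL (Fin 4) F, CarriesForm P J J' ∧ ∀ i, P.1 *ᵥ Pi.single i 1 = w i := by
  set M : Matrix (Fin 4) (Fin 4) F := (Matrix.of w)ᵀ with hM
  have hcol : ∀ i, M *ᵥ Pi.single i 1 = w i := by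
    intro i; ext j; simp [hM]
  have h1 : Mᵀ * J * M = J' := by
    ext i j
    have := toBilin'_mulVec_single (J := J) M 1 M i j
    rw [Matrix.one_mul, Matrix.one_mulVec, hcol, hcol, h] at this
    exact this
  have h2 : M.det ≠ 0 := by
    intro h0
    rw [← h1, Matrix.det_mul, h0, mul_zero] at hJ'
    exact hJ' rfl
  exact ⟨Matrix.GeneralLinearGroup.mkOfDetNeZero M h2, h1, hcol⟩

/-- This reads the entries of `x` in the new basis as values of the form, so orthogonality of
subspaces yields zero blocks. -/
theorem CarriesForm.mul_conj {J' : Matrix (Fin 4) (Fin 4) F} {P : GL (Fin 4) F}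
    (hP : CarriesForm P J J') (x : GL (Fin 4) F) (i j : Fin 4) :
    (J' * (P⁻¹ * x * P).1) i j =
      Matrix.toBilin' J (P.1 *ᵥ Pi.single i 1) (x.1 *ᵥ (P.1 *ᵥ Pi.single j 1)) := by
  rw [← toBilin'_mulVec_single, ← hP, Matrix.mul_assoc, ← Units.val_mul, ← Units.val_mul]
  group

theorem det_formIsotropic : (formIsotropic F).det ≠ 0 := by
  simp [formIsotropic, Matrix.det_succ_row_zero, Fin.sum_univ_succ, Fin.succAbove]

theorem det_formNonsingular : (formNonsingular F).det ≠ 0 := by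
  simp [formNonsingular, Matrix.det_succ_row_zero, Fin.sum_univ_succ, Fin.succAbove]

/-- The form puts `V` in perfect duality with `W`, since both are isotropic and together they span.
The negated dual basis matches the signs of `formIsotropic`. -/
theorem exists_frame_isotropic (hJ : IsSymplecticForm J) {W V : Submodule F (Fin 4 → F)}
    (hWV : IsCompl W V) (hW : IsTotallyIsotropic J W) (hV : IsTotallyIsotropic J V)
    (hW2 : Module.finrank F W = 2) (hV2 : Module.finrank F V = 2) :
    ∃ P : GL (Fin 4) F, CarriesForm P J (formIsotropic F) ∧
      P.1 *ᵥ Pi.single 0 1 ∈ W ∧ P.1 *ᵥ Pi.single 1 1 ∈ W ∧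
      P.1 *ᵥ Pi.single 2 1 ∈ V ∧ P.1 *ᵥ Pi.single 3 1 ∈ V := by
  let b := Module.finBasisOfFinrankEq F W hW2
  let φ : V →ₗ[F] Module.Dual F W :=
    ((Matrix.toBilin' J).flip.domRestrict₁₂ V W : V →ₗ[F] W →ₗ[F] F)
  have hφ : ∀ v w, φ v w = Matrix.toBilin' J w.1 v.1 := fun v w => rfl
  have hinj : Function.Injective φ := by
    rw [injective_iff_map_eq_zero]
    intro v hv
    have h1 : ∀ x, Matrix.toBilin' J x v.1 = 0 := by
      intro x
      have hx : x ∈ W ⊔ V := by rw [hWV.sup_eq_top]; trivial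
      obtain ⟨a, ha, c, hc, rfl⟩ := Submodule.mem_sup.1 hx
      have h2 : Matrix.toBilin' J a v.1 = 0 := by
        rw [← hφ v ⟨a, ha⟩, hv]; rfl
      rw [map_add, LinearMap.add_apply, h2, hV c hc v.1 v.2, add_zero]
    exact Subtype.ext (hJ.2.2 v.1 h1)
  have hsurj : Function.Surjective φ := by
    refine (LinearMap.injective_iff_surjective_of_finrank_eq_finrank ?_).1 hinj
    rw [Subspace.dual_finrank_eq, hW2, hV2]
  obtain ⟨y, hy⟩ := hsurj (-b.coord 0)
  obtain ⟨z, hz⟩ := hsurj (-b.coord 1)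
  have e : ∀ (v : V) (i j : Fin 2), φ v = - b.coord j →
      Matrix.toBilin' J (b i).1 v.1 = if i = j then -1 else 0 := by
    intro v i j h
    rw [← hφ v (b i), h]
    simp [Finsupp.single_apply, apply_ite]
  have e' : ∀ (v : V) (i j : Fin 2), φ v = - b.coord j →
      Matrix.toBilin' J v.1 (b i).1 = if i = j then 1 else 0 := by
    intro v i j h
    rw [← neg_neg (Matrix.toBilin' J v.1 (b i).1), hJ.1.neg_eq, e v i j h]
    split_ifs <;> simp
  obtain ⟨P, hP, hw⟩ := exists_carriesForm (J := J) (J' := formIsotropic F) det_formIsotropic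
    ![(b 0).1, (b 1).1, y.1, z.1] (by
      intro i j
      fin_cases i <;> fin_cases j <;>
      simp [formIsotropic, e _ _ _ hy, e _ _ _ hz, e' _ _ _ hy, e' _ _ _ hz,
        hW _ (b 0).2 _ (b 0).2, hW _ (b 0).2 _ (b 1).2, hW _ (b 1).2 _ (b 0).2,
        hW _ (b 1).2 _ (b 1).2, hV _ y.2 _ z.2, hV _ y.2 _ y.2, hV _ z.2 _ y.2, hV _ z.2 _ z.2])
  refine ⟨P, hP, ?_, ?_, ?_, ?_⟩
  · rw [hw]; exact (b 0).2
  · rw [hw]; exact (b 1).2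
  · rw [hw]; exact y.2
  · rw [hw]; exact z.2

theorem exists_hyperbolic_pair (hJ : IsSymplecticForm J) {W V : Submodule F (Fin 4 → F)}
    (hWV : W ⊔ V = ⊤) (hort : ∀ v ∈ V, ∀ w ∈ W, Matrix.toBilin' J v w = 0) (hW : W ≠ ⊥) :
    ∃ x ∈ W, ∃ y ∈ W, Matrix.toBilin' J x y = 1 := by
  obtain ⟨y, hy, hy0⟩ := W.ne_bot_iff.1 hW
  have h1 : ∃ x ∈ W, Matrix.toBilin' J x y ≠ 0 := by
    by_contra! hcon
    refine hy0 (hJ.2.2 y fun x => ?_)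
    have hx : x ∈ W ⊔ V := by rw [hWV]; trivial
    obtain ⟨a, ha, c, hc, rfl⟩ := Submodule.mem_sup.1 hx
    rw [map_add, LinearMap.add_apply, hcon a ha, hort c hc y hy, add_zero]
  obtain ⟨x, hx, hxy⟩ := h1
  refine ⟨(Matrix.toBilin' J x y)⁻¹ • x, W.smul_mem _ hx, y, hy, ?_⟩
  rw [map_smul, LinearMap.smul_apply, smul_eq_mul, inv_mul_cancel₀ hxy]

theorem exists_frame_nonsingular (hJ : IsSymplecticForm J) {W V : Submodule F (Fin 4 → F)}
    (hWV : W ⊔ V = ⊤) (hort : ∀ v ∈ V, ∀ w ∈ W, Matrix.toBilin' J v w = 0) (hW : W ≠ ⊥)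
    (hV : V ≠ ⊥) :
    ∃ P : GL (Fin 4) F, CarriesForm P J (formNonsingular F) ∧
      P.1 *ᵥ Pi.single 0 1 ∈ W ∧ P.1 *ᵥ Pi.single 1 1 ∈ W ∧
      P.1 *ᵥ Pi.single 2 1 ∈ V ∧ P.1 *ᵥ Pi.single 3 1 ∈ V := by
  have hort' : ∀ v ∈ W, ∀ w ∈ V, Matrix.toBilin' J v w = 0 := fun v hv w hw =>
    hJ.1.isRefl _ _ (hort w hw v hv)
  obtain ⟨x, hx, y, hy, hxy⟩ := exists_hyperbolic_pair hJ hWV hort hW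
  obtain ⟨z, hz, t, ht, hzt⟩ := exists_hyperbolic_pair hJ (by rwa [sup_comm]) hort' hV
  have hyx : Matrix.toBilin' J y x = -1 := by rw [← hJ.1.neg_eq, hxy]
  have htz : Matrix.toBilin' J t z = -1 := by rw [← hJ.1.neg_eq, hzt]
  have hs : ∀ v, Matrix.toBilin' J v v = 0 := hJ.1
  obtain ⟨P, hP, hw⟩ := exists_carriesForm (J := J) (J' := formNonsingular F) det_formNonsingular
    ![x, y, z, t] (by
      intro i j
      fin_cases i <;> fin_cases j <;>
      simp [formNonsingular, hxy, hyx, hzt, htz, hs, hort' x hx z hz, hort' x hx t ht,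
        hort' y hy z hz, hort' y hy t ht, hort z hz x hx, hort z hz y hy, hort t ht x hx,
        hort t ht y hy])
  refine ⟨P, hP, ?_, ?_, ?_, ?_⟩
  · rw [hw]; exact hx
  · rw [hw]; exact hy
  · rw [hw]; exact hz
  · rw [hw]; exact ht

end Frames

/-! ### Invariance under change of basis -/

section BaseChange

variable {n : ℕ} {F : Type*} [Field F] {J J' : Matrix (Fin n) (Fin n) F} {P : GL (Fin n) F}

theorem mem_inBasis {G : Subgroup (GL (Fin n) F)} {x : GL (Fin n) F} :
    x ∈ inBasis P G ↔ P * x * P⁻¹ ∈ G := by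
  rw [inBasis, Subgroup.mem_map]
  constructor
  · rintro ⟨y, hy, rfl⟩
    simpa [mul_assoc] using hy
  · intro h
    exact ⟨_, h, by simp [mul_assoc]⟩

theorem inBasis_mono {G H : Subgroup (GL (Fin n) F)} (h : G ≤ H) : inBasis P G ≤ inBasis P H :=
  Subgroup.map_mono h

theorem inBasis_inv_inBasis (P : GL (Fin n) F) (G : Subgroup (GL (Fin n) F)) :
    inBasis P⁻¹ (inBasis P G) = G := by
  ext x
  rw [mem_inBasis, mem_inBasis, inv_inv]
  simp [mul_assoc]

theorem inBasis_inBasis_inv (P : GL (Fin n) F) (G : Subgroup (GL (Fin n) F)) :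
    inBasis P (inBasis P⁻¹ G) = G := by
  ext x
  rw [mem_inBasis, mem_inBasis, inv_inv]
  simp [mul_assoc]

theorem inBasis_mul (P Q : GL (Fin n) F) (G : Subgroup (GL (Fin n) F)) :
    inBasis (P * Q) G = inBasis Q (inBasis P G) := by
  ext x
  rw [mem_inBasis, mem_inBasis, mem_inBasis]
  simp [mul_assoc]

theorem inBasis_inf (P : GL (Fin n) F) (G H : Subgroup (GL (Fin n) F)) :
    inBasis P (G ⊓ H) = inBasis P G ⊓ inBasis P H := by
  ext x
  simp only [mem_inBasis, Subgroup.mem_inf]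

theorem CarriesForm.mul {J'' : Matrix (Fin n) (Fin n) F} {Q : GL (Fin n) F}
    (hP : CarriesForm P J J') (hQ : CarriesForm Q J' J'') : CarriesForm (P * Q) J J'' := by
  rw [CarriesForm] at *
  rw [← hQ, ← hP, Units.val_mul, Matrix.transpose_mul]
  simp only [Matrix.mul_assoc]

theorem CarriesForm.inv (hP : CarriesForm P J J') : CarriesForm P⁻¹ J' J := by
  rw [CarriesForm] at *
  rw [← hP]
  have h2 : P.1 * (P⁻¹).1 = 1 := by rw [← Units.val_mul, mul_inv_cancel, Units.val_one]
  have h1 : (P⁻¹).1ᵀ * P.1ᵀ = 1 := by rw [← Matrix.transpose_mul, h2, Matrix.transpose_one]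
  simp only [Matrix.mul_assoc]
  rw [h2, Matrix.mul_one, ← Matrix.mul_assoc, h1, Matrix.one_mul]

theorem CarriesForm.isSim_iff (hP : CarriesForm P J J') {x : GL (Fin n) F} {k : Fˣ} :
    IsSim J' x k ↔ IsSim J (P * x * P⁻¹) k := by
  have key : ∀ {P : GL (Fin n) F} {J J' : Matrix (Fin n) (Fin n) F} {x : GL (Fin n) F},
      CarriesForm P J J' → IsSim J (P * x * P⁻¹) k → IsSim J' x k := by
    intro P J J' x hP h
    have h1 : P.1ᵀ * ((P * x * P⁻¹).1ᵀ * J * (P * x * P⁻¹).1) * P.1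
        = (P * x * P⁻¹ * P).1ᵀ * J * (P * x * P⁻¹ * P).1 := by
      rw [Units.val_mul (P * x * P⁻¹) P, Matrix.transpose_mul]
      simp only [Matrix.mul_assoc]
    rw [IsSim] at *
    rw [h, inv_mul_cancel_right, Matrix.mul_smul, Matrix.smul_mul, hP, Units.val_mul,
      Matrix.transpose_mul] at h1
    rw [h1, ← hP]
    simp only [Matrix.mul_assoc]
  refine ⟨fun h => key hP.inv ?_, key hP⟩
  simpa [mul_assoc] using h

theorem CarriesForm.inBasis_GSp (hP : CarriesForm P J J') : inBasis P (GSp J) = GSp J' := by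
  ext x
  rw [mem_inBasis, mem_GSp, mem_GSp]
  exact exists_congr fun k => hP.isSim_iff.symm

theorem CarriesForm.inBasis_Sp (hP : CarriesForm P J J') : inBasis P (Sp J) = Sp J' := by
  ext x
  rw [mem_inBasis, mem_Sp, mem_Sp]
  exact hP.isSim_iff.symm

theorem IsStable.comap_inBasis {G : Subgroup (GL (Fin n) F)} {W : Submodule F (Fin n → F)}
    (h : IsStable (inBasis P G) W) : IsStable G (W.map (Matrix.toLin' P.1)) := by
  intro x hx v hv
  rw [mem_map_toLin'] at hv ⊢
  have h1 := h (P⁻¹ * x * P) (mem_inBasis.2 (by simpa [mul_assoc] using hx)) _ hv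
  rwa [Matrix.mulVec_mulVec, ← Units.val_mul, mul_inv_cancel_right, Units.val_mul,
    ← Matrix.mulVec_mulVec] at h1

theorem ActsIrreducibly.inBasis {G : Subgroup (GL (Fin n) F)} (h : ActsIrreducibly G) :
    ActsIrreducibly (inBasis P G) := by
  refine ⟨h.1, fun W hW => ?_⟩
  rcases h.2 _ hW.comap_inBasis with h1 | h1
  · left
    rw [eq_bot_iff]
    intro v hv
    have : P.1 *ᵥ v ∈ W.map (Matrix.toLin' P.1) := ⟨v, hv, Matrix.toLin'_apply _ _⟩
    rw [h1, Submodule.mem_bot] at this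
    rw [← inv_mulVec_map P v, this, Matrix.mulVec_zero]
    exact Submodule.zero_mem _
  · right
    rw [eq_top_iff]
    intro v _
    have : P.1 *ᵥ v ∈ W.map (Matrix.toLin' P.1) := by rw [h1]; trivial
    rwa [mem_map_toLin', inv_mulVec_map] at this

theorem ActsReducibly.inBasis {G : Subgroup (GL (Fin n) F)} (h : ActsReducibly G) :
    ActsReducibly (inBasis P G) := by
  intro h1
  apply h
  rw [← inBasis_inv_inBasis P G]
  exact h1.inBasis

theorem IsHasse.inBasis {G : Subgroup (GL (Fin n) F)} (h : IsHasse G) :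
    IsHasse (inBasis P G) := by
  refine ⟨fun x hx => ?_, h.2.inBasis⟩
  obtain ⟨a, ha⟩ := h.1 _ (mem_inBasis.1 hx)
  obtain ⟨v, hv, hav⟩ := (hasEigenvalue_iff _ _).1 ha
  refine ⟨a, (hasEigenvalue_iff _ _).2 ⟨(P⁻¹).1 *ᵥ v, fun h0 => hv ?_, ?_⟩⟩
  · rw [← map_mulVec_inv P v, h0, Matrix.mulVec_zero]
  · rw [← Matrix.mulVec_smul, ← hav, Matrix.mulVec_mulVec, Matrix.mulVec_mulVec, ← Units.val_mul,
      ← Units.val_mul]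
    congr 2
    group

theorem IsMaximalHasseIn.inBasis {G : Subgroup (GL (Fin n) F)} (hP : CarriesForm P J J')
    (h : IsMaximalHasseIn (GSp J) G) : IsMaximalHasseIn (GSp J') (inBasis P G) := by
  refine ⟨⟨?_, h.prop.2.inBasis⟩, fun H hH hle => ?_⟩
  · rw [← hP.inBasis_GSp]
    exact inBasis_mono h.prop.1
  · have h1 : HasseSubgroup.inBasis P⁻¹ H ≤ GSp J ∧ IsHasse (HasseSubgroup.inBasis P⁻¹ H) := by
      refine ⟨?_, hH.2.inBasis⟩
      rw [← hP.inv.inBasis_GSp]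
      exact inBasis_mono hH.1
    have h2 : G ≤ HasseSubgroup.inBasis P⁻¹ H := by
      rw [← inBasis_inv_inBasis P G]
      exact inBasis_mono hle
    have h3 := h.le_of_ge h1 h2
    rw [← inBasis_inBasis_inv P H]
    exact inBasis_mono h3

theorem inBasis_inf_Sp {G : Subgroup (GL (Fin n) F)} (hP : CarriesForm P J J') :
    inBasis P (G ⊓ Sp J) = inBasis P G ⊓ Sp J' := by
  rw [inBasis_inf, hP.inBasis_Sp]

end BaseChange

/-! ### Calculus of `2 × 2` blocks -/

section Blocks

variable {F : Type*} [Field F]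

/-- The `4 × 4` matrix with the given `2 × 2` blocks. -/
def mk4 (A B C D : Matrix (Fin 2) (Fin 2) F) : Matrix (Fin 4) (Fin 4) F :=
  Matrix.reindex finSumFinEquiv finSumFinEquiv (Matrix.fromBlocks A B C D)

theorem mk4_mul (A B C D A' B' C' D' : Matrix (Fin 2) (Fin 2) F) :
    mk4 A B C D * mk4 A' B' C' D' =
      mk4 (A * A' + B * C') (A * B' + B * D') (C * A' + D * C') (C * B' + D * D') := by
  simp only [mk4, Matrix.reindex_apply, Matrix.submatrix_mul_equiv, Matrix.fromBlocks_multiply]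

theorem mk4_transpose (A B C D : Matrix (Fin 2) (Fin 2) F) :
    (mk4 A B C D)ᵀ = mk4 Aᵀ Cᵀ Bᵀ Dᵀ := by
  simp only [mk4, Matrix.reindex_apply, Matrix.transpose_submatrix, Matrix.fromBlocks_transpose]

theorem mk4_smul (c : F) (A B C D : Matrix (Fin 2) (Fin 2) F) :
    c • mk4 A B C D = mk4 (c • A) (c • B) (c • C) (c • D) := by
  simp only [mk4, Matrix.reindex_apply, ← Matrix.fromBlocks_smul]
  rfl

theorem mk4_one : (mk4 1 0 0 1 : Matrix (Fin 4) (Fin 4) F) = 1 := by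
  simp only [mk4, Matrix.reindex_apply, Matrix.fromBlocks_one, Matrix.submatrix_one_equiv]

theorem mk4_inj {A B C D A' B' C' D' : Matrix (Fin 2) (Fin 2) F} :
    mk4 A B C D = mk4 A' B' C' D' ↔ A = A' ∧ B = B' ∧ C = C' ∧ D = D' := by
  rw [mk4, mk4, (Matrix.reindex _ _).injective.eq_iff, Matrix.fromBlocks_inj]

theorem mk4_apply (A B C D : Matrix (Fin 2) (Fin 2) F) : mk4 A B C D =
    !![A 0 0, A 0 1, B 0 0, B 0 1; A 1 0, A 1 1, B 1 0, B 1 1;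
      C 0 0, C 0 1, D 0 0, D 0 1; C 1 0, C 1 1, D 1 0, D 1 1] := by
  ext i j
  fin_cases i <;> fin_cases j <;> rfl

theorem exists_eq_mk4 (M : Matrix (Fin 4) (Fin 4) F) : ∃ A B C D, M = mk4 A B C D := by
  refine ⟨!![M 0 0, M 0 1; M 1 0, M 1 1], !![M 0 2, M 0 3; M 1 2, M 1 3],
    !![M 2 0, M 2 1; M 3 0, M 3 1], !![M 2 2, M 2 3; M 3 2, M 3 3], ?_⟩
  rw [mk4_apply]
  ext i j
  fin_cases i <;> fin_cases j <;> rfl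

theorem formIsotropic_eq : formIsotropic F = mk4 0 (-1) 1 0 := by
  rw [mk4_apply]
  simp [formIsotropic]

theorem formNonsingular_eq :
    formNonsingular F = mk4 !![0, 1; -1, 0] 0 0 !![0, 1; -1, 0] := by
  rw [mk4_apply]
  simp [formNonsingular]

theorem blockDiag_val (p : GL (Fin 2) F × GL (Fin 2) F) :
    (blockDiag F p).1 = mk4 p.1.1 0 0 p.2.1 := rfl

theorem blockDiagInvTranspose_val (A : GL (Fin 2) F) :
    (blockDiagInvTranspose F A).1 = mk4 A.1 0 0 (invTranspose F A).1 := rfl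

theorem blockDiagInvTranspose_injective : Function.Injective (blockDiagInvTranspose F) := by
  intro A B h
  have h1 := congrArg Units.val h
  rw [blockDiagInvTranspose_val, blockDiagInvTranspose_val, mk4_inj] at h1
  exact Units.ext h1.1

/-- The concatenation of two vectors of length two. -/
def vec4 (u v : Fin 2 → F) : Fin 4 → F := ![u 0, u 1, v 0, v 1]

theorem exists_eq_vec4 (x : Fin 4 → F) : ∃ u v, x = vec4 u v := by
  refine ⟨![x 0, x 1], ![x 2, x 3], ?_⟩
  ext i
  fin_cases i <;> rfl

theorem vec4_inj {u v u' v' : Fin 2 → F} : vec4 u v = vec4 u' v' ↔ u = u' ∧ v = v' := by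
  constructor
  · intro h
    exact ⟨by ext i; fin_cases i; exacts [congrFun h 0, congrFun h 1],
      by ext i; fin_cases i; exacts [congrFun h 2, congrFun h 3]⟩
  · rintro ⟨rfl, rfl⟩
    rfl

theorem smul_vec4 (c : F) (u v : Fin 2 → F) : c • vec4 u v = vec4 (c • u) (c • v) := by
  ext i
  fin_cases i <;> rfl

theorem vec4_zero : vec4 (0 : Fin 2 → F) 0 = 0 := by
  ext i
  fin_cases i <;> rfl

theorem vec4_ne_zero {u v : Fin 2 → F} : vec4 u v ≠ 0 ↔ u ≠ 0 ∨ v ≠ 0 := by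
  rw [Ne, ← vec4_zero, vec4_inj, not_and_or]

theorem mk4_mulVec (A B C D : Matrix (Fin 2) (Fin 2) F) (u v : Fin 2 → F) :
    mk4 A B C D *ᵥ vec4 u v = vec4 (A *ᵥ u + B *ᵥ v) (C *ᵥ u + D *ᵥ v) := by
  rw [mk4_apply]
  ext i
  fin_cases i <;> simp [vec4, Matrix.mulVec, dotProduct, Fin.sum_univ_succ, add_assoc]

theorem mulVec_eq_zero_iff (g : GL (Fin 2) F) {v : Fin 2 → F} : g.1 *ᵥ v = 0 ↔ v = 0 := by
  constructor
  · intro h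
    rw [← inv_mulVec_map g v, h, Matrix.mulVec_zero]
  · rintro rfl
    exact Matrix.mulVec_zero _

end Blocks

/-! ### Similitudes exchanging two isotropic planes -/

section AntiBlocks

variable {F : Type*} [Field F]

theorem invTranspose_val (A : GL (Fin 2) F) : (invTranspose F A).1 = ((A⁻¹).1)ᵀ := rfl

theorem transpose_mul_invTranspose (A : GL (Fin 2) F) : A.1ᵀ * (invTranspose F A).1 = 1 := by
  rw [invTranspose_val, ← Matrix.transpose_mul, ← Units.val_mul, inv_mul_cancel, Units.val_one,
    Matrix.transpose_one]

theorem invTranspose_mul_transpose (A : GL (Fin 2) F) : (invTranspose F A).1 * A.1ᵀ = 1 := by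
  rw [invTranspose_val, ← Matrix.transpose_mul, ← Units.val_mul, mul_inv_cancel, Units.val_one,
    Matrix.transpose_one]

/-- The similitude of `formIsotropic` with multiplier `k` exchanging the two coordinate planes. -/
def antiBlock (k : Fˣ) : GL (Fin 4) F where
  val := mk4 0 1 (-(k : F) • 1) 0
  inv := mk4 0 (-((k⁻¹ : Fˣ) : F) • 1) 1 0
  val_inv := by
    rw [mk4_mul, ← mk4_one]
    simp [smul_smul]
  inv_val := by
    rw [mk4_mul, ← mk4_one]
    simp [smul_smul]

theorem antiBlock_val (k : Fˣ) : (antiBlock k).1 = mk4 0 1 (-(k : F) • 1) 0 := rfl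

theorem blockDiagInvTranspose_mul_antiBlock_val (B : GL (Fin 2) F) (k : Fˣ) :
    (blockDiagInvTranspose F B * antiBlock k).1
      = mk4 0 B.1 (-(k : F) • (invTranspose F B).1) 0 := by
  rw [Units.val_mul, blockDiagInvTranspose_val, antiBlock_val, mk4_mul]
  simp

theorem invTranspose_invTranspose (A : GL (Fin 2) F) :
    invTranspose F (invTranspose F A) = A := by
  apply Units.ext
  rw [invTranspose_val]
  change ((A.1)ᵀ)ᵀ = A.1
  rw [Matrix.transpose_transpose]

theorem antiBlock_mul (k : Fˣ) (A : GL (Fin 2) F) :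
    antiBlock k * blockDiagInvTranspose F A
      = blockDiagInvTranspose F (invTranspose F A) * antiBlock k := by
  apply Units.ext
  rw [blockDiagInvTranspose_mul_antiBlock_val, Units.val_mul, blockDiagInvTranspose_val,
    antiBlock_val, mk4_mul, invTranspose_invTranspose]
  simp

theorem antiBlock_mul_self (k : Fˣ) :
    antiBlock k * antiBlock k = Matrix.GeneralLinearGroup.scalar (Fin 4) (-k) := by
  apply Units.ext
  rw [Units.val_mul, antiBlock_val, mk4_mul, scalar_val, ← mk4_one, mk4_smul]
  simp

theorem isSim_antiBlock (k : Fˣ) : IsSim (formIsotropic F) (antiBlock k) k := by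
  rw [IsSim, antiBlock_val, formIsotropic_eq, mk4_transpose, mk4_mul, mk4_mul, mk4_smul, mk4_inj]
  simp

theorem isSim_blockDiagInvTranspose (A : GL (Fin 2) F) :
    IsSim (formIsotropic F) (blockDiagInvTranspose F A) 1 := by
  have h := congrArg Matrix.transpose (transpose_mul_invTranspose A)
  rw [Matrix.transpose_mul, Matrix.transpose_transpose, Matrix.transpose_one] at h
  rw [IsSim, blockDiagInvTranspose_val, formIsotropic_eq, mk4_transpose, mk4_mul, mk4_mul, mk4_smul,
    mk4_inj]
  simp [transpose_mul_invTranspose, h]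

theorem carriesForm_blockDiagInvTranspose (A : GL (Fin 2) F) :
    CarriesForm (blockDiagInvTranspose F A) (formIsotropic F) (formIsotropic F) := by
  have := isSim_blockDiagInvTranspose A
  rwa [IsSim, Units.val_one, one_smul] at this

theorem exists_blockDiagInvTranspose {x : GL (Fin 4) F} {A D : Matrix (Fin 2) (Fin 2) F}
    (hx : x.1 = mk4 A 0 0 D) (hs : IsSim (formIsotropic F) x 1) :
    ∃ a, x = blockDiagInvTranspose F a := by
  rw [IsSim, hx, formIsotropic_eq, mk4_transpose, mk4_mul, mk4_mul, mk4_smul, mk4_inj] at hs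
  simp only [Matrix.transpose_zero, Matrix.mul_zero, Matrix.mul_neg, Matrix.mul_one, add_zero,
    zero_add, Matrix.zero_mul, Matrix.neg_mul, Units.val_one, one_smul, neg_inj] at hs
  have h1 : D * Aᵀ = 1 := mul_eq_one_comm.1 hs.2.1
  let a : GL (Fin 2) F := ⟨A, Dᵀ, by
    rw [← Matrix.transpose_inj, Matrix.transpose_mul, Matrix.transpose_transpose, h1,
      Matrix.transpose_one], hs.2.2.1⟩
  refine ⟨a, Units.ext ?_⟩
  rw [hx, blockDiagInvTranspose_val, mk4_inj]
  exact ⟨rfl, rfl, rfl, (Matrix.transpose_transpose D).symm⟩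

theorem exists_mul_antiBlock {x : GL (Fin 4) F} {B C : Matrix (Fin 2) (Fin 2) F} {k : Fˣ}
    (hx : x.1 = mk4 0 B C 0) (hs : IsSim (formIsotropic F) x k) :
    ∃ b, x = blockDiagInvTranspose F b * antiBlock k := by
  have h1 : (x * (antiBlock k)⁻¹).1 = mk4 B 0 0 (-((k⁻¹ : Fˣ) : F) • C) := by
    rw [Units.val_mul, hx]
    change mk4 0 B C 0 * mk4 0 (-((k⁻¹ : Fˣ) : F) • 1) 1 0 = _
    rw [mk4_mul]
    simp
  have h2 : IsSim (formIsotropic F) (x * (antiBlock k)⁻¹) 1 := by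
    have := hs.mul (isSim_antiBlock k).inv
    rwa [mul_inv_cancel] at this
  obtain ⟨b, hb⟩ := exists_blockDiagInvTranspose h1 h2
  exact ⟨b, by rw [← hb, inv_mul_cancel_right]⟩

/-- An eigenvector `(u, v)` for `c` satisfies `B v = c u` and `-k B^{-T} u = c v`; eliminating `u`
gives the condition on `v`. -/
theorem hasEigenvalue_mul_antiBlock (B : GL (Fin 2) F) (k : Fˣ) :
    (∃ a, Module.End.HasEigenvalue
      (Matrix.toLin' (blockDiagInvTranspose F B * antiBlock k).1) a) ↔
    ∃ c : F, ∃ v, v ≠ 0 ∧ c ^ 2 • (B.1ᵀ *ᵥ v) + (k : F) • (B.1 *ᵥ v) = 0 := by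
  simp only [hasEigenvalue_iff, blockDiagInvTranspose_mul_antiBlock_val]
  constructor
  · rintro ⟨a, x, hx, h⟩
    obtain ⟨u, v, rfl⟩ := exists_eq_vec4 x
    rw [mk4_mulVec, smul_vec4, vec4_inj] at h
    simp only [Matrix.zero_mulVec, zero_add, add_zero, Matrix.smul_mulVec] at h
    obtain ⟨h1, h2⟩ := h
    refine ⟨a, v, ?_, ?_⟩
    · rintro rfl
      rw [smul_zero, smul_eq_zero_iff_right (neg_ne_zero.2 k.ne_zero), mulVec_eq_zero_iff] at h2
      rw [h2, vec4_zero] at hx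
      exact hx rfl
    · have h3 := congrArg (fun y => B.1ᵀ *ᵥ y) h2
      simp only [Matrix.mulVec_smul, Matrix.mulVec_mulVec, transpose_mul_invTranspose,
        Matrix.one_mulVec] at h3
      rw [h1, pow_two, mul_smul, ← h3, neg_smul, smul_neg, smul_comm]
      simp
  · rintro ⟨c, v, hv, h⟩
    have hc : c ≠ 0 := by
      rintro rfl
      rw [zero_pow two_ne_zero, zero_smul, zero_add, smul_eq_zero_iff_right k.ne_zero,
        mulVec_eq_zero_iff] at h
      exact hv h
    refine ⟨c, vec4 (c⁻¹ • (B.1 *ᵥ v)) v, vec4_ne_zero.2 (Or.inr hv), ?_⟩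
    rw [mk4_mulVec, smul_vec4, vec4_inj]
    simp only [Matrix.zero_mulVec, add_zero, Matrix.smul_mulVec, Matrix.mulVec_smul]
    refine ⟨by rw [smul_zero, zero_add, smul_smul, mul_inv_cancel₀ hc, one_smul], ?_⟩
    have h1 : (k : F) • (B.1 *ᵥ v) = - c ^ 2 • (B.1ᵀ *ᵥ v) := by
      rw [neg_smul]; exact eq_neg_of_add_eq_zero_right h
    have h3 := congrArg (fun y => (invTranspose F B).1 *ᵥ y) h1
    simp only [Matrix.mulVec_smul] at h3
    rw [Matrix.mulVec_mulVec v _ B.1ᵀ, invTranspose_mul_transpose, Matrix.one_mulVec] at h3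
    rw [neg_smul, h3, neg_smul, smul_neg, smul_neg, neg_neg, smul_smul, pow_two, ← mul_assoc,
      inv_mul_cancel₀ hc, one_mul]

/-- Elements with an eigenvalue in the nontrivial coset of `G ∩ Sp₄`, isotropic case. -/
theorem trace_or_det_of_eigenvalue {B : GL (Fin 2) F} {k : Fˣ} (hk : ¬ IsSquare (k : F))
    (h : ∃ a, Module.End.HasEigenvalue
      (Matrix.toLin' (blockDiagInvTranspose F B * antiBlock k).1) a) :
    (B.1 1 0 = B.1 0 1 ∧ ¬ IsSquare (-1 : F)) ∨ (B.1 1 0 ≠ B.1 0 1 ∧ ¬ IsSquare B.1.det) := by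
  obtain ⟨c, v, hv, h⟩ := (hasEigenvalue_mul_antiBlock B k).1 h
  set p := B.1 0 0
  set q := B.1 0 1
  set r := B.1 1 0
  set s := B.1 1 1
  have h0 : c ^ 2 * (p * v 0 + r * v 1) + k * (p * v 0 + q * v 1) = 0 := by
    simpa [Matrix.mulVec, dotProduct, Fin.sum_univ_two] using congrFun h 0
  have h1 : c ^ 2 * (q * v 0 + s * v 1) + k * (r * v 0 + s * v 1) = 0 := by
    simpa [Matrix.mulVec, dotProduct, Fin.sum_univ_two] using congrFun h 1
  have hΔ : p * s - q * r ≠ 0 := by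
    have := B.isUnit.map Matrix.detMonoidHom
    rw [Matrix.coe_detMonoidHom, Matrix.det_fin_two] at this
    exact this.ne_zero
  -- This is the vanishing of the determinant of `c ^ 2 Bᵀ + k B`. Comparing square classes on both
  -- sides gives the dichotomy.
  have key : (c ^ 2 + k) ^ 2 * (p * s - q * r) = c ^ 2 * k * (r - q) ^ 2 := by
    have e0 : ((c ^ 2 + k) ^ 2 * (p * s - q * r) - c ^ 2 * k * (r - q) ^ 2) * v 0 = 0 := by
      linear_combination ((c ^ 2 + k) * s) * h0 - (c ^ 2 * r + k * q) * h1
    have e1 : ((c ^ 2 + k) ^ 2 * (p * s - q * r) - c ^ 2 * k * (r - q) ^ 2) * v 1 = 0 := by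
      linear_combination ((c ^ 2 + k) * p) * h1 - (c ^ 2 * q + k * r) * h0
    rcases vec_ne_zero_iff.1 hv with h2 | h2
    · exact sub_eq_zero.1 ((mul_eq_zero.1 e0).resolve_right h2)
    · exact sub_eq_zero.1 ((mul_eq_zero.1 e1).resolve_right h2)
  by_cases hqr : r = q
  · left
    refine ⟨hqr, ?_⟩
    rw [hqr, sub_self, zero_pow two_ne_zero, mul_zero] at key
    have h2 : c ^ 2 + k = 0 := by
      have := (mul_eq_zero.1 key).resolve_right (by rwa [← hqr] at hΔ ⊢)
      exact pow_eq_zero_iff two_ne_zero |>.1 this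
    rintro ⟨i, hi⟩
    exact hk ⟨i * c, by linear_combination h2 + c ^ 2 * hi⟩
  · right
    refine ⟨hqr, ?_⟩
    have hc : c ≠ 0 := by
      rintro rfl
      apply hΔ
      have : (k : F) ^ 2 * (p * s - q * r) = 0 := by linear_combination key
      exact (mul_eq_zero.1 this).resolve_left (pow_ne_zero 2 k.ne_zero)
    have hd : r - q ≠ 0 := sub_ne_zero.2 hqr
    rw [Matrix.det_fin_two]
    rintro ⟨t, ht⟩
    refine hk ⟨(c ^ 2 + k) * t / (c * (r - q)), ?_⟩
    have ht' : p * s - q * r = t * t := ht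
    rw [div_mul_div_comm, eq_div_iff (mul_ne_zero (mul_ne_zero hc hd) (mul_ne_zero hc hd))]
    rw [ht'] at key
    linear_combination -key

end AntiBlocks

/-! ### Monomial matrices and the Weyl element -/

section Monomial

variable {F : Type*} [Field F]

theorem conj_diagonal_of_fixes {a : GL (Fin 2) F} {x y : Fin 2 → F} (h : cross x y ≠ 0)
    (hf : Fixes a.1 x y) : ((ofColumns x y h)⁻¹ * a * ofColumns x y h).1 0 1 = 0 ∧
      ((ofColumns x y h)⁻¹ * a * ofColumns x y h).1 1 0 = 0 := by
  set Q := ofColumns x y h with hQ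
  have e : a.1 * Q.1 = Q.1 * (Q⁻¹ * a * Q).1 := by
    rw [← Units.val_mul, ← Units.val_mul]; congr 1; group
  set M := (Q⁻¹ * a * Q).1
  rw [hQ, ofColumns_val] at e
  have e00 := congrFun (congrFun e 0) 0
  have e01 := congrFun (congrFun e 0) 1
  have e10 := congrFun (congrFun e 1) 0
  have e11 := congrFun (congrFun e 1) 1
  simp [Matrix.mul_apply, Fin.sum_univ_two] at e00 e01 e10 e11
  obtain ⟨h1, h2⟩ := hf
  rw [cross_mulVec] at h1 h2
  rw [cross] at h
  constructor
  · apply (mul_eq_zero.1 _).resolve_right h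
    linear_combination -h2 + y 0 * e11 - y 1 * e01
  · apply (mul_eq_zero.1 _).resolve_right h
    linear_combination h1 - x 0 * e10 + x 1 * e00

theorem conj_antidiagonal_of_swaps {a : GL (Fin 2) F} {x y : Fin 2 → F} (h : cross x y ≠ 0)
    (hf : Swaps a.1 x y) : ((ofColumns x y h)⁻¹ * a * ofColumns x y h).1 0 0 = 0 ∧
      ((ofColumns x y h)⁻¹ * a * ofColumns x y h).1 1 1 = 0 := by
  set Q := ofColumns x y h with hQ
  have e : a.1 * Q.1 = Q.1 * (Q⁻¹ * a * Q).1 := by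
    rw [← Units.val_mul, ← Units.val_mul]; congr 1; group
  set M := (Q⁻¹ * a * Q).1
  rw [hQ, ofColumns_val] at e
  have e00 := congrFun (congrFun e 0) 0
  have e01 := congrFun (congrFun e 0) 1
  have e10 := congrFun (congrFun e 1) 0
  have e11 := congrFun (congrFun e 1) 1
  simp [Matrix.mul_apply, Fin.sum_univ_two] at e00 e01 e10 e11
  obtain ⟨h1, h2⟩ := hf
  rw [cross, mulVec_zero_eq, mulVec_one_eq] at h1 h2
  rw [cross] at h
  constructor
  · apply (mul_eq_zero.1 _).resolve_right h
    linear_combination -h1 + y 0 * e10 - y 1 * e00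
  · apply (mul_eq_zero.1 _).resolve_right h
    linear_combination h2 - x 0 * e11 + x 1 * e01

theorem inv_val_eq (a : GL (Fin 2) F) :
    (a⁻¹).1 = (a.1.det)⁻¹ • !![a.1 1 1, -a.1 0 1; -a.1 1 0, a.1 0 0] := by
  rw [Matrix.coe_units_inv, Matrix.inv_def, Ring.inverse_eq_inv', Matrix.adjugate_fin_two]

/-- The monomial matrices whose nonzero entries have a square product. -/
def squareMonomial (F : Type*) [Field F] : Subgroup (GL (Fin 2) F) where
  carrier := {a | (a.1 0 1 = 0 ∧ a.1 1 0 = 0 ∧ IsSquare (a.1 0 0 * a.1 1 1)) ∨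
    (a.1 0 0 = 0 ∧ a.1 1 1 = 0 ∧ IsSquare (a.1 0 1 * a.1 1 0))}
  one_mem' := by
    left
    exact ⟨rfl, rfl, 1, by simp⟩
  mul_mem' := by
    rintro a b (⟨h1, h2, s, hs⟩ | ⟨h1, h2, s, hs⟩) (⟨h3, h4, t, ht⟩ | ⟨h3, h4, t, ht⟩)
    · left
      simp only [Units.val_mul, Matrix.mul_apply, Fin.sum_univ_two, h1, h2, h3, h4]
      exact ⟨by ring, by ring, s * t, by linear_combination b.1 0 0 * b.1 1 1 * hs + s * s * ht⟩
    · right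
      simp only [Units.val_mul, Matrix.mul_apply, Fin.sum_univ_two, h1, h2, h3, h4]
      exact ⟨by ring, by ring, s * t, by linear_combination b.1 0 1 * b.1 1 0 * hs + s * s * ht⟩
    · right
      simp only [Units.val_mul, Matrix.mul_apply, Fin.sum_univ_two, h1, h2, h3, h4]
      exact ⟨by ring, by ring, s * t, by linear_combination b.1 0 0 * b.1 1 1 * hs + s * s * ht⟩
    · left
      simp only [Units.val_mul, Matrix.mul_apply, Fin.sum_univ_two, h1, h2, h3, h4]
      exact ⟨by ring, by ring, s * t, by linear_combination b.1 0 1 * b.1 1 0 * hs + s * s * ht⟩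
  inv_mem' := by
    rintro a (⟨h1, h2, s, hs⟩ | ⟨h1, h2, s, hs⟩)
    · left
      simp only [inv_val_eq, Matrix.smul_apply, smul_eq_mul, h1, h2]
      refine ⟨by simp, by simp, (a.1.det)⁻¹ * s, ?_⟩
      simp only [Matrix.of_apply, Matrix.cons_val', Matrix.cons_val_zero, Matrix.cons_val_one,
        Matrix.cons_val_fin_one]
      linear_combination (a.1.det)⁻¹ ^ 2 * hs
    · right
      simp only [inv_val_eq, Matrix.smul_apply, smul_eq_mul, h1, h2]
      refine ⟨by simp, by simp, (a.1.det)⁻¹ * s, ?_⟩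
      simp only [Matrix.of_apply, Matrix.cons_val', Matrix.cons_val_zero, Matrix.cons_val_one,
        Matrix.cons_val_fin_one]
      linear_combination (a.1.det)⁻¹ ^ 2 * hs

theorem mem_squareMonomial {a : GL (Fin 2) F} : a ∈ squareMonomial F ↔
    (a.1 0 1 = 0 ∧ a.1 1 0 = 0 ∧ IsSquare (a.1 0 0 * a.1 1 1)) ∨
    (a.1 0 0 = 0 ∧ a.1 1 1 = 0 ∧ IsSquare (a.1 0 1 * a.1 1 0)) := Iff.rfl

theorem invTranspose_mem_squareMonomial {a : GL (Fin 2) F} (h : a ∈ squareMonomial F) :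
    invTranspose F a ∈ squareMonomial F := by
  have h1 := (squareMonomial F).inv_mem h
  rw [mem_squareMonomial] at h1 ⊢
  simp only [invTranspose_val, Matrix.transpose_apply]
  rcases h1 with ⟨h1, h2, h3⟩ | ⟨h1, h2, h3⟩
  · exact Or.inl ⟨h2, h1, h3⟩
  · exact Or.inr ⟨h1, h2, by rwa [mul_comm]⟩

theorem mem_squareMonomial_of_pair {a : GL (Fin 2) F} {x y : Fin 2 → F} (h : cross x y ≠ 0)
    (ha : (Fixes a.1 x y ∧ IsSquare a.1.det) ∨ (Swaps a.1 x y ∧ IsSquare (-a.1.det))) :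
    (ofColumns x y h)⁻¹ * a * ofColumns x y h ∈ squareMonomial F := by
  have hdet : ((ofColumns x y h)⁻¹ * a * ofColumns x y h).1.det = a.1.det := by
    rw [Units.val_mul, Matrix.det_mul_comm, ← Units.val_mul]
    congr 2
    group
  rw [Matrix.det_fin_two] at hdet
  rcases ha with ⟨h1, h2⟩ | ⟨h1, h2⟩
  · obtain ⟨e1, e2⟩ := conj_diagonal_of_fixes h h1
    refine Or.inl ⟨e1, e2, ?_⟩
    rw [e1, zero_mul, sub_zero] at hdet
    rwa [hdet]
  · obtain ⟨e1, e2⟩ := conj_antidiagonal_of_swaps h h1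
    refine Or.inr ⟨e1, e2, ?_⟩
    rw [e1, zero_mul, zero_sub] at hdet
    rwa [← hdet, neg_neg] at h2

/-- The matrix intertwining the natural representation of `SL₂` with its dual. -/
def weyl (F : Type*) [Field F] : GL (Fin 2) F :=
  ⟨!![0, 1; -1, 0], !![0, -1; 1, 0], by ext i j; fin_cases i <;> fin_cases j <;> simp,
    by ext i j; fin_cases i <;> fin_cases j <;> simp⟩

theorem weyl_val : (weyl F).1 = !![0, 1; -1, 0] := rfl

theorem weyl_inv_val : ((weyl F)⁻¹).1 = !![0, -1; 1, 0] := rfl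

theorem det_weyl : (weyl F).1.det = 1 := by
  rw [weyl_val, Matrix.det_fin_two_of]; ring

theorem weyl_mul_self : weyl F * weyl F = Matrix.GeneralLinearGroup.scalar (Fin 2) (-1) := by
  apply Units.ext
  rw [Units.val_mul, scalar_val, weyl_val]
  ext i j
  fin_cases i <;> fin_cases j <;> simp

/-- Modulo scalars, the inverse transpose is conjugation by `weyl F`. Hence a similitude with block
`B` acts on `H` like conjugation by `B * weyl F`. -/
theorem weyl_conj (a : GL (Fin 2) F) : weyl F * a * (weyl F)⁻¹ =
    Matrix.GeneralLinearGroup.scalar (Fin 2) (Matrix.GeneralLinearGroup.det a)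
      * invTranspose F a := by
  apply Units.ext
  rw [Units.val_mul, Units.val_mul, Units.val_mul, scalar_val, invTranspose_val, weyl_inv_val,
    inv_val_eq a, weyl_val, smul_mul_assoc, one_mul, Matrix.GeneralLinearGroup.val_det_apply,
    Matrix.transpose_smul, smul_smul, mul_inv_cancel₀ (det_ne_zero a), one_smul]
  ext i j
  fin_cases i <;> fin_cases j <;>
    simp [Matrix.mul_apply, Fin.sum_univ_two, Matrix.vecMul, dotProduct]

end Monomial

/-! ### The isotropic case in standard coordinates -/

section Isotropic

variable {F : Type*} [Field F]

theorem mul_antiBlock_mul (B A : GL (Fin 2) F) (k : Fˣ) :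
    blockDiagInvTranspose F B * antiBlock k * blockDiagInvTranspose F A =
      blockDiagInvTranspose F (B * invTranspose F A * B⁻¹) *
        (blockDiagInvTranspose F B * antiBlock k) := by
  rw [mul_assoc, antiBlock_mul, ← mul_assoc, ← mul_assoc, ← map_mul, ← map_mul,
    inv_mul_cancel_right]

theorem mul_antiBlock_mul_self (B : GL (Fin 2) F) (k : Fˣ) :
    blockDiagInvTranspose F B * antiBlock k * (blockDiagInvTranspose F B * antiBlock k) =
      Matrix.GeneralLinearGroup.scalar (Fin 4) (-k) *
        blockDiagInvTranspose F (B * invTranspose F B) := by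
  rw [← mul_assoc, mul_assoc _ (antiBlock k) (blockDiagInvTranspose F B), antiBlock_mul,
    ← mul_assoc, ← map_mul, mul_assoc, antiBlock_mul_self, mul_scalar_comm]

variable {ℓ : ℕ} [Fact ℓ.Prime]

theorem isSquare_neg_of_not_isSquare {k : ZMod ℓ} (hk : ¬ IsSquare k)
    (hneg : ¬ IsSquare (-1 : ZMod ℓ)) : IsSquare (-k) := by
  have := isSquare_mul_of_not_isSquare hneg hk
  rwa [neg_one_mul] at this

/-- A diagonal matrix has `e₁` as eigenvector, and an antidiagonal one whose entries multiply to `s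
^ 2` has the eigenvalue `s`. -/
theorem hasPropertyE_squareMonomial :
    HasPropertyE ((squareMonomial F).map (blockDiagInvTranspose F)) := by
  rintro _ ⟨a, ha, rfl⟩
  have key : ∀ (c : F) (u : Fin 2 → F), u ≠ 0 → a.1 *ᵥ u = c • u → ∃ c : F,
      Module.End.HasEigenvalue (Matrix.toLin' (blockDiagInvTranspose F a).1) c := by
    intro c u hu h
    refine ⟨c, (hasEigenvalue_iff _ _).2 ⟨vec4 u 0, vec4_ne_zero.2 (Or.inl hu), ?_⟩⟩
    rw [blockDiagInvTranspose_val, mk4_mulVec, smul_vec4, h]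
    simp
  rcases ha with ⟨h1, h2, -⟩ | ⟨h1, h2, s, hs⟩
  · refine key (a.1 0 0) ![1, 0] (vec_ne_zero_iff.2 (Or.inl one_ne_zero)) ?_
    ext i
    fin_cases i <;> simp [Matrix.mulVec, dotProduct, Fin.sum_univ_two, h2]
  · have hd := det_ne_zero a
    rw [Matrix.det_fin_two, h1, zero_mul, zero_sub, neg_ne_zero] at hd
    refine key s ![a.1 0 1, s] (vec_ne_zero_iff.2 (Or.inl (left_ne_zero_of_mul hd))) ?_
    ext i
    fin_cases i
    · simp [Matrix.mulVec, dotProduct, Fin.sum_univ_two, h1, mul_comm]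
    · simp [Matrix.mulVec, dotProduct, Fin.sum_univ_two, h2, ← hs, mul_comm]

/-- As `k` and `-1` are nonsquares, `-k = c ^ 2`. With `v = e₁` the eigenvalue equation is solved by
`c` for diagonal `B`, and by `c` rescaled by the root `s` for antidiagonal `B`. -/
theorem exists_eigenvalue_mul_antiBlock {k : (ZMod ℓ)ˣ} (hk : ¬ IsSquare (k : ZMod ℓ))
    (hneg : ¬ IsSquare (-1 : ZMod ℓ)) {B : GL (Fin 2) (ZMod ℓ)} (hB : B ∈ squareMonomial (ZMod ℓ)) :
    ∃ a, Module.End.HasEigenvalue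
      (Matrix.toLin' (blockDiagInvTranspose (ZMod ℓ) B * antiBlock k).1) a := by
  rw [hasEigenvalue_mul_antiBlock]
  obtain ⟨c, hc⟩ := isSquare_neg_of_not_isSquare hk hneg
  rcases hB with ⟨h1, h2, -⟩ | ⟨h1, h2, s, hs⟩
  · refine ⟨c, ![1, 0], vec_ne_zero_iff.2 (Or.inl one_ne_zero), ?_⟩
    ext i
    fin_cases i
    · simp
      linear_combination -B.1 0 0 * hc
    · simp [h1, h2]
  · have hd := det_ne_zero B
    rw [Matrix.det_fin_two, h1, zero_mul, zero_sub, neg_ne_zero] at hd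
    have hb := left_ne_zero_of_mul hd
    refine ⟨c * s / B.1 0 1, ![1, 0], vec_ne_zero_iff.2 (Or.inl one_ne_zero), ?_⟩
    ext i
    fin_cases i
    · simp [h1]
    · simp
      field_simp
      linear_combination -s ^ 2 * hc + k * hs

/-- A maximal Hasse subgroup contains the full group of square monomial matrices as soon as its
symplectic part is contained in it. -/
theorem inf_Sp_eq_squareMonomial {G : Subgroup (GL (Fin 4) (ZMod ℓ))}
    (hG : IsMaximalHasseIn (GSp (formIsotropic (ZMod ℓ))) G)
    (hle : G ⊓ Sp (formIsotropic (ZMod ℓ)) ≤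
      (squareMonomial (ZMod ℓ)).map (blockDiagInvTranspose (ZMod ℓ)))
    {k : (ZMod ℓ)ˣ} (hk : ¬ IsSquare k) (hneg : ¬ IsSquare (-1 : ZMod ℓ))
    {B : GL (Fin 2) (ZMod ℓ)} (hB : B ∈ squareMonomial (ZMod ℓ))
    (hg : blockDiagInvTranspose (ZMod ℓ) B * antiBlock k ∈ G) :
    G ⊓ Sp (formIsotropic (ZMod ℓ)) =
      (squareMonomial (ZMod ℓ)).map (blockDiagInvTranspose (ZMod ℓ)) := by
  have hJ0 : formIsotropic (ZMod ℓ) ≠ 0 := fun h => by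
    have := det_formIsotropic (F := ZMod ℓ)
    rw [h, Matrix.det_zero] at this
    exact this rfl
  have hk' : ¬ IsSquare (k : ZMod ℓ) := by rwa [← isSquare_units_iff]
  set N := squareMonomial (ZMod ℓ)
  set τ := blockDiagInvTranspose (ZMod ℓ) B * antiBlock k with hτ
  have hτs : IsSim (formIsotropic (ZMod ℓ)) τ k := by
    have := (isSim_blockDiagInvTranspose B).mul (isSim_antiBlock k)
    rwa [one_mul] at this
  have hm : ∀ a ∈ saturation (N.map (blockDiagInvTranspose (ZMod ℓ))),
      τ * a * τ⁻¹ ∈ saturation (N.map (blockDiagInvTranspose (ZMod ℓ))) := by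
    intro x hx
    obtain ⟨c, _, ⟨a, ha, rfl⟩, rfl⟩ := mem_saturation.1 hx
    refine mem_saturation.2 ⟨c, _, ⟨B * invTranspose (ZMod ℓ) a * B⁻¹, N.mul_mem (N.mul_mem hB
      (invTranspose_mem_squareMonomial ha)) (N.inv_mem hB), rfl⟩, ?_⟩
    rw [eq_mul_inv_iff_mul_eq, mul_assoc, ← mul_antiBlock_mul, ← mul_assoc τ, mul_scalar_comm, hτ]
    simp only [mul_assoc]
  have hm2 : τ * τ ∈ saturation (N.map (blockDiagInvTranspose (ZMod ℓ))) := by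
    rw [hτ, mul_antiBlock_mul_self]
    exact mem_saturation.2 ⟨-k, _, ⟨_, N.mul_mem hB (invTranspose_mem_squareMonomial hB), rfl⟩, rfl⟩
  let K := adjoinNormalizing _ τ hm hm2
  have hSle : N.map (blockDiagInvTranspose (ZMod ℓ)) ≤ K := fun x hx =>
    Or.inl (le_sup_left (b := scalars 4 (ZMod ℓ)) hx)
  have hSG : saturation (N.map (blockDiagInvTranspose (ZMod ℓ))) ≤ GSp (formIsotropic (ZMod ℓ)) := by
    refine sup_le ?_ (hG.scalars_le.trans hG.prop.1)
    rintro _ ⟨a, -, rfl⟩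
    exact ⟨1, isSim_blockDiagInvTranspose a⟩
  have hKG : K ≤ GSp (formIsotropic (ZMod ℓ)) := by
    rintro x (hx | hx)
    · exact hSG hx
    · have := (GSp (formIsotropic (ZMod ℓ))).mul_mem (hSG hx) ⟨k, hτs⟩
      rwa [inv_mul_cancel_right] at this
  have hGK : G ≤ K := by
    intro x hx
    have hmono : saturation (G ⊓ Sp (formIsotropic (ZMod ℓ))) ≤
        saturation (N.map (blockDiagInvTranspose (ZMod ℓ))) := sup_le_sup_right hle _
    rcases mem_or_mul_inv_mem_saturation hJ0 hG hg hτs hk x hx with h | h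
    · exact Or.inl (hmono h)
    · exact Or.inr (hmono h)
  have hKE : HasPropertyE K := by
    rintro x (hx | hx)
    · exact hasPropertyE_squareMonomial.saturation x hx
    · obtain ⟨c, _, ⟨a, ha, rfl⟩, hcx⟩ := mem_saturation.1 hx
      rw [eq_mul_inv_iff_mul_eq, mul_assoc, hτ, ← mul_assoc (blockDiagInvTranspose (ZMod ℓ) a),
        ← map_mul] at hcx
      obtain ⟨e, he⟩ := exists_eigenvalue_mul_antiBlock hk' hneg (N.mul_mem ha hB)
      obtain ⟨v, hv, hev⟩ := (hasEigenvalue_iff _ _).1 he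
      refine ⟨c * e, (hasEigenvalue_iff _ _).2 ⟨v, hv, ?_⟩⟩
      rw [← hcx, Units.val_mul, scalar_val, smul_mul_assoc, one_mul, Matrix.smul_mulVec, hev,
        smul_smul]
  -- `K` adjoins to `τ` and the scalars every square monomial matrix. It contains `G` and is still
  -- Hasse, so by maximality it is no larger.
  have hKle := hG.le_of_ge ⟨hKG, hKE, hG.prop.2.2.mono hGK⟩ hGK
  refine le_antisymm hle (le_inf (hSle.trans hKle) ?_)
  rintro _ ⟨a, -, rfl⟩
  exact mem_Sp.2 (isSim_blockDiagInvTranspose a)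

theorem disc_invTranspose (a : GL (Fin 2) F) :
    disc a.1 = a.1.det ^ 2 * disc (invTranspose F a).1 := by
  have hd := det_ne_zero a
  rw [invTranspose_val, inv_val_eq, disc_eq, disc_eq]
  simp only [Matrix.transpose_apply, Matrix.smul_apply, Matrix.of_apply, Matrix.cons_val',
    Matrix.cons_val_zero, Matrix.cons_val_one, Matrix.cons_val_fin_one, smul_eq_mul]
  field_simp
  ring

theorem isSquare_disc_of_eigenvalue {a : GL (Fin 2) F}
    (h : ∃ c, Module.End.HasEigenvalue (Matrix.toLin' (blockDiagInvTranspose F a).1) c) :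
    IsSquare (disc a.1) := by
  obtain ⟨c, h⟩ := h
  obtain ⟨x, hx, hcx⟩ := (hasEigenvalue_iff _ _).1 h
  obtain ⟨u, v, rfl⟩ := exists_eq_vec4 x
  rw [blockDiagInvTranspose_val, mk4_mulVec, smul_vec4, vec4_inj] at hcx
  simp only [Matrix.zero_mulVec, add_zero, zero_add] at hcx
  rcases vec4_ne_zero.1 hx with hu | hv
  · exact isSquare_disc_of_cross hu (by rw [hcx.1, cross_smul_right, cross_self, mul_zero])
  · rw [disc_invTranspose]
    refine (IsSquare.sq _).mul (isSquare_disc_of_cross hv ?_)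
    rw [hcx.2, cross_smul_right, cross_self, mul_zero]

theorem scalar_mul_val (c : Fˣ) (a : GL (Fin 2) F) :
    (Matrix.GeneralLinearGroup.scalar (Fin 2) c * a).1 = (c : F) • a.1 := by
  rw [Units.val_mul, scalar_val, smul_mul_assoc, one_mul]

theorem trace_mul_weyl (B : GL (Fin 2) F) : (B * weyl F).1.trace = B.1 1 0 - B.1 0 1 := by
  rw [Units.val_mul, weyl_val, Matrix.trace_fin_two]
  simp [Matrix.mul_apply, Fin.sum_univ_two]
  ring

theorem det_mul_weyl (B : GL (Fin 2) F) : (B * weyl F).1.det = B.1.det := by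
  rw [Units.val_mul, Matrix.det_mul, det_weyl, mul_one]

theorem weyl_mul (A : GL (Fin 2) F) : weyl F * A =
    Matrix.GeneralLinearGroup.scalar (Fin 2) (Matrix.GeneralLinearGroup.det A)
      * invTranspose F A * weyl F := by
  rw [← weyl_conj, inv_mul_cancel_right]

/-- This translates to `exists_pair_of_coset` for `H` saturated by scalars and `m = B * weyl`.
Symmetry of a block becomes vanishing of the trace after multiplication by `weyl`, while the
determinant is unchanged. -/
theorem exists_pair_isotropic (hℓ : ℓ ≠ 2) {G : Subgroup (GL (Fin 4) (ZMod ℓ))}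
    (hG : IsMaximalHasseIn (GSp (formIsotropic (ZMod ℓ))) G)
    (hline : ∀ v : Fin 4 → ZMod ℓ, v ≠ 0 → ∃ h ∈ G ⊓ Sp (formIsotropic (ZMod ℓ)),
      ∀ c : ZMod ℓ, h.1 *ᵥ v ≠ c • v)
    (hblk : ∀ h ∈ G ⊓ Sp (formIsotropic (ZMod ℓ)), ∃ a, h = blockDiagInvTranspose (ZMod ℓ) a)
    {k : (ZMod ℓ)ˣ} (hk : ¬ IsSquare k) {B : GL (Fin 2) (ZMod ℓ)}
    (hg : blockDiagInvTranspose (ZMod ℓ) B * antiBlock k ∈ G) :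
    ¬ IsSquare (-1 : ZMod ℓ) ∧ ∃ x y : Fin 2 → ZMod ℓ, cross x y ≠ 0 ∧
      (∀ a, blockDiagInvTranspose (ZMod ℓ) a ∈ G →
        (Fixes a.1 x y ∧ IsSquare a.1.det) ∨ (Swaps a.1 x y ∧ IsSquare (-a.1.det))) ∧
      ∃ b, blockDiagInvTranspose (ZMod ℓ) b * antiBlock k ∈ G ∧
        Swaps (b * weyl (ZMod ℓ)).1 x y ∧ IsSquare b.1.det := by
  have hk' : ¬ IsSquare (k : ZMod ℓ) := by rwa [← isSquare_units_iff]
  set H := G.comap (blockDiagInvTranspose (ZMod ℓ)) with hH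
  have hsc := hG.scalars_le
  have memH : ∀ a, a ∈ H ↔ blockDiagInvTranspose (ZMod ℓ) a ∈ G := fun a => Iff.rfl
  have h1 : ∀ a ∈ saturation H, IsSquare (disc a.1) := by
    intro a ha
    obtain ⟨c, h, hh, rfl⟩ := mem_saturation.1 ha
    have : disc ((c : ZMod ℓ) • h.1) = (c : ZMod ℓ) ^ 2 * disc h.1 := by
      rw [disc_eq, disc_eq]
      simp only [Matrix.smul_apply, smul_eq_mul]
      ring
    rw [scalar_mul_val, this]
    exact (IsSquare.sq _).mul (isSquare_disc_of_eigenvalue (hG.prop.2.1 _ hh))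
  have h2 : NoCommonLine (saturation H) := by
    intro v hv
    obtain ⟨h, hh, hc⟩ := hline (vec4 v 0) (vec4_ne_zero.2 (Or.inl hv))
    obtain ⟨a, rfl⟩ := hblk h hh
    refine ⟨a, le_sup_left (b := scalars 2 (ZMod ℓ)) hh.1, fun h0 => ?_⟩
    obtain ⟨c, hc'⟩ := exists_smul_of_cross hv h0
    apply hc c
    rw [blockDiagInvTranspose_val, mk4_mulVec, smul_vec4, hc']
    simp
  have h3 : ∀ a ∈ saturation H,
      B * weyl (ZMod ℓ) * a * (B * weyl (ZMod ℓ))⁻¹ ∈ saturation H := by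
    intro a ha
    obtain ⟨c, h, hh, rfl⟩ := mem_saturation.1 ha
    refine mem_saturation.2 ⟨c * Matrix.GeneralLinearGroup.det h,
      B * invTranspose (ZMod ℓ) h * B⁻¹, ?_, ?_⟩
    · rw [memH]
      have h5 := mul_antiBlock_mul B h k
      rw [← mul_inv_eq_iff_eq_mul] at h5
      rw [← h5]
      exact G.mul_mem (G.mul_mem hg hh) (G.inv_mem hg)
    · rw [eq_mul_inv_iff_mul_eq, ← mul_assoc (B * weyl (ZMod ℓ)), mul_scalar_comm,
        mul_assoc _ (B * weyl (ZMod ℓ)), mul_assoc B _ h, weyl_mul,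
        mul_assoc _ (invTranspose (ZMod ℓ) h) (weyl (ZMod ℓ)),
        ← mul_assoc B, mul_scalar_comm, map_mul]
      simp only [mul_assoc, inv_mul_cancel_left]
  have h4 : B * weyl (ZMod ℓ) * (B * weyl (ZMod ℓ)) ∈ saturation H := by
    refine mem_saturation.2 ⟨Matrix.GeneralLinearGroup.det B * -1,
      B * invTranspose (ZMod ℓ) B, ?_, ?_⟩
    · rw [memH]
      have h5 := mul_antiBlock_mul_self B k
      rw [← inv_mul_eq_iff_eq_mul] at h5
      rw [← h5]
      exact G.mul_mem (G.inv_mem (hsc (scalar_mem_scalars _))) (G.mul_mem hg hg)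
    · rw [mul_assoc B, ← mul_assoc (weyl (ZMod ℓ)), weyl_mul, mul_assoc _ (weyl (ZMod ℓ)),
        weyl_mul_self, mul_assoc _ (invTranspose (ZMod ℓ) B), mul_scalar_comm,
        ← mul_assoc _ (Matrix.GeneralLinearGroup.scalar (Fin 2) (-1)), ← map_mul, ← mul_assoc B,
        mul_scalar_comm, mul_assoc]
  have hcomb : ∀ a, a ∈ H → blockDiagInvTranspose (ZMod ℓ) (a * B) * antiBlock k ∈ G := by
    intro a ha
    rw [map_mul, mul_assoc]
    exact G.mul_mem ha hg
  have h5 : ∀ a ∈ saturation H, ((a * (B * weyl (ZMod ℓ))).1.trace = 0 ∧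
      ¬ IsSquare (-1 : ZMod ℓ)) ∨ ((a * (B * weyl (ZMod ℓ))).1.trace ≠ 0 ∧
      ¬ IsSquare (a * (B * weyl (ZMod ℓ))).1.det) := by
    intro a ha
    obtain ⟨c, h, hh, rfl⟩ := mem_saturation.1 ha
    have h6 := trace_or_det_of_eigenvalue hk' (hG.prop.2.1 _ (hcomb h hh))
    rw [mul_assoc, scalar_mul_val, ← mul_assoc, Matrix.trace_smul, Matrix.det_smul, trace_mul_weyl,
      det_mul_weyl, smul_eq_mul, mul_eq_zero, or_iff_right c.ne_zero, Ne, mul_eq_zero,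
      or_iff_right c.ne_zero, sub_eq_zero, Fintype.card_fin]
    refine h6.imp_right fun h7 => ⟨h7.1, fun h8 => h7.2 ?_⟩
    have h9 := h8.mul (IsSquare.sq ((c : ZMod ℓ)⁻¹))
    rwa [mul_comm, ← mul_assoc, ← mul_pow, inv_mul_cancel₀ c.ne_zero, one_pow, one_mul] at h9
  obtain ⟨hneg, x, y, hxy, h6, a, ha, h7, h8⟩ :=
    exists_pair_of_coset hℓ h1 h2 le_sup_right h3 h4 h5
  refine ⟨hneg, x, y, hxy, fun a ha => h6 a (le_sup_left (b := scalars 2 (ZMod ℓ)) ha), ?_⟩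
  obtain ⟨c, h, hh, rfl⟩ := mem_saturation.1 ha
  refine ⟨h * B, hcomb h hh, ?_, ?_⟩
  · rw [mul_assoc, scalar_mul_val, ← mul_assoc] at h7
    rw [Swaps, Matrix.smul_mulVec, Matrix.smul_mulVec, cross_smul_right, cross_smul_right,
      mul_eq_zero, mul_eq_zero, or_iff_right c.ne_zero, or_iff_right c.ne_zero] at h7
    exact h7
  · rw [mul_assoc, scalar_mul_val, ← mul_assoc, Matrix.det_smul, det_mul_weyl,
      Fintype.card_fin] at h8
    have h9 := h8.mul (IsSquare.sq ((c : ZMod ℓ)⁻¹))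
    rwa [mul_comm, ← mul_assoc, ← mul_pow, inv_mul_cancel₀ c.ne_zero, one_pow, one_mul] at h9

theorem isSymplecticForm_formIsotropic : IsSymplecticForm (formIsotropic F) := by
  constructor
  · intro v
    rw [Matrix.toBilin'_apply']
    simp [formIsotropic, Matrix.mulVec, dotProduct, Fin.sum_univ_succ]
    ring
  · exact (Matrix.nondegenerate_of_det_ne_zero det_formIsotropic).toBilin'

theorem exists_inBasis_eq_squareMonomial (hℓ : ℓ ≠ 2) {G : Subgroup (GL (Fin 4) (ZMod ℓ))}
    (hG : IsMaximalHasseIn (GSp (formIsotropic (ZMod ℓ))) G)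
    (hline : ∀ v : Fin 4 → ZMod ℓ, v ≠ 0 → ∃ h ∈ G ⊓ Sp (formIsotropic (ZMod ℓ)),
      ∀ c : ZMod ℓ, h.1 *ᵥ v ≠ c • v)
    (hblk : ∀ h ∈ G ⊓ Sp (formIsotropic (ZMod ℓ)), ∃ a, h = blockDiagInvTranspose (ZMod ℓ) a)
    {k : (ZMod ℓ)ˣ} (hk : ¬ IsSquare k) {B : GL (Fin 2) (ZMod ℓ)}
    (hg : blockDiagInvTranspose (ZMod ℓ) B * antiBlock k ∈ G) :
    ¬ IsSquare (-1 : ZMod ℓ) ∧ ∃ P : GL (Fin 4) (ZMod ℓ),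
      CarriesForm P (formIsotropic (ZMod ℓ)) (formIsotropic (ZMod ℓ)) ∧
      inBasis P (G ⊓ Sp (formIsotropic (ZMod ℓ))) =
        (squareMonomial (ZMod ℓ)).map (blockDiagInvTranspose (ZMod ℓ)) := by
  obtain ⟨hneg, x, y, hxy, hH, b, hb, hbs, hbd⟩ := exists_pair_isotropic hℓ hG hline hblk hk hg
  set Q := ofColumns x y hxy with hQ
  have hP := carriesForm_blockDiagInvTranspose Q
  refine ⟨hneg, blockDiagInvTranspose (ZMod ℓ) Q, hP, ?_⟩
  rw [inBasis_inf_Sp hP]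
  refine inf_Sp_eq_squareMonomial (B := Q⁻¹ * b * invTranspose (ZMod ℓ) Q) (hG.inBasis hP) ?_ hk
    hneg ?_ ?_
  · rw [← inBasis_inf_Sp hP]
    intro z hz
    rw [mem_inBasis] at hz
    obtain ⟨a, ha⟩ := hblk _ hz
    refine ⟨Q⁻¹ * a * Q, mem_squareMonomial_of_pair hxy (hH a (ha ▸ hz.1)), ?_⟩
    rw [map_mul, map_mul, map_inv, ← ha]
    group
  · have h1 : Q⁻¹ * b * invTranspose (ZMod ℓ) Q =
        Matrix.GeneralLinearGroup.scalar (Fin 2) (Matrix.GeneralLinearGroup.det Q)⁻¹ *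
          (Q⁻¹ * (b * weyl (ZMod ℓ)) * Q * (weyl (ZMod ℓ))⁻¹) := by
      have h2 := weyl_conj Q
      rw [← inv_mul_eq_iff_eq_mul, ← map_inv] at h2
      rw [← h2, ← mul_assoc, mul_scalar_comm]
      simp only [mul_assoc]
    obtain ⟨e1, e2⟩ := conj_antidiagonal_of_swaps hxy hbs
    have hdet : (Q⁻¹ * (b * weyl (ZMod ℓ)) * Q).1.det = b.1.det := by
      rw [Units.val_mul, Matrix.det_mul_comm, ← Units.val_mul, ← det_mul_weyl b]
      congr 2
      group
    set M := Q⁻¹ * (b * weyl (ZMod ℓ)) * Q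
    set d := (Matrix.GeneralLinearGroup.det Q)⁻¹
    rw [h1, mem_squareMonomial, scalar_mul_val, Units.val_mul, weyl_inv_val]
    left
    rw [Matrix.det_fin_two, e1, zero_mul, zero_sub] at hdet
    simp [Matrix.mul_apply, Fin.sum_univ_two, e1, e2]
    have : (d : ZMod ℓ) * M.1 0 1 * ((d : ZMod ℓ) * M.1 1 0) = - ((d : ZMod ℓ) ^ 2 * b.1.det) := by
      linear_combination -(d : ZMod ℓ) ^ 2 * hdet
    rw [this, neg_neg]
    exact (IsSquare.sq _).mul hbd
  · rw [mem_inBasis]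
    have h1 : blockDiagInvTranspose (ZMod ℓ) Q *
        (blockDiagInvTranspose (ZMod ℓ) (Q⁻¹ * b * invTranspose (ZMod ℓ) Q) * antiBlock k) *
        (blockDiagInvTranspose (ZMod ℓ) Q)⁻¹ = blockDiagInvTranspose (ZMod ℓ) b * antiBlock k := by
      rw [mul_inv_eq_iff_eq_mul, mul_assoc (blockDiagInvTranspose (ZMod ℓ) b), antiBlock_mul,
        ← mul_assoc, ← mul_assoc, ← map_mul, ← map_mul]
      congr 2
      group
    rwa [h1]

end Isotropic

/-! ### The normaliser of the split Cartan and its subgroup of index two -/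

section SplitNormalizer

variable {F : Type*} [Field F]

theorem mem_splitCartan {a : GL (Fin 2) F} :
    a ∈ splitCartan F ↔ a.1 0 1 = 0 ∧ a.1 1 0 = 0 := by
  constructor
  · rintro ⟨d, rfl⟩
    exact ⟨Matrix.diagonal_apply_ne _ (by decide), Matrix.diagonal_apply_ne _ (by decide)⟩
  · rintro ⟨h1, h2⟩
    have hd := det_ne_zero a
    rw [Matrix.det_fin_two, h1, zero_mul, sub_zero] at hd
    have h00 := left_ne_zero_of_mul hd
    have h11 := right_ne_zero_of_mul hd
    refine ⟨⟨![a.1 0 0, a.1 1 1], ![(a.1 0 0)⁻¹, (a.1 1 1)⁻¹], ?_, ?_⟩, ?_⟩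
    · ext i
      fin_cases i <;> simp [h00, h11]
    · ext i
      fin_cases i <;> simp [h00, h11]
    · ext i j
      fin_cases i <;> fin_cases j <;> simp [h1, h2]

theorem conj_mem_splitCartan {x a : GL (Fin 2) F}
    (hx : (x.1 0 1 = 0 ∧ x.1 1 0 = 0) ∨ (x.1 0 0 = 0 ∧ x.1 1 1 = 0)) (ha : a ∈ splitCartan F) :
    x * a * x⁻¹ ∈ splitCartan F := by
  rw [mem_splitCartan] at ha ⊢
  obtain ⟨h1, h2⟩ := ha
  simp only [Units.val_mul, inv_val_eq]
  rcases hx with ⟨h3, h4⟩ | ⟨h3, h4⟩ <;>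
  simp [Matrix.mul_apply, Fin.sum_univ_two, h1, h2, h3, h4]

/-- Testing the normalising condition on `diag(1, -1)` alone forces a zero in each row. This needs
`2 ≠ 0`. -/
theorem mem_splitNormalizerGL (h2 : (2 : F) ≠ 0) {x : GL (Fin 2) F} :
    x ∈ splitNormalizerGL F ↔
      (x.1 0 1 = 0 ∧ x.1 1 0 = 0) ∨ (x.1 0 0 = 0 ∧ x.1 1 1 = 0) := by
  rw [splitNormalizerGL, Subgroup.mem_normalizer_iff]
  constructor
  · intro h
    let t : GL (Fin 2) F := ⟨!![1, 0; 0, -1], !![1, 0; 0, -1],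
      by ext i j; fin_cases i <;> fin_cases j <;> simp,
      by ext i j; fin_cases i <;> fin_cases j <;> simp⟩
    have h1 := (h t).1 (mem_splitCartan.2 ⟨rfl, rfl⟩)
    rw [mem_splitCartan] at h1
    have e : x.1 * t.1 = (x * t * x⁻¹).1 * x.1 := by
      rw [← Units.val_mul, ← Units.val_mul, inv_mul_cancel_right]
    set D := (x * t * x⁻¹).1
    have e00 := congrFun (congrFun e 0) 0
    have e01 := congrFun (congrFun e 0) 1
    have e10 := congrFun (congrFun e 1) 0
    have e11 := congrFun (congrFun e 1) 1
    simp [Matrix.mul_apply, Fin.sum_univ_two, t, h1.1, h1.2] at e00 e01 e10 e11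
    have hd := det_ne_zero x
    rw [Matrix.det_fin_two] at hd
    have n0 : x.1 0 0 * x.1 0 1 = 0 := by
      apply (mul_eq_zero.1 _).resolve_left h2
      linear_combination x.1 0 1 * e00 - x.1 0 0 * e01
    have n1 : x.1 1 0 * x.1 1 1 = 0 := by
      apply (mul_eq_zero.1 _).resolve_left h2
      linear_combination x.1 1 1 * e10 - x.1 1 0 * e11
    rcases mul_eq_zero.1 n0 with h3 | h3 <;> rcases mul_eq_zero.1 n1 with h4 | h4
    · simp [h3, h4] at hd
    · exact Or.inr ⟨h3, h4⟩
    · exact Or.inl ⟨h3, h4⟩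
    · simp [h3, h4] at hd
  · intro hx a
    refine ⟨fun ha => conj_mem_splitCartan hx ha, fun ha => ?_⟩
    have hx' : ((x⁻¹).1 0 1 = 0 ∧ (x⁻¹).1 1 0 = 0) ∨ ((x⁻¹).1 0 0 = 0 ∧ (x⁻¹).1 1 1 = 0) := by
      rw [inv_val_eq]
      rcases hx with ⟨h3, h4⟩ | ⟨h3, h4⟩
      · left; simp [h3, h4]
      · right; simp [h3, h4]
    have := conj_mem_splitCartan hx' ha
    simpa [mul_assoc] using this

theorem squareMonomial_le (h2 : (2 : F) ≠ 0) : squareMonomial F ≤ splitNormalizerGL F := by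
  intro x hx
  rw [mem_splitNormalizerGL h2]
  exact hx.imp (fun h => ⟨h.1, h.2.1⟩) (fun h => ⟨h.1, h.2.1⟩)

variable {ℓ : ℕ} [Fact ℓ.Prime]

theorem isSquare_neg_iff (hneg : ¬ IsSquare (-1 : ZMod ℓ)) {u : ZMod ℓ} (hu : u ≠ 0) :
    IsSquare (-u) ↔ ¬ IsSquare u := by
  constructor
  · intro h1 h2
    apply hneg
    have := h1.div h2
    rwa [neg_div, div_self hu] at this
  · intro h
    exact isSquare_neg_of_not_isSquare h hneg

/-- Multiplication by `diag(1, -1)` negates the product of the nonzero entries, which toggles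
squareness when `-1` is a nonsquare. -/
theorem relIndex_squareMonomial (hℓ : ℓ ≠ 2) (hneg : ¬ IsSquare (-1 : ZMod ℓ)) :
    (squareMonomial (ZMod ℓ)).relIndex (splitNormalizerGL (ZMod ℓ)) = 2 := by
  have h2 := two_ne_zero_zmod hℓ
  rw [Subgroup.relIndex, Subgroup.index_eq_two_iff]
  let t : GL (Fin 2) (ZMod ℓ) := ⟨!![1, 0; 0, -1], !![1, 0; 0, -1],
      by ext i j; fin_cases i <;> fin_cases j <;> simp,
      by ext i j; fin_cases i <;> fin_cases j <;> simp⟩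
  refine ⟨⟨t, (mem_splitNormalizerGL h2).2 (Or.inl ⟨rfl, rfl⟩)⟩, ?_⟩
  rintro ⟨b, hb⟩
  rw [Subgroup.mem_subgroupOf, Subgroup.mem_subgroupOf]
  simp only [Subgroup.coe_mul]
  have hd := det_ne_zero b
  rw [Matrix.det_fin_two] at hd
  rw [mem_squareMonomial, mem_squareMonomial, Units.val_mul]
  rcases (mem_splitNormalizerGL h2).1 hb with ⟨h3, h4⟩ | ⟨h3, h4⟩
  · rw [h3, zero_mul, sub_zero] at hd
    have h5 := left_ne_zero_of_mul hd
    have := isSquare_neg_iff hneg hd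
    simp [Matrix.mul_apply, Fin.sum_univ_two, h3, h4, t, h5, this]
  · rw [h3, zero_mul, zero_sub, neg_ne_zero] at hd
    have h5 := left_ne_zero_of_mul hd
    have := isSquare_neg_iff hneg hd
    simp [Matrix.mul_apply, Fin.sum_univ_two, h3, h4, t, h5, this]

end SplitNormalizer

/-! ### `K` as an extension of `H` by a cyclic group -/

section Extension

variable {ℓ : ℕ} [Fact ℓ.Prime]

/-- A direct product decomposition gives a group extension. -/
def groupExtensionOfProd {N N' E H : Type*} [Group N] [Group N'] [Group E] [Group H]
    (e : E ≃* N' × H) (f : N ≃* N') : GroupExtension N E H where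
  inl := e.symm.toMonoidHom.comp ((MonoidHom.inl N' H).comp f.toMonoidHom)
  rightHom := (MonoidHom.snd N' H).comp e.toMonoidHom
  inl_injective := by
    intro a b h
    have h1 := congrArg (fun x => (e x).1) h
    simpa using h1
  range_inl_eq_ker_rightHom := by
    ext x
    rw [MonoidHom.mem_range, MonoidHom.mem_ker]
    constructor
    · rintro ⟨n, rfl⟩
      simp
    · intro h
      refine ⟨f.symm (e x).1, ?_⟩
      apply e.injective
      refine Prod.ext ?_ ?_
      · simp
      · simpa using h.symm
  rightHom_surjective := by
    intro h
    exact ⟨e.symm (1, h), by simp⟩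

theorem nonempty_mulEquiv_squares (hℓ : ℓ ≠ 2) :
    Nonempty (Multiplicative (ZMod ((ℓ - 1) / 2)) ≃*
      (powMonoidHom 2 : (ZMod ℓ)ˣ →* (ZMod ℓ)ˣ).range) := by
  set f : (ZMod ℓ)ˣ →* (ZMod ℓ)ˣ := powMonoidHom 2
  have h1 := f.ker.card_mul_index
  rw [card_units_sq_eq_one hℓ f.ker (fun c => Iff.rfl), Subgroup.index_ker,
    Nat.card_eq_fintype_card (α := (ZMod ℓ)ˣ), ZMod.card_units] at h1
  have hcard : Nat.card f.range = (ℓ - 1) / 2 := by omega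
  have hcyc : IsCyclic f.range := inferInstance
  exact ⟨hcard ▸ zmodCyclicMulEquiv hcyc⟩

/-- When `-1` is a nonsquare, the nonzero scalars are the direct product of the squares and `±1`.
Since `G¹` contains `±1` and meets the square scalars trivially, `K` is a direct product. -/
theorem nonempty_saturation_mulEquiv (hneg : ¬ IsSquare (-1 : ZMod ℓ))
    {J : Matrix (Fin 4) (Fin 4) (ZMod ℓ)} (hJ : J ≠ 0) {G : Subgroup (GL (Fin 4) (ZMod ℓ))}
    (hsc : scalars 4 (ZMod ℓ) ≤ G) :
    Nonempty (saturation (G ⊓ Sp J) ≃*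
      (powMonoidHom 2 : (ZMod ℓ)ˣ →* (ZMod ℓ)ˣ).range × (G ⊓ Sp J : Subgroup _)) := by
  set f : (ZMod ℓ)ˣ →* (ZMod ℓ)ˣ := powMonoidHom 2 with hf
  let φ : f.range × (G ⊓ Sp J : Subgroup _) →* saturation (G ⊓ Sp J) :=
    { toFun := fun p => ⟨Matrix.GeneralLinearGroup.scalar (Fin 4) p.1.1 * p.2.1,
        mem_saturation.2 ⟨_, _, p.2.2, rfl⟩⟩
      map_one' := by simp
      map_mul' := by
        intro p q
        apply Subtype.ext
        simp only [Prod.fst_mul, Prod.snd_mul, Subgroup.coe_mul, map_mul]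
        rw [mul_assoc, mul_assoc, ← mul_assoc p.2.1, mul_scalar_comm p.2.1, mul_assoc _ p.2.1] }
  refine ⟨(MulEquiv.ofBijective φ ⟨?_, ?_⟩).symm⟩
  · rw [injective_iff_map_eq_one]
    rintro ⟨⟨_, s, rfl⟩, ⟨h, hh⟩⟩ hφ
    have h1 : Matrix.GeneralLinearGroup.scalar (Fin 4) (s ^ 2) * h = 1 := congrArg Subtype.val hφ
    have h2 : (s ^ 2) ^ 2 = (1 : (ZMod ℓ)ˣ) := by
      have h3 := (isSim_scalar (J := J) (s ^ 2)).mul (mem_Sp.1 hh.2)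
      rw [h1, mul_one] at h3
      exact h3.unique hJ (mem_Sp.1 (Sp J).one_mem)
    have h4 : s ^ 2 = 1 := by
      have h5 : ((s : ZMod ℓ) ^ 2) ^ 2 = 1 := by simpa using congrArg Units.val h2
      rcases sq_eq_one_iff.1 h5 with h6 | h6
      · exact Units.ext (by simpa using h6)
      · exact absurd ⟨(s : ZMod ℓ), by rw [← h6, pow_two]⟩ hneg
    rw [h4, map_one, one_mul] at h1
    exact Prod.ext (Subtype.ext h4) (Subtype.ext h1)
  · rintro ⟨x, hx⟩
    obtain ⟨c, g, hg, rfl⟩ := mem_saturation.1 hx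
    by_cases hc : IsSquare c
    · obtain ⟨s, rfl⟩ := hc
      refine ⟨⟨⟨s * s, s, pow_two s⟩, ⟨g, hg⟩⟩, rfl⟩
    · have h1 : ¬ IsSquare (-1 : (ZMod ℓ)ˣ) := by
        rwa [isSquare_units_iff, Units.val_neg, Units.val_one]
      obtain ⟨s, hs⟩ := isSquare_mul_units h1 hc
      have h2 : Matrix.GeneralLinearGroup.scalar (Fin 4) (-1) * g ∈ G ⊓ Sp J := by
        refine (G ⊓ Sp J).mul_mem ⟨hsc (scalar_mem_scalars _), mem_Sp.2 ?_⟩ hg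
        have := isSim_scalar (J := J) (n := 4) (-1 : (ZMod ℓ)ˣ)
        rwa [neg_one_sq] at this
      refine ⟨⟨⟨s * s, s, pow_two s⟩, ⟨_, h2⟩⟩, Subtype.ext ?_⟩
      change Matrix.GeneralLinearGroup.scalar (Fin 4) (s * s) *
        (Matrix.GeneralLinearGroup.scalar (Fin 4) (-1) * g) = _
      rw [← mul_assoc, ← map_mul, ← hs]
      congr 2
      simp

theorem nonempty_groupExtension (hℓ : ℓ ≠ 2) (hneg : ¬ IsSquare (-1 : ZMod ℓ))
    {J : Matrix (Fin 4) (Fin 4) (ZMod ℓ)} (hJ : J ≠ 0) {G : Subgroup (GL (Fin 4) (ZMod ℓ))}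
    (hsc : scalars 4 (ZMod ℓ) ≤ G) {P : GL (Fin 4) (ZMod ℓ)} {H : Subgroup (GL (Fin 2) (ZMod ℓ))}
    (hH : inBasis P (G ⊓ Sp J) = H.map (blockDiagInvTranspose (ZMod ℓ))) :
    Nonempty (GroupExtension (Multiplicative (ZMod ((ℓ - 1) / 2))) (saturation (G ⊓ Sp J)) H) := by
  obtain ⟨e⟩ := nonempty_saturation_mulEquiv hneg hJ hsc
  obtain ⟨f⟩ := nonempty_mulEquiv_squares hℓ
  have e1 : (G ⊓ Sp J : Subgroup _) ≃* inBasis P (G ⊓ Sp J) :=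
    (G ⊓ Sp J).equivMapOfInjective _ (MulAut.conj P⁻¹).injective
  have e2 : H ≃* H.map (blockDiagInvTranspose (ZMod ℓ)) :=
    H.equivMapOfInjective _ blockDiagInvTranspose_injective
  have e3 := (e1.trans (MulEquiv.subgroupCongr hH)).trans e2.symm
  exact ⟨groupExtensionOfProd (e.trans (MulEquiv.prodCongr (MulEquiv.refl _) e3)) f⟩

end Extension

/-! ### From a totally isotropic stable plane to the second case -/

section IsotropicCase

variable {ℓ : ℕ} [Fact ℓ.Prime] {J : Matrix (Fin 4) (Fin 4) (ZMod ℓ)}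

theorem IsTotallyIsotropic.map {n : ℕ} {F : Type*} [Field F] {J : Matrix (Fin n) (Fin n) F}
    {W : Submodule F (Fin n → F)} (hW : IsTotallyIsotropic J W) {g : GL (Fin n) F} {k : Fˣ}
    (hg : IsSim J g k) : IsTotallyIsotropic J (W.map (Matrix.toLin' g.1)) := by
  rintro _ ⟨v, hv, rfl⟩ _ ⟨w, hw, rfl⟩
  rw [Matrix.toLin'_apply, Matrix.toLin'_apply, hg.toBilin', hW v hv w hw, mul_zero]

theorem isotropic_case {G : Subgroup (GL (Fin 4) (ZMod ℓ))} (hJ : IsSymplecticForm J)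
    (hG : IsMaximalHasseIn (GSp J) G) (hred : ActsReducibly (G ⊓ Sp J))
    {W : Submodule (ZMod ℓ) (Fin 4 → ZMod ℓ)} (hW : IsStable (G ⊓ Sp J) W) (hb : W ≠ ⊥)
    (ht : W ≠ ⊤) (hW2 : Module.finrank (ZMod ℓ) W = 2) (hWi : IsTotallyIsotropic J W) :
    ¬ IsSquare (-1 : ZMod ℓ) ∧ (∃ P : GL (Fin 4) (ZMod ℓ),
      CarriesForm P J (formIsotropic (ZMod ℓ)) ∧ inBasis P (G ⊓ Sp J) =
        (squareMonomial (ZMod ℓ)).map (blockDiagInvTranspose (ZMod ℓ))) ∧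
      ∃ V₁ V₂ : Submodule (ZMod ℓ) (Fin 4 → ZMod ℓ), IsCompl V₁ V₂ ∧
        Module.finrank (ZMod ℓ) V₁ = 2 ∧ Module.finrank (ZMod ℓ) V₂ = 2 ∧
        IsStable (G ⊓ Sp J) V₁ ∧ IsStable (G ⊓ Sp J) V₂ ∧
        IsTotallyIsotropic J V₁ ∧ IsTotallyIsotropic J V₂ := by
  have hJ0 := hJ.ne_zero
  have hℓ := two_ne hJ0 hG hred
  obtain ⟨g, hg, k, hk, hks⟩ := exists_not_isSquare_multiplier hJ0 hG hred
  have hcompl := hW.isCompl_map hJ0 hG hg hk hks hb ht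
  have hV := IsStable.map hG.prop.1 hW hg
  have hVi := hWi.map hk
  have hV2 : Module.finrank (ZMod ℓ) (W.map (Matrix.toLin' g.1)) = 2 := by
    rw [finrank_map_toLin', hW2]
  have hgW : ∀ v ∈ W, g.1 *ᵥ v ∈ W.map (Matrix.toLin' g.1) := fun v hv =>
    ⟨v, hv, Matrix.toLin'_apply _ _⟩
  have hgV : ∀ v ∈ W.map (Matrix.toLin' g.1), g.1 *ᵥ v ∈ W := by
    rintro _ ⟨v, hv, rfl⟩
    rw [Matrix.toLin'_apply]
    exact hW.mul_self_mem hJ0 hG hg hk hv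
  set V := W.map (Matrix.toLin' g.1)
  obtain ⟨P, hP, p0, p1, p2, p3⟩ := exists_frame_isotropic hJ hcompl hWi hVi hW2 hV2
  have hG' := hG.inBasis hP
  have hred' : ActsReducibly (inBasis P G ⊓ Sp (formIsotropic (ZMod ℓ))) := by
    rw [← inBasis_inf_Sp hP]
    exact hred.inBasis
  have hentry : ∀ (x : GL (Fin 4) (ZMod ℓ)) {A B C D : Matrix (Fin 2) (Fin 2) (ZMod ℓ)},
      (P⁻¹ * x * P).1 = mk4 A B C D → ∀ i j, mk4 (-C) (-D) A B i j =
        Matrix.toBilin' J (P.1 *ᵥ Pi.single i 1) (x.1 *ᵥ (P.1 *ᵥ Pi.single j 1)) := by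
    intro x A B C D hx i j
    rw [← hP.mul_conj, hx, formIsotropic_eq, mk4_mul]
    simp
  have hblk : ∀ h ∈ inBasis P G ⊓ Sp (formIsotropic (ZMod ℓ)),
      ∃ a, h = blockDiagInvTranspose (ZMod ℓ) a := by
    intro h hh
    have hh2 := hh
    rw [← inBasis_inf_Sp hP, mem_inBasis] at hh2
    obtain ⟨A, B, C, D, hABCD⟩ := exists_eq_mk4 h.1
    have e := hentry (P * h * P⁻¹) (by rw [← hABCD]; congr 1; group)
    -- The entries of `C` are, up to sign, values of the form on `W`, which is stable and isotropic.
    -- The translate `V` does the same for `B`.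
    have hC : C = 0 := by
      have e00 := e 0 0
      have e01 := e 0 1
      have e10 := e 1 0
      have e11 := e 1 1
      rw [hWi _ p0 _ (hW _ hh2 _ p0)] at e00
      rw [hWi _ p0 _ (hW _ hh2 _ p1)] at e01
      rw [hWi _ p1 _ (hW _ hh2 _ p0)] at e10
      rw [hWi _ p1 _ (hW _ hh2 _ p1)] at e11
      simp [mk4_apply] at e00 e01 e10 e11
      ext i j
      fin_cases i <;> fin_cases j <;> assumption
    have hB : B = 0 := by
      have e00 := e 2 2
      have e01 := e 2 3
      have e10 := e 3 2
      have e11 := e 3 3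
      rw [hVi _ p2 _ (hV _ hh2 _ p2)] at e00
      rw [hVi _ p2 _ (hV _ hh2 _ p3)] at e01
      rw [hVi _ p3 _ (hV _ hh2 _ p2)] at e10
      rw [hVi _ p3 _ (hV _ hh2 _ p3)] at e11
      simp [mk4_apply] at e00 e01 e10 e11
      ext i j
      fin_cases i <;> fin_cases j <;> assumption
    rw [hB, hC] at hABCD
    exact exists_blockDiagInvTranspose hABCD (mem_Sp.1 hh.2)
  have hg' : P⁻¹ * g * P ∈ inBasis P G := mem_inBasis.2 (by simpa [mul_assoc] using hg)
  obtain ⟨b, hb⟩ : ∃ b, P⁻¹ * g * P = blockDiagInvTranspose (ZMod ℓ) b * antiBlock k := by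
    obtain ⟨A, B, C, D, hABCD⟩ := exists_eq_mk4 (P⁻¹ * g * P).1
    have e := hentry g hABCD
    -- Here `g` exchanges `W` and `V`, so the diagonal blocks vanish for the same reason.
    have hD : D = 0 := by
      have e00 := e 0 2
      have e01 := e 0 3
      have e10 := e 1 2
      have e11 := e 1 3
      rw [hWi _ p0 _ (hgV _ p2)] at e00
      rw [hWi _ p0 _ (hgV _ p3)] at e01
      rw [hWi _ p1 _ (hgV _ p2)] at e10
      rw [hWi _ p1 _ (hgV _ p3)] at e11
      simp [mk4_apply] at e00 e01 e10 e11
      ext i j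
      fin_cases i <;> fin_cases j <;> assumption
    have hA : A = 0 := by
      have e00 := e 2 0
      have e01 := e 2 1
      have e10 := e 3 0
      have e11 := e 3 1
      rw [hVi _ p2 _ (hgW _ p0)] at e00
      rw [hVi _ p2 _ (hgW _ p1)] at e01
      rw [hVi _ p3 _ (hgW _ p0)] at e10
      rw [hVi _ p3 _ (hgW _ p1)] at e11
      simp [mk4_apply] at e00 e01 e10 e11
      ext i j
      fin_cases i <;> fin_cases j <;> assumption
    rw [hA, hD] at hABCD
    refine exists_mul_antiBlock hABCD (hP.isSim_iff.2 ?_)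
    have e1 : P * (P⁻¹ * g * P) * P⁻¹ = g := by group
    rwa [e1]
  rw [hb] at hg'
  obtain ⟨hneg, R, hR, hRG⟩ := exists_inBasis_eq_squareMonomial hℓ hG'
    (fun v hv => exists_ne_smul isSymplecticForm_formIsotropic.ne_zero hG' hred' hv) hblk hks hg'
  refine ⟨hneg, ⟨P * R, hP.mul hR, ?_⟩, W, V, hcompl, hW2, hV2, hW, hV, hWi, hVi⟩
  rw [inBasis_mul, inBasis_inf_Sp hP, hRG]

end IsotropicCase

/-! ### From a non-singular stable plane to the first or third case -/

section Nonsingular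

variable {F : Type*} [Field F]

theorem isSymplecticForm_formNonsingular : IsSymplecticForm (formNonsingular F) := by
  constructor
  · intro v
    rw [Matrix.toBilin'_apply']
    simp [formNonsingular, Matrix.mulVec, dotProduct, Fin.sum_univ_succ]
    ring
  · exact (Matrix.nondegenerate_of_det_ne_zero det_formNonsingular).toBilin'

theorem transpose_mul_weyl_mul (A : Matrix (Fin 2) (Fin 2) F) :
    Aᵀ * (!![0, 1; -1, 0] : Matrix (Fin 2) (Fin 2) F) * A = A.det • !![0, 1; -1, 0] := by
  rw [Matrix.det_fin_two]
  ext i j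
  fin_cases i <;> fin_cases j <;> simp [Matrix.mul_apply, Fin.sum_univ_two] <;> ring

theorem smul_weyl_inj {a b : F} :
    a • (!![0, 1; -1, 0] : Matrix (Fin 2) (Fin 2) F) = b • !![0, 1; -1, 0] ↔ a = b := by
  constructor
  · intro h
    simpa using congrFun (congrFun h 0) 1
  · rintro rfl
    rfl

theorem isSim_formNonsingular {x : GL (Fin 4) F} {A B C D : Matrix (Fin 2) (Fin 2) F}
    {k : Fˣ} (hx : x.1 = mk4 A B C D) (hs : IsSim (formNonsingular F) x k) :
    A.det + C.det = k ∧ B.det + D.det = k ∧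
      Aᵀ * !![0, 1; -1, 0] * B + Cᵀ * !![0, 1; -1, 0] * D = 0 := by
  rw [IsSim, hx, formNonsingular_eq, mk4_transpose, mk4_mul, mk4_mul, mk4_smul, mk4_inj] at hs
  simp only [Matrix.mul_zero, add_zero, zero_add, smul_zero, transpose_mul_weyl_mul,
    ← add_smul, smul_weyl_inj] at hs
  exact ⟨hs.1, hs.2.2.2, hs.2.1⟩

theorem isSim_blockDiag {p : GL (Fin 2) F × GL (Fin 2) F} (h1 : p.1.1.det = 1)
    (h2 : p.2.1.det = 1) : IsSim (formNonsingular F) (blockDiag F p) 1 := by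
  rw [IsSim, blockDiag_val, formNonsingular_eq, mk4_transpose, mk4_mul, mk4_mul, mk4_smul, mk4_inj]
  simp [transpose_mul_weyl_mul, h1, h2]

theorem exists_blockDiag {x : GL (Fin 4) F} {A D : Matrix (Fin 2) (Fin 2) F}
    (hx : x.1 = mk4 A 0 0 D) (hs : IsSim (formNonsingular F) x 1) :
    ∃ p, x = blockDiag F p ∧ p.1.1.det = 1 ∧ p.2.1.det = 1 := by
  obtain ⟨h1, h2, -⟩ := isSim_formNonsingular hx hs
  rw [Matrix.det_zero, add_zero, Units.val_one] at h1
  rw [Matrix.det_zero, zero_add, Units.val_one] at h2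
  refine ⟨(Matrix.GeneralLinearGroup.mkOfDetNeZero A (h1 ▸ one_ne_zero),
    Matrix.GeneralLinearGroup.mkOfDetNeZero D (h2 ▸ one_ne_zero)), Units.ext ?_, h1, h2⟩
  rw [hx, blockDiag_val]
  rfl

/-- A nonzero matrix intertwining a group without stable line is invertible. -/
theorem det_ne_zero_of_intertwining {M : Matrix (Fin 2) (Fin 2) F} (hM : M ≠ 0)
    (h : ∀ v : Fin 2 → F, v ≠ 0 → ∃ a b : Matrix (Fin 2) (Fin 2) F,
      cross v (a *ᵥ v) ≠ 0 ∧ M * a = b * M) : M.det ≠ 0 := by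
  intro h0
  obtain ⟨u, hu, hMu⟩ := Matrix.exists_mulVec_eq_zero_iff.2 h0
  obtain ⟨a, b, hc, hab⟩ := h u hu
  have h1 : M *ᵥ (a *ᵥ u) = 0 := by
    rw [Matrix.mulVec_mulVec, hab, ← Matrix.mulVec_mulVec, hMu, Matrix.mulVec_zero]
  apply hM
  have h2 : M * (ofColumns u (a *ᵥ u) hc).1 = 0 := by
    rw [ofColumns_val]
    set w := a *ᵥ u
    have e0 := congrFun hMu 0
    have e1 := congrFun hMu 1
    have f0 := congrFun h1 0
    have f1 := congrFun h1 1
    simp only [mulVec_zero_eq, mulVec_one_eq, Pi.zero_apply] at e0 e1 f0 f1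
    ext i j
    fin_cases i <;> fin_cases j <;> simp [Matrix.mul_apply, Fin.sum_univ_two, e0, e1, f0, f1]
  have h3 := congrArg (fun N => N * ((ofColumns u (a *ᵥ u) hc)⁻¹).1) h2
  simpa [Matrix.mul_assoc, ← Units.val_mul] using h3

/-- The first coordinate plane. -/
def firstPlane (F : Type*) [Field F] : Submodule F (Fin 4 → F) where
  carrier := {x | x 2 = 0 ∧ x 3 = 0}
  add_mem' := by
    rintro x y ⟨h1, h2⟩ ⟨h3, h4⟩
    exact ⟨by simp [h1, h3], by simp [h2, h4]⟩
  zero_mem' := ⟨rfl, rfl⟩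
  smul_mem' := by
    rintro c x ⟨h1, h2⟩
    exact ⟨by simp [h1], by simp [h2]⟩

theorem mem_firstPlane {x : Fin 4 → F} : x ∈ firstPlane F ↔ ∃ u, x = vec4 u 0 := by
  constructor
  · rintro ⟨h1, h2⟩
    obtain ⟨u, v, rfl⟩ := exists_eq_vec4 x
    refine ⟨u, vec4_inj.2 ⟨rfl, ?_⟩⟩
    ext i
    fin_cases i
    exacts [h1, h2]
  · rintro ⟨u, rfl⟩
    exact ⟨rfl, rfl⟩

/-- Correcting a change of basis by a diagonal matrix makes it symplectic without affecting the
Cartan normaliser. -/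
theorem det_one_normalize (q : GL (Fin 2) F) :
    ∃ t ∈ splitCartan F, (q * t).1.det = 1 := by
  have hd := det_ne_zero q
  refine ⟨Matrix.GeneralLinearGroup.mkOfDetNeZero !![1, 0; 0, (q.1.det)⁻¹]
    (by simpa [Matrix.det_fin_two_of] using hd), mem_splitCartan.2 ⟨rfl, rfl⟩, ?_⟩
  rw [Units.val_mul, Matrix.det_mul]
  change q.1.det * (!![1, 0; 0, (q.1.det)⁻¹] : Matrix (Fin 2) (Fin 2) F).det = 1
  rw [Matrix.det_fin_two_of, one_mul, mul_zero, sub_zero, mul_inv_cancel₀ hd]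

theorem conj_mem_splitNormalizerSL (h2 : (2 : F) ≠ 0) {a t : GL (Fin 2) F} {x y : Fin 2 → F}
    (h : cross x y ≠ 0) (ha : Fixes a.1 x y ∨ Swaps a.1 x y) (hd : a.1.det = 1)
    (ht : t ∈ splitCartan F) :
    t⁻¹ * ((ofColumns x y h)⁻¹ * a * ofColumns x y h) * t ∈ splitNormalizerSL F := by
  refine ⟨?_, ?_⟩
  · have htN : t ∈ splitNormalizerGL F := Subgroup.le_normalizer ht
    refine (splitNormalizerGL F).mul_mem ((splitNormalizerGL F).mul_mem
      ((splitNormalizerGL F).inv_mem htN) ?_) htN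
    rw [mem_splitNormalizerGL h2]
    exact ha.imp (conj_diagonal_of_fixes h) (conj_antidiagonal_of_swaps h)
  · change _ ∈ (Matrix.GeneralLinearGroup.det : GL (Fin 2) F →* Fˣ).ker
    have hd' : Matrix.GeneralLinearGroup.det a = 1 := Units.ext hd
    rw [MonoidHom.mem_ker]
    simp only [map_mul, map_inv, hd', mul_one, inv_mul_cancel]

theorem disc_conj (Y d : GL (Fin 2) F) : disc (Y * d * Y⁻¹).1 = disc d.1 := by
  have h1 : (Y * d * Y⁻¹).1.trace = d.1.trace := by
    rw [Units.val_mul, Matrix.trace_mul_comm, ← Units.val_mul]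
    congr 2
    group
  have h2 : (Y * d * Y⁻¹).1.det = d.1.det := by
    rw [Units.val_mul, Matrix.det_mul_comm, ← Units.val_mul]
    congr 2
    group
  rw [disc, disc, h1, h2]

theorem isSquare_disc_of_eigenvalue_blockDiag {p : GL (Fin 2) F × GL (Fin 2) F}
    (h : ∃ c, Module.End.HasEigenvalue (Matrix.toLin' (blockDiag F p).1) c) :
    IsSquare (disc p.1.1) ∨ IsSquare (disc p.2.1) := by
  obtain ⟨c, h⟩ := h
  obtain ⟨x, hx, hcx⟩ := (hasEigenvalue_iff _ _).1 h
  obtain ⟨u, v, rfl⟩ := exists_eq_vec4 x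
  rw [blockDiag_val, mk4_mulVec, smul_vec4, vec4_inj] at hcx
  simp only [Matrix.zero_mulVec, add_zero, zero_add] at hcx
  rcases vec4_ne_zero.1 hx with hu | hv
  · exact Or.inl (isSquare_disc_of_cross hu (by rw [hcx.1, cross_smul_right, cross_self, mul_zero]))
  · exact Or.inr (isSquare_disc_of_cross hv (by rw [hcx.2, cross_smul_right, cross_self, mul_zero]))

theorem blockDiag_injective : Function.Injective (blockDiag F) := by
  intro p q h
  have h1 := congrArg Units.val h
  rw [blockDiag_val, blockDiag_val, mk4_inj] at h1
  exact Prod.ext (Units.ext h1.1) (Units.ext h1.2.2.2)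

variable {ℓ : ℕ} [Fact ℓ.Prime]

/-- The homomorphism `(a, d) ↦ diag(a, Y d Y⁻¹)`. -/
def twistedBlockDiag (Y : GL (Fin 2) F) : GL (Fin 2) F × GL (Fin 2) F →* GL (Fin 4) F :=
  (blockDiag F).comp ((MonoidHom.id _).prodMap (MulAut.conj Y).toMonoidHom)

theorem twistedBlockDiag_apply (Y a d : GL (Fin 2) F) :
    twistedBlockDiag Y (a, d) = blockDiag F (a, Y * d * Y⁻¹) := rfl

/-- The two coordinate representations of the symplectic part become exchanged by a twist. -/
theorem exists_twist {G : Subgroup (GL (Fin 4) (ZMod ℓ))}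
    (hG : IsMaximalHasseIn (GSp (formNonsingular (ZMod ℓ))) G)
    (hred : ActsReducibly (G ⊓ Sp (formNonsingular (ZMod ℓ))))
    (hblk : ∀ h ∈ G ⊓ Sp (formNonsingular (ZMod ℓ)), ∃ p, h = blockDiag (ZMod ℓ) p ∧
      p.1.1.det = 1 ∧ p.2.1.det = 1) :
    ∃ Y z : GL (Fin 2) (ZMod ℓ),
      (z, z) ∈ (G ⊓ Sp (formNonsingular (ZMod ℓ))).comap (twistedBlockDiag Y) ∧
      ∀ a d, (a, d) ∈ (G ⊓ Sp (formNonsingular (ZMod ℓ))).comap (twistedBlockDiag Y) →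
        (z * d * z⁻¹, a) ∈ (G ⊓ Sp (formNonsingular (ZMod ℓ))).comap (twistedBlockDiag Y) := by
  have hJ0 := (isSymplecticForm_formNonsingular (F := ZMod ℓ)).ne_zero
  have hsc := hG.scalars_le
  obtain ⟨g, hg, k, hk, hks⟩ := exists_not_isSquare_multiplier hJ0 hG hred
  set G1 := G ⊓ Sp (formNonsingular (ZMod ℓ)) with hG1
  have hconj : ∀ {x}, x ∈ G → ∀ h ∈ G1, x * h * x⁻¹ ∈ G1 := by
    intro x hx h hh
    obtain ⟨m, hm⟩ := hG.prop.1 hx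
    exact ⟨G.mul_mem (G.mul_mem hx hh.1) (G.inv_mem hx), mem_Sp.2 ((mem_Sp.1 hh.2).conj hm)⟩
  obtain ⟨A, B, C, D, hABCD⟩ := exists_eq_mk4 g.1
  obtain ⟨d1, d2, d3⟩ := isSim_formNonsingular hABCD hk
  have hint : ∀ a d, blockDiag (ZMod ℓ) (a, d) ∈ G1 → ∃ a' d' : GL (Fin 2) (ZMod ℓ),
      g * blockDiag (ZMod ℓ) (a, d) * g⁻¹ = blockDiag (ZMod ℓ) (a', d') ∧
      A * a.1 = a'.1 * A ∧ C * a.1 = d'.1 * C := by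
    intro a d h
    obtain ⟨⟨a', d'⟩, hp, -⟩ := hblk _ (hconj hg _ h)
    refine ⟨a', d', hp, ?_⟩
    rw [mul_inv_eq_iff_eq_mul] at hp
    have h1 := congrArg Units.val hp
    rw [Units.val_mul, Units.val_mul, hABCD, blockDiag_val, blockDiag_val, mk4_mul, mk4_mul,
      mk4_inj] at h1
    simp only [Matrix.mul_zero, add_zero, zero_add, Matrix.zero_mul] at h1
    exact ⟨h1.1, h1.2.2.1⟩
  have hline : ∀ v : Fin 2 → ZMod ℓ, v ≠ 0 → ∃ a d, blockDiag (ZMod ℓ) (a, d) ∈ G1 ∧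
      cross v (a.1 *ᵥ v) ≠ 0 := by
    intro v hv
    obtain ⟨h, hh, hc⟩ := exists_ne_smul hJ0 hG hred (v := vec4 v 0) (vec4_ne_zero.2 (Or.inl hv))
    obtain ⟨⟨a, d⟩, rfl, -⟩ := hblk h hh
    refine ⟨a, d, hh, fun h0 => ?_⟩
    obtain ⟨c, hc'⟩ := exists_smul_of_cross hv h0
    apply hc c
    rw [blockDiag_val, mk4_mulVec, smul_vec4, hc']
    simp
  -- If `C` vanished, `g` would preserve the first plane, which would then be stable under all of
  -- `G`.
  have hC : C ≠ 0 := by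
    rintro rfl
    have hs : IsStable G1 (firstPlane (ZMod ℓ)) := by
      intro h hh x hx
      obtain ⟨u, rfl⟩ := mem_firstPlane.1 hx
      obtain ⟨⟨a, d⟩, rfl, -⟩ := hblk h hh
      rw [blockDiag_val, mk4_mulVec]
      exact mem_firstPlane.2 ⟨a.1 *ᵥ u, by simp⟩
    have hs2 : IsStable G (firstPlane (ZMod ℓ)) := by
      refine IsStable.of_inf_Sp hs (g := g) (fun x hx => ?_)
        (mem_or_mul_inv_mem_saturation hJ0 hG hg hk hks)
      obtain ⟨u, rfl⟩ := mem_firstPlane.1 hx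
      rw [hABCD, mk4_mulVec]
      exact mem_firstPlane.2 ⟨A *ᵥ u, by simp⟩
    rcases hG.prop.2.2.2 _ hs2 with h | h
    · have h1 : vec4 ![1, 0] 0 ∈ firstPlane (ZMod ℓ) := mem_firstPlane.2 ⟨_, rfl⟩
      rw [h, Submodule.mem_bot] at h1
      simpa [vec4] using congrFun h1 0
    · have h1 : vec4 0 ![1, 0] ∈ firstPlane (ZMod ℓ) := by rw [h]; trivial
      simpa [vec4] using h1.1
  have hCd : C.det ≠ 0 := det_ne_zero_of_intertwining hC fun v hv => by
    obtain ⟨a, d, hh, hc⟩ := hline v hv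
    obtain ⟨a', d', -, -, h1⟩ := hint a d hh
    exact ⟨a.1, d'.1, hc, h1⟩
  let Y : GL (Fin 2) (ZMod ℓ) := Matrix.GeneralLinearGroup.mkOfDetNeZero C hCd
  -- If `A = 0`, then `g` exchanges the planes. Conjugation by `g` gives the symmetry, and `z` is
  -- the first block of `g ^ 2` divided by its multiplier's square root `k`, so that the rescaled `g
  -- ^ 2` lies in `G¹`.
  by_cases hA : A = 0
  · have hD : D = 0 := by
      rw [hA] at d3
      simp only [Matrix.transpose_zero, Matrix.zero_mul, zero_add] at d3
      have h1 : (Cᵀ * !![0, 1; -1, 0]).det ≠ 0 := by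
        rw [Matrix.det_mul, Matrix.det_transpose, Matrix.det_fin_two_of]
        simpa using hCd
      have h2 : IsUnit (Cᵀ * !![0, 1; -1, 0]) := (Matrix.isUnit_iff_isUnit_det _).2 h1.isUnit
      exact (h2.mul_right_eq_zero).1 d3
    have hBd : B.det ≠ 0 := by
      rw [hD, Matrix.det_zero, add_zero] at d2
      rw [d2]
      exact k.ne_zero
    let X : GL (Fin 2) (ZMod ℓ) := Matrix.GeneralLinearGroup.mkOfDetNeZero B hBd
    have hgval : g.1 = mk4 0 X.1 Y.1 0 := by rw [hABCD, hA, hD]; rfl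
    have hgmul : ∀ a d, g * blockDiag (ZMod ℓ) (a, d) =
        blockDiag (ZMod ℓ) (X * d * X⁻¹, Y * a * Y⁻¹) * g := by
      intro a d
      apply Units.ext
      rw [Units.val_mul, Units.val_mul, hgval, blockDiag_val, blockDiag_val, mk4_mul, mk4_mul,
        mk4_inj]
      simp only [Matrix.mul_zero, add_zero, zero_add, Matrix.zero_mul, ← Units.val_mul,
        inv_mul_cancel_right, and_self]
    let s : GL (Fin 2) (ZMod ℓ) := Matrix.GeneralLinearGroup.scalar (Fin 2) k⁻¹
    have hs : ∀ x, x * s = s * x := fun x => mul_scalar_comm x _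
    have hss : (Matrix.GeneralLinearGroup.scalar (Fin 4) k⁻¹ : GL (Fin 4) (ZMod ℓ)) =
        blockDiag (ZMod ℓ) (s, s) := by
      apply Units.ext
      change _ = mk4 s.1 0 0 s.1
      rw [show s.1 = _ from scalar_val _, scalar_val, ← mk4_one, mk4_smul, smul_zero]
    refine ⟨Y, s * (X * Y), ?_, ?_⟩
    · rw [Subgroup.mem_comap, twistedBlockDiag_apply]
      have h1 : blockDiag (ZMod ℓ) (s * (X * Y), Y * (s * (X * Y)) * Y⁻¹) =
          Matrix.GeneralLinearGroup.scalar (Fin 4) k⁻¹ * (g * g) := by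
        have h2 : g * g = blockDiag (ZMod ℓ) (X * Y, Y * X) := by
          apply Units.ext
          rw [Units.val_mul, hgval, blockDiag_val, mk4_mul, mk4_inj]
          simp
        rw [h2, hss, ← map_mul, Prod.mk_mul_mk, ← mul_assoc Y, hs, mul_assoc s, mul_assoc s,
          mul_assoc Y, mul_assoc X, mul_inv_cancel, mul_one]
      rw [h1]
      refine ⟨G.mul_mem (hsc (scalar_mem_scalars _)) (G.mul_mem hg hg), mem_Sp.2 ?_⟩
      have h3 := (isSim_scalar (J := formNonsingular (ZMod ℓ)) k⁻¹).mul (IsSim.mul hk hk)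
      rwa [pow_two, mul_mul_mul_comm, inv_mul_cancel, mul_one] at h3
    · intro a d had
      rw [Subgroup.mem_comap, twistedBlockDiag_apply] at had ⊢
      have h1 := hconj hg _ had
      rw [hgmul, mul_inv_cancel_right] at h1
      have h2 : s * (X * Y) * d * (s * (X * Y))⁻¹ = X * (Y * d * Y⁻¹) * X⁻¹ := by
        rw [mul_inv_eq_iff_eq_mul, ← mul_assoc _ s, hs]
        simp [mul_assoc]
      rwa [h2]
  · have hAd : A.det ≠ 0 := det_ne_zero_of_intertwining hA fun v hv => by
      obtain ⟨a, d, hh, hc⟩ := hline v hv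
      obtain ⟨a', d', -, h1, -⟩ := hint a d hh
      exact ⟨a.1, a'.1, hc, h1⟩
    let X : GL (Fin 2) (ZMod ℓ) := Matrix.GeneralLinearGroup.mkOfDetNeZero A hAd
    -- With `A` and `C` both invertible, the two component representations are equivalent. Twisting
    -- by `Y * X⁻¹` makes the group diagonal, and `z = 1` works.
    have key : ∀ a d, blockDiag (ZMod ℓ) (a, d) ∈ G1 → d = Y * X⁻¹ * a * (Y * X⁻¹)⁻¹ := by
      intro a d h
      have h1 := hconj (G.inv_mem hg) _ h
      obtain ⟨⟨b, c⟩, hbc, -⟩ := hblk _ h1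
      rw [hbc] at h1
      obtain ⟨a', d', e1, e2, e3⟩ := hint b c h1
      rw [← hbc] at e1
      have e4 : blockDiag (ZMod ℓ) (a, d) = blockDiag (ZMod ℓ) (a', d') := by
        rw [← e1]; group
      obtain ⟨rfl, rfl⟩ := Prod.mk.inj (blockDiag_injective e4)
      have e5 : X * b = a * X := Units.ext e2
      have e6 : Y * b = d * Y := Units.ext e3
      have e7 : b = X⁻¹ * a * X := by rw [mul_assoc, ← e5, inv_mul_cancel_left]
      have e8 : d = Y * b * Y⁻¹ := by rw [e6, mul_inv_cancel_right]
      rw [e8, e7]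
      group
    refine ⟨Y * X⁻¹, 1, Subgroup.one_mem _, ?_⟩
    intro a d had
    rw [Subgroup.mem_comap, twistedBlockDiag_apply] at had
    have h1 : d = a := by
      have := key _ _ had
      simpa using this
    subst h1
    rw [Subgroup.mem_comap, twistedBlockDiag_apply]
    simpa using had

theorem carriesForm_blockDiag {p : GL (Fin 2) F × GL (Fin 2) F} (h1 : p.1.1.det = 1)
    (h2 : p.2.1.det = 1) :
    CarriesForm (blockDiag F p) (formNonsingular F) (formNonsingular F) := by
  have := isSim_blockDiag h1 h2
  rwa [IsSim, Units.val_one, one_smul] at this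

/-- The dichotomy is proved for the twisted group and carried back. The second plane receives the
basis `Y * Q` instead of `Q`, and both bases are normalised to determinant one. -/
theorem exists_inBasis_le_splitNormalizer_or_card_le (hℓ : ℓ ≠ 2)
    {G : Subgroup (GL (Fin 4) (ZMod ℓ))}
    (hG : IsMaximalHasseIn (GSp (formNonsingular (ZMod ℓ))) G)
    (hred : ActsReducibly (G ⊓ Sp (formNonsingular (ZMod ℓ))))
    (hblk : ∀ h ∈ G ⊓ Sp (formNonsingular (ZMod ℓ)), ∃ p, h = blockDiag (ZMod ℓ) p ∧
      p.1.1.det = 1 ∧ p.2.1.det = 1) :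
    (IsSquare (-1 : ZMod ℓ) ∧ ∃ P : GL (Fin 4) (ZMod ℓ),
      CarriesForm P (formNonsingular (ZMod ℓ)) (formNonsingular (ZMod ℓ)) ∧
      inBasis P (G ⊓ Sp (formNonsingular (ZMod ℓ))) ≤
        ((splitNormalizerSL (ZMod ℓ)).prod (splitNormalizerSL (ZMod ℓ))).map
          (blockDiag (ZMod ℓ))) ∨
    Nat.card (G ⊓ Sp (formNonsingular (ZMod ℓ)) : Subgroup (GL (Fin 4) (ZMod ℓ))) ≤ 14400 := by
  have hJ0 := (isSymplecticForm_formNonsingular (F := ZMod ℓ)).ne_zero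
  have h2 := two_ne_zero_zmod hℓ
  obtain ⟨Y, z, hz, hsym⟩ := exists_twist hG hred hblk
  set G1 := G ⊓ Sp (formNonsingular (ZMod ℓ)) with hG1
  have hmem : ∀ a d, blockDiag (ZMod ℓ) (a, d) ∈ G1 →
      (a, Y⁻¹ * d * Y) ∈ G1.comap (twistedBlockDiag Y) := by
    intro a d h
    rw [Subgroup.mem_comap, twistedBlockDiag_apply]
    have e : Y * (Y⁻¹ * d * Y) * Y⁻¹ = d := by group
    rwa [e]
  have hdet' : ∀ a d, blockDiag (ZMod ℓ) (a, d) ∈ G1 → a.1.det = 1 ∧ d.1.det = 1 := by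
    intro a d h
    obtain ⟨p, hp, h3, h4⟩ := hblk _ h
    rw [← blockDiag_injective hp] at h3 h4
    exact ⟨h3, h4⟩
  have hdetc : ∀ d : GL (Fin 2) (ZMod ℓ), (Y * d * Y⁻¹).1.det = d.1.det := by
    intro d
    rw [Units.val_mul, Matrix.det_mul_comm, ← Units.val_mul]
    congr 2
    group
  have hdet : ∀ p ∈ G1.comap (twistedBlockDiag Y), p.1.1.det = 1 ∧ p.2.1.det = 1 := by
    rintro ⟨a, d⟩ h
    have h3 : a.1.det = 1 ∧ (Y * d * Y⁻¹).1.det = 1 := hdet' _ _ h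
    rwa [hdetc] at h3
  have hspl : ∀ p ∈ G1.comap (twistedBlockDiag Y),
      IsSquare (disc p.1.1) ∨ IsSquare (disc p.2.1) := by
    rintro ⟨a, d⟩ h
    have h3 := isSquare_disc_of_eigenvalue_blockDiag (p := (a, Y * d * Y⁻¹))
      (hG.prop.2.1 _ (Subgroup.mem_comap.1 h).1)
    rwa [disc_conj] at h3
  have hirr : NoCommonLine ((G1.comap (twistedBlockDiag Y)).map (MonoidHom.fst _ _)) := by
    intro v hv
    obtain ⟨h, hh, hc⟩ := exists_ne_smul hJ0 hG hred (v := vec4 v 0) (vec4_ne_zero.2 (Or.inl hv))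
    obtain ⟨⟨a, d⟩, rfl, -⟩ := hblk h hh
    refine ⟨a, ⟨_, hmem _ _ hh, rfl⟩, fun h0 => ?_⟩
    obtain ⟨c, hc'⟩ := exists_smul_of_cross hv h0
    apply hc c
    rw [blockDiag_val, mk4_mulVec, smul_vec4, hc']
    simp
  rcases exists_pair_or_card_le hℓ (G1.comap (twistedBlockDiag Y)) hdet hspl hirr hz hsym with
    ⟨hneg, x, y, hxy, hpair⟩ | hcard
  · left
    refine ⟨hneg, ?_⟩
    set Q := ofColumns x y hxy with hQ
    obtain ⟨t, ht, htd⟩ := det_one_normalize Q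
    obtain ⟨t', ht', htd'⟩ := det_one_normalize (Y * Q)
    have hP := carriesForm_blockDiag (p := (Q * t, Y * Q * t')) htd htd'
    refine ⟨_, hP, ?_⟩
    intro w hw
    rw [mem_inBasis] at hw
    obtain ⟨⟨a, d⟩, hp, h3, h4⟩ := hblk _ hw
    have hw2 := hw
    rw [hp] at hw2
    have h5 := hpair _ (hmem _ _ hw2)
    have h6 := hdet _ (hmem _ _ hw2)
    refine ⟨(t⁻¹ * (Q⁻¹ * a * Q) * t, t'⁻¹ * (Q⁻¹ * (Y⁻¹ * d * Y) * Q) * t'),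
      ⟨conj_mem_splitNormalizerSL h2 hxy h5.1 h6.1 ht,
        conj_mem_splitNormalizerSL h2 hxy h5.2 h6.2 ht'⟩, ?_⟩
    have h7 : w = (blockDiag (ZMod ℓ) (Q * t, Y * Q * t'))⁻¹ * blockDiag (ZMod ℓ) (a, d) *
        blockDiag (ZMod ℓ) (Q * t, Y * Q * t') := by
      rw [← hp]; group
    rw [h7, ← map_inv, ← map_mul, ← map_mul]
    congr 1
    refine Prod.ext ?_ ?_
    · simp [mul_assoc]
    · simp [mul_assoc]
  · right
    refine le_trans (Nat.card_le_card_of_surjective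
      (fun p : G1.comap (twistedBlockDiag Y) => (⟨twistedBlockDiag Y p.1, p.2⟩ : G1)) ?_) hcard
    rintro ⟨h, hh⟩
    obtain ⟨⟨a, d⟩, rfl, -⟩ := hblk h hh
    refine ⟨⟨_, hmem _ _ hh⟩, Subtype.ext ?_⟩
    change twistedBlockDiag Y _ = _
    rw [twistedBlockDiag_apply]
    congr 2
    group

theorem nonsingular_case {J : Matrix (Fin 4) (Fin 4) (ZMod ℓ)}
    {G : Subgroup (GL (Fin 4) (ZMod ℓ))} (hJ : IsSymplecticForm J)
    (hG : IsMaximalHasseIn (GSp J) G) (hred : ActsReducibly (G ⊓ Sp J))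
    {W : Submodule (ZMod ℓ) (Fin 4 → ZMod ℓ)} (hW : IsStable (G ⊓ Sp J) W) (hb : W ≠ ⊥)
    (hW2 : Module.finrank (ZMod ℓ) W = 2)
    (hWV : IsCompl W ((Matrix.toBilin' J).orthogonal W)) :
    (IsSquare (-1 : ZMod ℓ) ∧ (∃ P : GL (Fin 4) (ZMod ℓ),
      CarriesForm P J (formNonsingular (ZMod ℓ)) ∧ inBasis P (G ⊓ Sp J) ≤
        ((splitNormalizerSL (ZMod ℓ)).prod (splitNormalizerSL (ZMod ℓ))).map
          (blockDiag (ZMod ℓ))) ∧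
      ∃ V₁ V₂ : Submodule (ZMod ℓ) (Fin 4 → ZMod ℓ), IsCompl V₁ V₂ ∧
        Module.finrank (ZMod ℓ) V₁ = 2 ∧ Module.finrank (ZMod ℓ) V₂ = 2 ∧
        IsStable (G ⊓ Sp J) V₁ ∧ IsStable (G ⊓ Sp J) V₂ ∧
        IsNonsingular J V₁ ∧ IsNonsingular J V₂) ∨
    Nat.card (projImage G) ≤ 2 ^ 7 * 3 ^ 2 * 5 ^ 2 := by
  have hJ0 := hJ.ne_zero
  have hℓ := two_ne hJ0 hG hred
  have hV := hW.orthogonal (J := J) inf_le_right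
  have hort : ∀ v ∈ (Matrix.toBilin' J).orthogonal W, ∀ w ∈ W, Matrix.toBilin' J v w = 0 :=
    fun v hv w hw => hJ.1.isRefl _ _ (hv w hw)
  have hort' : ∀ v ∈ W, ∀ w ∈ (Matrix.toBilin' J).orthogonal W, Matrix.toBilin' J v w = 0 :=
    fun v hv w hw => hw v hv
  have hWn : IsNonsingular J W :=
    LinearMap.BilinForm.nondegenerate_restrict_of_disjoint_orthogonal _ hJ.1.isRefl hWV.disjoint
  have hVn : IsNonsingular J ((Matrix.toBilin' J).orthogonal W) := by
    refine LinearMap.BilinForm.nondegenerate_restrict_of_disjoint_orthogonal _ hJ.1.isRefl ?_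
    rw [LinearMap.BilinForm.orthogonal_orthogonal hJ.2 hJ.1.isRefl]
    exact hWV.disjoint.symm
  have hV2 : Module.finrank (ZMod ℓ) ((Matrix.toBilin' J).orthogonal W) = 2 := by
    have := Submodule.finrank_add_eq_of_isCompl hWV
    rw [Module.finrank_fin_fun, hW2] at this
    omega
  have hVb : (Matrix.toBilin' J).orthogonal W ≠ ⊥ := by
    intro h
    rw [h, finrank_bot] at hV2
    omega
  set V := (Matrix.toBilin' J).orthogonal W
  obtain ⟨P, hP, p0, p1, p2, p3⟩ := exists_frame_nonsingular hJ hWV.sup_eq_top hort hb hVb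
  have hG' := hG.inBasis hP
  have hred' : ActsReducibly (inBasis P G ⊓ Sp (formNonsingular (ZMod ℓ))) := by
    rw [← inBasis_inf_Sp hP]
    exact hred.inBasis
  have hblk : ∀ h ∈ inBasis P G ⊓ Sp (formNonsingular (ZMod ℓ)),
      ∃ p, h = blockDiag (ZMod ℓ) p ∧ p.1.1.det = 1 ∧ p.2.1.det = 1 := by
    intro h hh
    have hh2 := hh
    rw [← inBasis_inf_Sp hP, mem_inBasis] at hh2
    obtain ⟨A, B, C, D, hABCD⟩ := exists_eq_mk4 h.1
    have e : ∀ i j, mk4 (!![0, 1; -1, 0] * A) (!![0, 1; -1, 0] * B) (!![0, 1; -1, 0] * C)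
        (!![0, 1; -1, 0] * D) i j = Matrix.toBilin' J (P.1 *ᵥ Pi.single i 1)
          ((P * h * P⁻¹).1 *ᵥ (P.1 *ᵥ Pi.single j 1)) := by
      intro i j
      have e1 : P⁻¹ * (P * h * P⁻¹) * P = h := by group
      rw [← hP.mul_conj, e1, hABCD, formNonsingular_eq, mk4_mul]
      simp
    have hB : B = 0 := by
      have e00 := e 0 2
      have e01 := e 0 3
      have e10 := e 1 2
      have e11 := e 1 3
      rw [hort' _ p0 _ (hV _ hh2 _ p2)] at e00
      rw [hort' _ p0 _ (hV _ hh2 _ p3)] at e01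
      rw [hort' _ p1 _ (hV _ hh2 _ p2)] at e10
      rw [hort' _ p1 _ (hV _ hh2 _ p3)] at e11
      simp [mk4_apply, Matrix.vecMul, dotProduct] at e00 e01 e10 e11
      ext i j
      fin_cases i <;> fin_cases j <;> assumption
    have hC : C = 0 := by
      have e00 := e 2 0
      have e01 := e 2 1
      have e10 := e 3 0
      have e11 := e 3 1
      rw [hort _ p2 _ (hW _ hh2 _ p0)] at e00
      rw [hort _ p2 _ (hW _ hh2 _ p1)] at e01
      rw [hort _ p3 _ (hW _ hh2 _ p0)] at e10
      rw [hort _ p3 _ (hW _ hh2 _ p1)] at e11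
      simp [mk4_apply, Matrix.vecMul, dotProduct] at e00 e01 e10 e11
      ext i j
      fin_cases i <;> fin_cases j <;> assumption
    rw [hB, hC] at hABCD
    exact exists_blockDiag hABCD (mem_Sp.1 hh.2)
  rcases exists_inBasis_le_splitNormalizer_or_card_le hℓ hG' hred' hblk with
    ⟨hneg, R, hR, hRG⟩ | hcard
  · left
    refine ⟨hneg, ⟨P * R, hP.mul hR, ?_⟩, W, V, hWV, hW2, hV2, hW, hV, hWn, hVn⟩
    rw [inBasis_mul, inBasis_inf_Sp hP]
    exact hRG
  · right
    rw [← inBasis_inf_Sp hP] at hcard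
    have h1 : Nat.card (inBasis P (G ⊓ Sp J)) = Nat.card (G ⊓ Sp J : Subgroup _) :=
      (Nat.card_congr ((G ⊓ Sp J).equivMapOfInjective _
        (MulAut.conj P⁻¹).injective).toEquiv).symm
    rw [h1] at hcard
    -- The projective image is at most twice as large as `G¹`, and `2 * 14400 = 2 ^ 7 * 3 ^ 2 * 5 ^
    -- 2`.
    exact (card_projImage_le hJ0 hG hred).trans (by omega)

end Nonsingular

/-! ### `N(C_s)` as a generalised quaternion group -/

section Quaternion

variable {F : Type*} [Field F]

/-- The homomorphism `u ↦ diag(u, u⁻¹)`. -/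
def torusHom (F : Type*) [Field F] : Fˣ →* GL (Fin 2) F where
  toFun u := ⟨!![(u : F), 0; 0, ((u⁻¹ : Fˣ) : F)], !![((u⁻¹ : Fˣ) : F), 0; 0, (u : F)],
    by ext i j; fin_cases i <;> fin_cases j <;> simp,
    by ext i j; fin_cases i <;> fin_cases j <;> simp⟩
  map_one' := by
    apply Units.ext
    ext i j
    fin_cases i <;> fin_cases j <;> simp
  map_mul' u v := by
    apply Units.ext
    ext i j
    fin_cases i <;> fin_cases j <;> simp [Matrix.mul_apply, Fin.sum_univ_two, mul_comm]

theorem torusHom_val (u : Fˣ) : (torusHom F u).1 = !![(u : F), 0; 0, ((u⁻¹ : Fˣ) : F)] := rfl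

theorem torusHom_mul_weyl (u : Fˣ) : torusHom F u * weyl F = weyl F * torusHom F u⁻¹ := by
  apply Units.ext
  rw [Units.val_mul, Units.val_mul, torusHom_val, torusHom_val, weyl_val]
  ext i j
  fin_cases i <;> fin_cases j <;> simp [Matrix.mul_apply, Fin.sum_univ_two]

theorem torusHom_neg_one : torusHom F (-1) = weyl F * weyl F := by
  apply Units.ext
  rw [Units.val_mul, torusHom_val, weyl_val]
  ext i j
  fin_cases i <;> fin_cases j <;> simp [Matrix.mul_apply, Fin.sum_univ_two]

theorem det_torusHom (u : Fˣ) : (torusHom F u).1.det = 1 := by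
  rw [torusHom_val, Matrix.det_fin_two_of]
  simp

theorem torusHom_eq_one {u : Fˣ} (h : torusHom F u = 1) : u = 1 := by
  have h1 : (torusHom F u).1 0 0 = (1 : GL (Fin 2) F).1 0 0 := by rw [h]
  exact Units.ext h1

theorem weyl_mul_torusHom_ne_one (u : Fˣ) : weyl F * torusHom F u ≠ 1 := by
  intro h
  have h1 : (weyl F * torusHom F u).1 0 0 = (1 : GL (Fin 2) F).1 0 0 := by rw [h]
  rw [Units.val_mul, weyl_val, torusHom_val] at h1
  simp at h1

theorem mem_splitNormalizerSL (h2 : (2 : F) ≠ 0) {x : GL (Fin 2) F} :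
    x ∈ splitNormalizerSL F ↔ ∃ u, x = torusHom F u ∨ x = weyl F * torusHom F u := by
  constructor
  · rintro ⟨h1, h3⟩
    have hd : x.1.det = 1 := congrArg Units.val (MonoidHom.mem_ker.1 h3)
    rw [Matrix.det_fin_two] at hd
    rcases (mem_splitNormalizerGL h2).1 h1 with ⟨h4, h5⟩ | ⟨h4, h5⟩
    · rw [h4, zero_mul, sub_zero] at hd
      refine ⟨⟨x.1 0 0, x.1 1 1, hd, by rwa [mul_comm]⟩, Or.inl (Units.ext ?_)⟩
      rw [torusHom_val]
      ext i j
      fin_cases i <;> fin_cases j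
      exacts [rfl, h4, h5, rfl]
    · rw [h4, zero_mul, zero_sub] at hd
      refine ⟨⟨-x.1 1 0, x.1 0 1, by linear_combination hd, by linear_combination hd⟩,
        Or.inr (Units.ext ?_)⟩
      rw [Units.val_mul, weyl_val, torusHom_val]
      ext i j
      fin_cases i <;> fin_cases j <;> simp [Matrix.mul_apply, Fin.sum_univ_two, h4, h5]
  · rintro ⟨u, rfl | rfl⟩
    · refine ⟨(mem_splitNormalizerGL h2).2 (Or.inl ⟨rfl, rfl⟩), ?_⟩
      exact MonoidHom.mem_ker.2 (Units.ext (det_torusHom u))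
    · refine ⟨(mem_splitNormalizerGL h2).2 (Or.inr ?_), ?_⟩
      · rw [Units.val_mul, weyl_val, torusHom_val]
        simp
      · refine MonoidHom.mem_ker.2 (Units.ext ?_)
        change (weyl F * torusHom F u).1.det = 1
        rw [Units.val_mul, Matrix.det_mul, det_weyl, det_torusHom, mul_one]

variable {ℓ : ℕ} [Fact ℓ.Prime]

/-- The class of `n` has order two, and `-1` is the only element of order two in `(ZMod ℓ)ˣ`. This
matches the relation `x ^ 2 = a ^ n`. -/
theorem exists_exponential {n : ℕ} (hn : n ≠ 0) (hℓn : 2 * n = ℓ - 1) :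
    ∃ e : Multiplicative (ZMod (2 * n)) ≃* (ZMod ℓ)ˣ,
      e (Multiplicative.ofAdd (n : ZMod (2 * n))) = -1 := by
  have hcard : Nat.card (ZMod ℓ)ˣ = 2 * n := by
    rw [Nat.card_eq_fintype_card, ZMod.card_units, hℓn]
  let e : Multiplicative (ZMod (2 * n)) ≃* (ZMod ℓ)ˣ :=
    hcard ▸ zmodCyclicMulEquiv (inferInstance : IsCyclic (ZMod ℓ)ˣ)
  refine ⟨e, ?_⟩
  have h1 : e (Multiplicative.ofAdd (n : ZMod (2 * n))) ^ 2 = 1 := by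
    rw [← map_pow, ← ofAdd_nsmul, nsmul_eq_mul, ← Nat.cast_mul, ZMod.natCast_self, ofAdd_zero,
      map_one]
  have h2 : e (Multiplicative.ofAdd (n : ZMod (2 * n))) ≠ 1 := by
    rw [Ne, map_eq_one_iff e e.injective, ofAdd_eq_one, ZMod.natCast_eq_zero_iff]
    intro h
    have := Nat.le_of_dvd (by omega) h
    omega
  have h3 : ((e (Multiplicative.ofAdd (n : ZMod (2 * n))) : (ZMod ℓ)ˣ) : ZMod ℓ) ^ 2 = 1 := by
    rw [← Units.val_pow_eq_pow_val, h1, Units.val_one]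
  rcases sq_eq_one_iff.1 h3 with h4 | h4
  · exact absurd (Units.ext (by simpa using h4)) h2
  · exact Units.ext (by simpa using h4)

/-- The rotations `a i` go to the torus and the elements `xa i` to the Weyl coset. The Weyl element
inverts the torus and squares to `-1`. -/
theorem nonempty_splitNormalizerSL_mulEquiv (hℓ : ℓ ≠ 2) :
    Nonempty (splitNormalizerSL (ZMod ℓ) ≃* QuaternionGroup ((ℓ - 1) / 2)) := by
  have hF := two_ne_zero_zmod hℓ
  have hp := (Fact.out : ℓ.Prime)
  have hodd := hp.eq_two_or_odd'.resolve_left hℓ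
  obtain ⟨m, hm⟩ := hodd
  have hp2 := hp.two_le
  have hn : (ℓ - 1) / 2 = m := by omega
  rw [hn]
  obtain ⟨e, he⟩ := exists_exponential (ℓ := ℓ) (n := m) (by omega) (by omega)
  let u : ZMod (2 * m) → (ZMod ℓ)ˣ := fun i => e (Multiplicative.ofAdd i)
  have u0 : ∀ i, u i = 1 ↔ i = 0 := by
    intro i
    rw [map_eq_one_iff e e.injective, ofAdd_eq_one]
  have uadd : ∀ i j, u (i + j) = u i * u j := fun i j => by
    simp only [u, ofAdd_add, map_mul]
  have usub : ∀ i j, u (i - j) = u i * (u j)⁻¹ := fun i j => by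
    simp only [u, sub_eq_add_neg, ofAdd_add, ofAdd_neg, map_mul, map_inv]
  let f : QuaternionGroup m → GL (Fin 2) (ZMod ℓ)
    | .a i => torusHom (ZMod ℓ) (u i)
    | .xa i => weyl (ZMod ℓ) * torusHom (ZMod ℓ) (u i)
  have fa : ∀ i, f (.a i) = torusHom (ZMod ℓ) (u i) := fun i => rfl
  have fxa : ∀ i, f (.xa i) = weyl (ZMod ℓ) * torusHom (ZMod ℓ) (u i) := fun i => rfl
  have hmem : ∀ q, f q ∈ splitNormalizerSL (ZMod ℓ) := by
    rintro (i | i)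
    · exact (mem_splitNormalizerSL hF).2 ⟨_, Or.inl rfl⟩
    · exact (mem_splitNormalizerSL hF).2 ⟨_, Or.inr rfl⟩
  have hmul : ∀ p q, f (p * q) = f p * f q := by
    rintro (i | i) (j | j)
    · rw [QuaternionGroup.a_mul_a, fa, fa, fa, uadd, map_mul]
    · rw [QuaternionGroup.a_mul_xa, fa, fxa, fxa, ← mul_assoc, torusHom_mul_weyl, mul_assoc,
        ← map_mul, usub, mul_comm (u j)]
    · rw [QuaternionGroup.xa_mul_a, fa, fxa, fxa, uadd, map_mul, mul_assoc]
    · rw [QuaternionGroup.xa_mul_xa, fa, fxa, fxa, mul_assoc, ← mul_assoc (torusHom (ZMod ℓ) (u i)),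
        torusHom_mul_weyl, ← mul_assoc, ← mul_assoc, ← torusHom_neg_one, ← map_mul, ← map_mul,
        usub, uadd, ← he]
      congr 1
      rw [mul_assoc, mul_assoc, mul_comm (u j)]
  let φ : QuaternionGroup m →* splitNormalizerSL (ZMod ℓ) :=
    MonoidHom.mk' (fun q => ⟨f q, hmem q⟩) fun p q => Subtype.ext (hmul p q)
  refine ⟨(MulEquiv.ofBijective φ ⟨?_, ?_⟩).symm⟩
  · rw [injective_iff_map_eq_one]
    rintro (i | i) h
    · have h1 : torusHom (ZMod ℓ) (u i) = 1 := congrArg Subtype.val h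
      rw [(u0 i).1 (torusHom_eq_one h1)]
      rfl
    · exact absurd (congrArg Subtype.val h) (weyl_mul_torusHom_ne_one (u i))
  · rintro ⟨x, hx⟩
    obtain ⟨v, hv⟩ := (mem_splitNormalizerSL hF).1 hx
    have hu : u (e.symm v).toAdd = v := by
      simp only [u, ofAdd_toAdd, MulEquiv.apply_symm_apply]
    rcases hv with rfl | rfl
    · exact ⟨.a (e.symm v).toAdd, Subtype.ext (by change torusHom _ _ = _; rw [hu])⟩
    · exact ⟨.xa (e.symm v).toAdd, Subtype.ext (by change weyl _ * torusHom _ _ = _; rw [hu])⟩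

end Quaternion

end HasseSubgroup

end

theorem theorem4p4 (ℓ : ℕ) [Fact ℓ.Prime] (J : Matrix (Fin 4) (Fin 4) (ZMod ℓ))
    (hJ : HasseSubgroup.IsSymplecticForm J) (G G1 : Subgroup (GL (Fin 4) (ZMod ℓ)))
    (hG : HasseSubgroup.IsMaximalHasseIn (HasseSubgroup.GSp J) G)
    (hG1 : G1 = G ⊓ HasseSubgroup.Sp J)
    (hred : HasseSubgroup.ActsReducibly G1) :
    -- first case: `G = (C_{(ℓ-1)/2} . G¹) . 2` with `G¹ ≤ N(C_s) × N(C_s)`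
    (ℓ ≡ 1 [MOD 4] ∧
      (HasseSubgroup.saturation G1 ≤ G ∧
        (HasseSubgroup.saturation G1).relIndex G = 2 ∧
        ∃ _ : (G1.subgroupOf (HasseSubgroup.saturation G1)).Normal,
          Nonempty ((HasseSubgroup.saturation G1 ⧸ G1.subgroupOf (HasseSubgroup.saturation G1)) ≃*
            Multiplicative (ZMod ((ℓ - 1) / 2)))) ∧
      (∃ P : GL (Fin 4) (ZMod ℓ),
        HasseSubgroup.CarriesForm P J (HasseSubgroup.formNonsingular (ZMod ℓ)) ∧
        HasseSubgroup.inBasis P G1 ≤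
          ((HasseSubgroup.splitNormalizerSL (ZMod ℓ)).prod
            (HasseSubgroup.splitNormalizerSL (ZMod ℓ))).map
              (HasseSubgroup.blockDiag (ZMod ℓ))) ∧
      Nonempty (HasseSubgroup.splitNormalizerSL (ZMod ℓ) ≃* QuaternionGroup ((ℓ - 1) / 2)) ∧
      (∃ V₁ V₂ : Submodule (ZMod ℓ) (Fin 4 → ZMod ℓ), IsCompl V₁ V₂ ∧
        Module.finrank (ZMod ℓ) V₁ = 2 ∧ Module.finrank (ZMod ℓ) V₂ = 2 ∧
        HasseSubgroup.IsStable G1 V₁ ∧ HasseSubgroup.IsStable G1 V₂ ∧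
        HasseSubgroup.IsNonsingular J V₁ ∧ HasseSubgroup.IsNonsingular J V₂)) ∨
    -- second case: `G = (C_{(ℓ-1)/2} . H) . 2` with `H` of index `2` in `N_{GL₂}(C_s)`
    (ℓ ≡ 3 [MOD 4] ∧
      (∃ H : Subgroup (GL (Fin 2) (ZMod ℓ)),
        H ≤ HasseSubgroup.splitNormalizerGL (ZMod ℓ) ∧
        H.relIndex (HasseSubgroup.splitNormalizerGL (ZMod ℓ)) = 2 ∧
        HasseSubgroup.saturation G1 ≤ G ∧
        (HasseSubgroup.saturation G1).relIndex G = 2 ∧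
        Nonempty (GroupExtension (Multiplicative (ZMod ((ℓ - 1) / 2)))
          (HasseSubgroup.saturation G1) H) ∧
        (∃ P : GL (Fin 4) (ZMod ℓ),
          HasseSubgroup.CarriesForm P J (HasseSubgroup.formIsotropic (ZMod ℓ)) ∧
          HasseSubgroup.inBasis P G1 =
            H.map (HasseSubgroup.blockDiagInvTranspose (ZMod ℓ)))) ∧
      (∃ V₁ V₂ : Submodule (ZMod ℓ) (Fin 4 → ZMod ℓ), IsCompl V₁ V₂ ∧
        Module.finrank (ZMod ℓ) V₁ = 2 ∧ Module.finrank (ZMod ℓ) V₂ = 2 ∧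
        HasseSubgroup.IsStable G1 V₁ ∧ HasseSubgroup.IsStable G1 V₂ ∧
        HasseSubgroup.IsTotallyIsotropic J V₁ ∧ HasseSubgroup.IsTotallyIsotropic J V₂)) ∨
    -- third case
    Nat.card (HasseSubgroup.projImage G) ≤ 2 ^ 7 * 3 ^ 2 * 5 ^ 2 := by
  subst hG1
  have hJ0 := hJ.ne_zero
  have hℓ := HasseSubgroup.two_ne hJ0 hG hred
  have hsc := hG.scalars_le
  have hodd : ℓ % 2 = 1 := ((Fact.out : ℓ.Prime).eq_two_or_odd).resolve_left hℓ
  have hsat := HasseSubgroup.saturation_le_of_scalars_le (J := J) hsc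
  have hrel := HasseSubgroup.relIndex_saturation hJ0 hG hred
  have hnorm := HasseSubgroup.normal_inf_Sp_subgroupOf hG.prop.1 hsc
  -- The type of the stable plane decides the case, and whether `-1` is a square fixes `ℓ` modulo
  -- four.
  obtain ⟨W, hW, hb, ht, hW2, hWi | hWV⟩ := HasseSubgroup.exists_stable_plane hJ hG hred
  · obtain ⟨hneg, ⟨P, hP, hPG⟩, hV⟩ :=
      HasseSubgroup.isotropic_case hJ hG hred hW hb ht hW2 hWi
    refine Or.inr (Or.inl ⟨?_, ⟨HasseSubgroup.squareMonomial (ZMod ℓ),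
      HasseSubgroup.squareMonomial_le (HasseSubgroup.two_ne_zero_zmod hℓ),
      HasseSubgroup.relIndex_squareMonomial hℓ hneg, hsat, hrel,
      HasseSubgroup.nonempty_groupExtension hℓ hneg hJ0 hsc hPG, P, hP, hPG⟩, hV⟩)
    have h3 : ℓ % 4 = 3 := by
      by_contra h
      exact hneg (ZMod.exists_sq_eq_neg_one_iff.2 h)
    exact h3
  · rcases HasseSubgroup.nonsingular_case hJ hG hred hW hb hW2 hWV with ⟨hneg, hP, hV⟩ | hcard
    · refine Or.inl ⟨?_, ⟨hsat, hrel, hnorm,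
        HasseSubgroup.nonempty_quotient_mulEquiv hℓ hJ0 hsc⟩, hP,
        HasseSubgroup.nonempty_splitNormalizerSL_mulEquiv hℓ, hV⟩
      have h3 := ZMod.exists_sq_eq_neg_one_iff.1 hneg
      have h1 : ℓ % 4 = 1 := by omega
      exact h1
    · exact Or.inr (Or.inr hcard)
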